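/- Let $k$ be a field of characteristic $0$; all structures are in $\mathbb Z$-graded $k$-vector spaces with the Koszul sign rule, and $(\Sigma V)^i=V^{i-1}$. Consider the following types of structures, given by (not necessarily unital) compositions along all non-empty finite graphs of a class: operads (rooted trees), cyclic operads (trees), properads and PROPs (connected, respectively arbitrary, directed graphs without oriented cycles), wheeled properads and wheeled PROPs (the same with oriented cycles allowed), modular operads (connected graphs with a genus label $g(v)$ at each vertex, all corollas satisfying $2g-2+n>0$). A structure of type $T$ assigns a graded vector space $\mathcal O(X)$ functorially to each corolla $X$ (finite set of flags, with directions and genus as appropriate). It is an untwisted, respectively a $\mathfrak K$-twisted, structure if it has compositions $\bigotimes_v\mathcal O(v)\to\mathcal O(\mathrm{tails}(\Gamma))$, respectively $\mathfrak K(\Gamma)\otimes\bigotimes_v\mathcal O(v)\to\mathcal O(\mathrm{tails}(\Gamma))$ with $\mathfrak K(\Gamma)=\Sigma^{-|E(\Gamma)|}\Lambda^{|E(\Gamma)|}k^{E(\Gamma)}$, of degree $0$, equivariant under isomorphisms of graphs, unital for one-vertex graphs without edges, and compatible with inserting graphs into vertices. An anti-cyclic operad has equivariant, associative gluings ${}_s\circ_t:\mathcal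 O(S)\otimes\mathcal O(T)\to\mathcal O((S\setminus s)\sqcup(T\setminus t))$ of degree $0$ with $a\,{}_s\circ_t b=-(-1)^{|a||b|}\,b\,{}_t\circ_s a$. Let $\mathcal O^\oplus_{\mathbb S}$ be the direct sum, over the isomorphism classes of corollas, of the coinvariants of $\mathcal O$ under the automorphisms of the corolla (e.g. $\bigoplus_n\mathcal O(n)_{\mathbb S_n}$ for operads, $\bigoplus_{n,m}\mathcal O(n,m)_{\mathbb S_n\times\mathbb S_m}$ for PROPs). An odd Lie bracket on a graded space is a bilinear bracket of degree $-1$ satisfying the antisymmetry and Jacobi identities of a graded Lie bracket for the degree $s(a)=|a|+1$. 1. (Odd structures.) (a) For every $\mathfrak K$-twisted structure $\mathcal O$ of one of the seven types (in particular for every $\mathfrak K$-modular operad), there is a unique bilinear bracket on $\mathcal O^\oplus_{\mathbb S}$ with $$\{[a]\bullet[b]\}=\sum_{s,t}(-1)^{|a|}[\circ_{(s,t)}(a\otimes b)]$$ for homogeneous $a$, where the sum is over all flags $s$ of $a$ and $t$ of $b$ that can be joined to an edge (an input and an output in the directed types) and $\circ_{(s,t)}$ is the composition along the two-vertex graph with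 this single edge. It is an odd Lie bracket. (b) The structures defined by shifts carry odd Lie brackets as well: for an odd operad $\Sigma P$, $P$ an operad, and for an odd cyclic operad $\Sigma P$, $P$ an anti-cyclic operad, the brackets of 2 are odd Lie brackets on $(\Sigma P)^\oplus_{\mathbb S}$; for an odd (wheeled) PROP(erad) $s_{\rm out}P$, $s_{\rm out}P(n,m)=\Sigma^mP(n,m)\otimes\mathrm{sgn}_m$, $P$ a (wheeled) PROP(erad), there is a unique bilinear bracket on $(s_{\rm out}P)^\oplus_{\mathbb S}$ with $$\{[L\otimes a]\bullet[M\otimes b]\}=\sum_{s,t}(-1)^{|a|+|L|+|a||M|}\,[\partial_{o}(L\wedge M)\otimes(\circ_{(s,t)}(a\otimes b))],$$ where $L$, $M$ are the wedge products of the outputs of $a$, $b$ in some order, $|L|$, $|M|$ their numbers of factors, $o$ is the output among $s,t$, and $\partial_o$ the left contraction; it is an odd Lie bracket. 2. (Even shifts.) (a) For an operad, PROP, properad, wheeled PROP or wheeled properad $P$ there is a unique bilinear bracket on $P^\oplus_{\mathbb S}$ with $[[a]\circ[b]]=[a\circ b]-(-1)^{|a||b|}[b\circ a]$, where $a\circ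 b$ is the sum of all gluings of an input of $a$ to an output of $b$; it is a graded Lie bracket. (b) For an anti-cyclic operad $P$ there is a unique bilinear bracket on $P^\oplus_{\mathbb S}$ with $[[a]\odot[b]]=\sum_{s,t}[a\,{}_s\circ_tb]$; it is a graded Lie bracket. (c) If $\mathcal O$ is $\mathfrak K$-twisted of any of the types (so that $\Sigma^{-1}\mathcal O$ is anti-modular if $\mathcal O$ is $\mathfrak K$-modular), then the bracket of 1(a) is a graded Lie bracket on $(\Sigma^{-1}\mathcal O)^\oplus_{\mathbb S}$. All these brackets are natural: a morphism of structures of the given kind induces a map of the direct sums of coinvariants that respects the brackets. -/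

import Mathlib

universe u v

noncomputable section

namespace OddBracket

/-! ### Types of operad-like structures, corollas -/

/-- The operad-like types of the two tables. -/
inductive OpType
  | operad | cyclic | prop | properad | wheeledProp | wheeledProperad | modular

/-- The types whose flags are directed (inputs and outputs). -/
def OpType.Directed : OpType → Prop
  | .cyclic => False
  | .modular => False
  | _ => True

/-- A vertex type: a finite set of flags, each an input (`out f = false`) or an output
(`out f = true`), with a genus label.  For the undirected types all flags carry the value
`false`; for the types without genus the label is `0`. -/
structure Corolla where
  Flag : Type
  finite : Finite Flag
  out : Flag → Bool
  genus : ℕ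

attribute [instance] Corolla.finite

namespace Corolla

def numIn (X : Corolla) : ℕ := Nat.card {f : X.Flag // X.out f = false}

def numOut (X : Corolla) : ℕ := Nat.card {f : X.Flag // X.out f = true}

/-- Bijections of flags that respect the direction and the genus. -/
structure Iso (X Y : Corolla) where
  flag : X.Flag ≃ Y.Flag
  out_eq : ∀ f, Y.out (flag f) = X.out f
  genus_eq : Y.genus = X.genus

def Iso.refl (X : Corolla) : Iso X X := ⟨Equiv.refl _, fun _ => rfl, rfl⟩

def Iso.trans {X Y Z : Corolla} (φ : Iso X Y) (ψ : Iso Y Z) : Iso X Z :=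
  ⟨φ.flag.trans ψ.flag, fun f => by simp [ψ.out_eq, φ.out_eq], ψ.genus_eq.trans φ.genus_eq⟩

/-- The standard corolla with `n` inputs, `m` outputs and genus `g`. -/
def std (g n m : ℕ) : Corolla := ⟨Fin n ⊕ Fin m, inferInstance, Sum.isRight, g⟩

theorem std_numIn (g n m : ℕ) : (std g n m).numIn = n := by
  have e : {f : (std g n m).Flag // (std g n m).out f = false} ≃ Fin n :=
    { toFun := fun f => match f with
        | ⟨Sum.inl i, _⟩ => i
        | ⟨Sum.inr _, h⟩ => absurd h (by simp [std])
      invFun := fun i => ⟨Sum.inl i, rfl⟩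
      left_inv := by
        rintro ⟨i | j, h⟩
        · rfl
        · exact absurd h (by simp [std])
      right_inv := fun _ => rfl }
  rw [numIn, Nat.card_congr e, Nat.card_fin]

theorem std_numOut (g n m : ℕ) : (std g n m).numOut = m := by
  have e : {f : (std g n m).Flag // (std g n m).out f = true} ≃ Fin m :=
    { toFun := fun f => match f with
        | ⟨Sum.inr i, _⟩ => i
        | ⟨Sum.inl _, h⟩ => absurd h (by simp [std])
      invFun := fun i => ⟨Sum.inr i, rfl⟩
      left_inv := by
        rintro ⟨i | j, h⟩
        · exact absurd h (by simp [std])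
        · rfl
      right_inv := fun _ => rfl }
  rw [numOut, Nat.card_congr e, Nat.card_fin]

theorem exists_iso_std (X : Corolla) : Nonempty (Iso X (std X.genus X.numIn X.numOut)) := by
  classical
  let e1 : {f : X.Flag // X.out f = false} ≃ Fin X.numIn := Finite.equivFin _
  let e2 : {f : X.Flag // ¬ X.out f = false} ≃ Fin X.numOut :=
    (Equiv.subtypeEquivRight (by simp)).trans (Finite.equivFin {f : X.Flag // X.out f = true})
  let e : X.Flag ≃ Fin X.numIn ⊕ Fin X.numOut :=
    (Equiv.sumCompl (fun f => X.out f = false)).symm.trans (Equiv.sumCongr e1 e2)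
  refine ⟨⟨e, fun f => ?_, rfl⟩⟩
  show (e f).isRight = X.out f
  by_cases h : X.out f = false
  · simp [e, Equiv.sumCompl_symm_apply_of_pos (p := fun f => X.out f = false) h, h]
  · simp [e, Equiv.sumCompl_symm_apply_of_neg (p := fun f => X.out f = false) h]
    simpa using h

end Corolla

/-- Which (genus, number of inputs, number of outputs) occur: one output for operads, no outputs
(all flags alike) for cyclic and modular operads, stability for modular operads. -/
def OpType.Occurs : OpType → ℕ → ℕ → ℕ → Prop
  | .operad, g, _, m => g = 0 ∧ m = 1
  | .cyclic, g, _, m => g = 0 ∧ m = 0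
  | .modular, g, n, m => m = 0 ∧ 2 < 2 * g + n
  | _, g, _, _ => g = 0

/-- The corollas of a given type. -/
def OpType.Vertex (T : OpType) : Type 1 :=
  {X : Corolla // T.Occurs X.genus X.numIn X.numOut}

/-- Isomorphism classes of corollas of a given type. -/
def OpType.Index (T : OpType) : Type :=
  {i : ℕ × ℕ × ℕ // T.Occurs i.1 i.2.1 i.2.2}

open Classical in
instance (T : OpType) : DecidableEq T.Index := Classical.decEq _

/-- The standard corolla of an isomorphism class. -/
def OpType.std (T : OpType) (i : T.Index) : T.Vertex :=
  ⟨Corolla.std i.1.1 i.1.2.1 i.1.2.2, by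
    rw [Corolla.std_numIn, Corolla.std_numOut]; exact i.2⟩

/-- The isomorphism class of a corolla. -/
def OpType.index {T : OpType} (X : T.Vertex) : T.Index :=
  ⟨(X.1.genus, X.1.numIn, X.1.numOut), X.2⟩

/-! ### Graphs -/

/-- Finite graphs: vertices, flags, the vertex of a flag, and an involution on flags whose
two-element orbits are the edges and whose fixed points are the tails.  The vertices are
listed in a linear order; the order enters only through the Koszul rule. -/
structure Graph where
  Vert : Type
  fintype : Fintype Vert
  order : LinearOrder Vert
  Flag : Type
  finite : Finite Flag
  vert : Flag → Vert
  inv : Flag → Flag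
  inv_inv : ∀ f, inv (inv f) = f
  out : Flag → Bool
  genus : Vert → ℕ

attribute [instance] Graph.fintype Graph.order Graph.finite

namespace Graph

/-- The corolla at a vertex. -/
def corolla (Γ : Graph) (w : Γ.Vert) : Corolla :=
  ⟨{f : Γ.Flag // Γ.vert f = w}, inferInstance, fun f => Γ.out f.1, Γ.genus w⟩

/-- The unordered pair `e` of flags is an edge. -/
def IsEdge (Γ : Graph) (e : Sym2 Γ.Flag) : Prop := ∃ f, Γ.inv f ≠ f ∧ e = s(f, Γ.inv f)

def numEdges (Γ : Graph) : ℕ := Nat.card {e : Sym2 Γ.Flag // Γ.IsEdge e}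

/-- An enumeration `e₁, …, e_r` of the edges, i.e. a generator `e₁ ∧ ⋯ ∧ e_r` of the
determinant line of the set of edges. -/
structure EdgeOrder (Γ : Graph) where
  list : List (Sym2 Γ.Flag)
  nodup : list.Nodup
  mem_iff : ∀ e, e ∈ list ↔ Γ.IsEdge e

def Connected (Γ : Graph) : Prop :=
  ∀ w w' : Γ.Vert, Relation.ReflTransGen
    (fun x y => ∃ f, Γ.vert f = x ∧ Γ.vert (Γ.inv f) = y) w w'

/-- A connected graph is a tree when it has one vertex more than edges. -/
def IsTree (Γ : Graph) : Prop :=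
  Γ.Connected ∧ Fintype.card Γ.Vert = Γ.numEdges + 1

/-- Every edge joins an output to an input. -/
def EdgesDirected (Γ : Graph) : Prop := ∀ f, Γ.inv f ≠ f → Γ.out (Γ.inv f) = !Γ.out f

/-- There are no oriented cycles. -/
def NoWheels (Γ : Graph) : Prop :=
  ∀ w : Γ.Vert, ¬ Relation.TransGen
    (fun x y => ∃ f, Γ.inv f ≠ f ∧ Γ.out f = true ∧ Γ.vert f = x ∧ Γ.vert (Γ.inv f) = y) w w

/-- Total genus `∑ g(v) + dim H₁` in the modular case (for a connected graph
`dim H₁ = |E| - |V| + 1`); genus is not recorded otherwise. -/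
def totalGenus (T : OpType) (Γ : Graph) : ℕ :=
  match T with
  | .modular => ∑ w, Γ.genus w + (Γ.numEdges + 1 - Fintype.card Γ.Vert)
  | _ => 0

/-- The result of contracting all edges and merging all vertices: the corolla of the tails. -/
def residue (T : OpType) (Γ : Graph) : Corolla :=
  ⟨{f : Γ.Flag // Γ.inv f = f}, inferInstance, fun f => Γ.out f.1, Γ.totalGenus T⟩

end Graph

/-- The shapes of graphs along which the structures of each type compose. -/
def OpType.Shape : OpType → Graph → Prop
  | .operad, Γ => Γ.IsTree ∧ Γ.EdgesDirected
  | .cyclic, Γ => Γ.IsTree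
  | .prop, Γ => Γ.EdgesDirected ∧ Γ.NoWheels
  | .properad, Γ => Γ.Connected ∧ Γ.EdgesDirected ∧ Γ.NoWheels
  | .wheeledProp, Γ => Γ.EdgesDirected
  | .wheeledProperad, Γ => Γ.Connected ∧ Γ.EdgesDirected
  | .modular, Γ => Γ.Connected

/-- The graphs of type `T`: non-empty, of the right shape, with vertices and total corolla of
type `T`.  (With one output at each vertex, a directed tree is a rooted tree.) -/
structure OpType.Admissible (T : OpType) (Γ : Graph) : Prop where
  nonempty : Nonempty Γ.Vert
  vertex : ∀ w, T.Occurs (Γ.corolla w).genus (Γ.corolla w).numIn (Γ.corolla w).numOut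
  total : T.Occurs (Γ.residue T).genus (Γ.residue T).numIn (Γ.residue T).numOut
  shape : T.Shape Γ

namespace Graph

def at' {T : OpType} (Γ : Graph) (h : T.Admissible Γ) (w : Γ.Vert) : T.Vertex :=
  ⟨Γ.corolla w, h.vertex w⟩

def total {T : OpType} (Γ : Graph) (h : T.Admissible Γ) : T.Vertex :=
  ⟨Γ.residue T, h.total⟩

/-- Isomorphisms of graphs; they need not respect the order of the vertices. -/
structure Iso (Γ Γ' : Graph) where
  vertE : Γ.Vert ≃ Γ'.Vert
  flagE : Γ.Flag ≃ Γ'.Flag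
  vert_flag : ∀ f, Γ'.vert (flagE f) = vertE (Γ.vert f)
  inv_flag : ∀ f, Γ'.inv (flagE f) = flagE (Γ.inv f)
  out_flag : ∀ f, Γ'.out (flagE f) = Γ.out f
  genus_vert : ∀ w, Γ'.genus (vertE w) = Γ.genus w

/-- The isomorphism of corollas induced at a vertex. -/
def Iso.corolla {Γ Γ' : Graph} (Φ : Iso Γ Γ') (w : Γ.Vert) :
    Corolla.Iso (Γ.corolla w) (Γ'.corolla (Φ.vertE w)) :=
  ⟨Φ.flagE.subtypeEquiv (fun f => by rw [Φ.vert_flag]; exact Φ.vertE.apply_eq_iff_eq.symm),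
    fun f => Φ.out_flag f.1, Φ.genus_vert w⟩

/-- A way of obtaining a graph `Γ` by inserting graphs `Γ_x` into the vertices `x` of a graph
`Γ₀`: the vertices of `Γ` are distributed over those of `Γ₀`, and some of the edges inside the
fibres are marked as the edges of the inserted graphs.  The vertices of `Γ` are listed
fibre by fibre. -/
structure Nest (Γ : Graph) where
  Vert0 : Type
  fintype : Fintype Vert0
  order : LinearOrder Vert0
  proj : Γ.Vert → Vert0
  mono : Monotone proj
  inside : Γ.Flag → Prop
  inside_inv : ∀ f, inside f → inside (Γ.inv f)
  inside_ne : ∀ f, inside f → Γ.inv f ≠ f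
  inside_proj : ∀ f, inside f → proj (Γ.vert (Γ.inv f)) = proj (Γ.vert f)

attribute [instance] Nest.fintype Nest.order

namespace Nest

variable {Γ : Graph}

open Classical in
/-- The graph `Γ_x` inserted into the vertex `x`. -/
def inner (N : Γ.Nest) (x : N.Vert0) : Graph where
  Vert := {w : Γ.Vert // N.proj w = x}
  fintype := inferInstance
  order := inferInstance
  Flag := {f : Γ.Flag // N.proj (Γ.vert f) = x}
  finite := inferInstance
  vert f := ⟨Γ.vert f.1, f.2⟩
  inv f := if h : N.inside f.1 then ⟨Γ.inv f.1, (N.inside_proj _ h).trans f.2⟩ else f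
  inv_inv f := by
    by_cases h : N.inside f.1
    · simp [h, N.inside_inv _ h, Γ.inv_inv]
    · simp [h]
  out f := Γ.out f.1
  genus w := Γ.genus w.1

/-- The graph `Γ₀` obtained from `Γ` by contracting each `Γ_x` to the vertex `x`. -/
def outer (T : OpType) (N : Γ.Nest) : Graph where
  Vert := N.Vert0
  fintype := inferInstance
  order := inferInstance
  Flag := {f : Γ.Flag // ¬ N.inside f}
  finite := inferInstance
  vert f := N.proj (Γ.vert f.1)
  inv f := ⟨Γ.inv f.1, fun h => f.2 (by simpa [Γ.inv_inv] using N.inside_inv _ h)⟩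
  inv_inv f := by simp [Γ.inv_inv]
  out f := Γ.out f.1
  genus x := (N.inner x).totalGenus T

/-- The flags at a vertex of `Γ` are its flags in the inserted graph. -/
def vertexIso (N : Γ.Nest) (x : N.Vert0) (w : (N.inner x).Vert) :
    Corolla.Iso (Γ.corolla w.1) ((N.inner x).corolla w) where
  flag :=
    { toFun := fun f => ⟨⟨f.1, by rw [f.2]; exact w.2⟩, Subtype.ext f.2⟩
      invFun := fun f => ⟨f.1.1, congrArg Subtype.val f.2⟩
      left_inv := fun _ => rfl
      right_inv := fun _ => rfl }
  out_eq _ := rfl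
  genus_eq := rfl

theorem inner_inv_eq_iff (N : Γ.Nest) (x : N.Vert0) (f : (N.inner x).Flag) :
    (N.inner x).inv f = f ↔ ¬ N.inside f.1 := by
  constructor
  · intro h hc
    have h1 : (N.inner x).inv f = ⟨Γ.inv f.1, (N.inside_proj _ hc).trans f.2⟩ := dif_pos hc
    exact N.inside_ne _ hc (congrArg Subtype.val (h1.symm.trans h))
  · intro h
    exact dif_neg h

/-- The tails of the inserted graph `Γ_x` are the flags of `Γ₀` at `x`. -/
def insertIso (T : OpType) (N : Γ.Nest) (x : N.Vert0) :
    Corolla.Iso ((N.inner x).residue T) ((N.outer T).corolla x) where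
  flag :=
    { toFun := fun f => ⟨⟨f.1.1, (N.inner_inv_eq_iff x f.1).1 f.2⟩, f.1.2⟩
      invFun := fun f => ⟨⟨f.1.1, f.2⟩, (N.inner_inv_eq_iff x ⟨f.1.1, f.2⟩).2 f.1.2⟩
      left_inv := fun _ => rfl
      right_inv := fun _ => rfl }
  out_eq _ := rfl
  genus_eq := rfl

end Nest

/-! ### The graph with two vertices and one edge -/

/-- The graph with the two vertices `X`, `Y` (in this order), whose only edge joins the flag `s`
of `X` to the flag `t` of `Y`. -/
def glue (X Y : Corolla) (s : X.Flag) (t : Y.Flag) : Graph where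
  Vert := Bool
  fintype := inferInstance
  order := inferInstance
  Flag := X.Flag ⊕ Y.Flag
  finite := inferInstance
  vert := Sum.isRight
  inv :=
    letI : DecidableEq (X.Flag ⊕ Y.Flag) := Classical.decEq _
    Equiv.swap (Sum.inl s) (Sum.inr t)
  inv_inv f := by
    let _ : DecidableEq (X.Flag ⊕ Y.Flag) := Classical.decEq _
    exact Equiv.swap_apply_self _ _ f
  out := Sum.elim X.out Y.out
  genus w := if w then Y.genus else X.genus

/-- The unique enumeration of the single edge. -/
def glueOrder (X Y : Corolla) (s : X.Flag) (t : Y.Flag) : (glue X Y s t).EdgeOrder where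
  list := [s(Sum.inl s, Sum.inr t)]
  nodup := List.nodup_singleton _
  mem_iff e := by
    let _ : DecidableEq (X.Flag ⊕ Y.Flag) := Classical.decEq _
    refine List.mem_singleton.trans ⟨?_, ?_⟩
    · rintro rfl
      refine ⟨Sum.inl s, ?_, ?_⟩
      · simp [glue, Equiv.swap_apply_left]
      · simp [glue, Equiv.swap_apply_left]
    · rintro ⟨f, hf, rfl⟩
      by_cases h1 : f = Sum.inl s
      · subst h1; simp [glue, Equiv.swap_apply_left]
      · by_cases h2 : f = Sum.inr t
        · subst h2; simp only [glue, Equiv.swap_apply_right]; exact Sym2.eq_swap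
        · exact absurd (Equiv.swap_apply_of_ne_of_ne (α := X.Flag ⊕ Y.Flag) h1 h2) hf

def glueLeft (X Y : Corolla) (s : X.Flag) (t : Y.Flag) :
    Corolla.Iso X ((glue X Y s t).corolla false) where
  flag :=
    { toFun := fun f => ⟨Sum.inl f, rfl⟩
      invFun := fun f => match f with
        | ⟨Sum.inl g, _⟩ => g
        | ⟨Sum.inr _, h⟩ => absurd h (by simp [glue])
      left_inv := fun _ => rfl
      right_inv := by
        rintro ⟨g | g, h⟩
        · rfl
        · exact absurd h (by simp [glue]) }
  out_eq _ := rfl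
  genus_eq := rfl

def glueRight (X Y : Corolla) (s : X.Flag) (t : Y.Flag) :
    Corolla.Iso Y ((glue X Y s t).corolla true) where
  flag :=
    { toFun := fun f => ⟨Sum.inr f, rfl⟩
      invFun := fun f => match f with
        | ⟨Sum.inr g, _⟩ => g
        | ⟨Sum.inl _, h⟩ => absurd h (by simp [glue])
      left_inv := fun _ => rfl
      right_inv := by
        rintro ⟨g | g, h⟩
        · exact absurd h (by simp [glue])
        · rfl }
  out_eq _ := rfl
  genus_eq := rfl

end Graph

/-! ### Graded modules over corollas and their coinvariants -/

/-- A functor from corollas of type `T` and their isomorphisms to `ℤ`-graded vector spaces. -/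
structure SMod (k : Type v) [Field k] (T : OpType) where
  obj : T.Vertex → Type u
  addCommGroup : ∀ X, AddCommGroup (obj X)
  module : ∀ X, Module k (obj X)
  gr : ∀ X, ℤ → Submodule k (obj X)
  internal : ∀ X, DirectSum.IsInternal (gr X)
  map : ∀ {X Y : T.Vertex}, Corolla.Iso X.1 Y.1 → (obj X →ₗ[k] obj Y)
  map_refl : ∀ X a, map (Corolla.Iso.refl X.1) a = (a : obj X)
  map_trans : ∀ {X Y Z : T.Vertex} (φ : Corolla.Iso X.1 Y.1) (ψ : Corolla.Iso Y.1 Z.1) (a : obj X),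
    map (φ.trans ψ) a = (map ψ (map φ a) : obj Z)
  map_gr : ∀ {X Y : T.Vertex} (φ : Corolla.Iso X.1 Y.1) (d : ℤ) (a : obj X),
    a ∈ gr X d → map φ a ∈ gr Y d

attribute [instance] SMod.addCommGroup SMod.module

/-- The sign of the permutation of the outputs. -/
def outSign {T : OpType} (i : T.Index) (σ : Corolla.Iso (T.std i).1 (T.std i).1) : ℤˣ :=
  letI : Fintype {f : (T.std i).1.Flag // (T.std i).1.out f = true} := Fintype.ofFinite _
  letI : DecidableEq {f : (T.std i).1.Flag // (T.std i).1.out f = true} := Classical.decEq _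
  Equiv.Perm.sign (σ.flag.subtypeEquiv (fun f => by rw [σ.out_eq]) :
    Equiv.Perm {f : (T.std i).1.Flag // (T.std i).1.out f = true})

namespace SMod

variable {k : Type v} [Field k] {T : OpType}

/-- The subspace divided out to obtain the coinvariants of the automorphism group of the
standard corolla, the action being twisted by the sign character `χ`. -/
def coinvRel (O : SMod.{u} k T) (χ : ∀ i : T.Index, Corolla.Iso (T.std i).1 (T.std i).1 → ℤˣ)
    (i : T.Index) : Submodule k (O.obj (T.std i)) :=
  Submodule.span k {x | ∃ (σ : Corolla.Iso (T.std i).1 (T.std i).1) (a : O.obj (T.std i)),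
    x = χ i σ • O.map σ a - a}

/-- The direct sum of the coinvariants of the action twisted by `χ`. -/
abbrev CoinvBy (O : SMod.{u} k T)
    (χ : ∀ i : T.Index, Corolla.Iso (T.std i).1 (T.std i).1 → ℤˣ) : Type u :=
  DirectSum T.Index fun i => O.obj (T.std i) ⧸ O.coinvRel χ i

/-- The degree `d` part of the direct sum of coinvariants, where the summand with index `i` is
shifted by `δ i`. -/
def coinvByGr (O : SMod.{u} k T)
    (χ : ∀ i : T.Index, Corolla.Iso (T.std i).1 (T.std i).1 → ℤˣ) (δ : T.Index → ℤ) (d : ℤ) :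
    Submodule k (O.CoinvBy χ) :=
  ⨅ i : T.Index, ((O.gr (T.std i) (d - δ i)).map (O.coinvRel χ i).mkQ).comap
    (DirectSum.component k T.Index (fun i => O.obj (T.std i) ⧸ O.coinvRel χ i) i)

/-- The direct sum `⨁ O(g,n,m)_{S_n × S_m}` of the coinvariants. -/
abbrev Coinv (O : SMod.{u} k T) : Type u := O.CoinvBy fun _ _ => 1

/-- The grading of the direct sum of coinvariants of the shift `Σ^c O`, where
`(Σ^c O)^d = O^(d - c)`; the vector space is the same for all `c`. -/
def coinvGr (O : SMod.{u} k T) (c d : ℤ) : Submodule k O.Coinv :=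
  O.coinvByGr (fun _ _ => 1) (fun _ => c) d

/-- The class `[a]` of an element. -/
def cls (O : SMod.{u} k T) {X : T.Vertex} (a : O.obj X) : O.Coinv :=
  DirectSum.of (fun i => O.obj (T.std i) ⧸ O.coinvRel (fun _ _ => 1) i) (T.index X)
    ((O.coinvRel (fun _ _ => 1) (T.index X)).mkQ
      (O.map (Y := T.std (T.index X)) (Classical.choice X.1.exists_iso_std) a))

/-- The direct sum of the coinvariants of the output suspension
`s_out O (n,m) = Σ^m O(n,m) ⊗ sgn_m`. -/
abbrev OutCoinv (O : SMod.{u} k T) : Type u := O.CoinvBy outSign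

/-- The grading of the direct sum of coinvariants of `s_out O`. -/
def outCoinvGr (O : SMod.{u} k T) (d : ℤ) : Submodule k O.OutCoinv :=
  O.coinvByGr outSign (fun i => (i.1.2.2 : ℤ)) d

/-- `L` enumerates the outputs of `X`. -/
def IsOutOrder (X : Corolla) (L : List X.Flag) : Prop :=
  L.Nodup ∧ ∀ f, f ∈ L ↔ X.out f = true

open Classical in
/-- The class of `(o₁ ∧ ⋯ ∧ o_m) ⊗ a` in the coinvariants of the output suspension, where
`L = [o₁, …, o_m]` enumerates the outputs: the class of `φ a` for any isomorphism `φ` to the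
standard corolla under which the enumeration becomes the standard one. -/
def outCls (O : SMod.{u} k T) {X : T.Vertex} (L : List X.1.Flag) (a : O.obj X) : O.OutCoinv :=
  if h : ∃ φ : Corolla.Iso X.1 (T.std (T.index X)).1,
      L.map φ.flag = (List.finRange X.1.numOut).map Sum.inr then
    DirectSum.of (fun i => O.obj (T.std i) ⧸ O.coinvRel outSign i) (T.index X)
      ((O.coinvRel outSign (T.index X)).mkQ (O.map h.choose a))
  else 0

/-- Morphisms: natural, degree preserving families of linear maps. -/
structure Hom (O O' : SMod.{u} k T) where
  app : ∀ X, O.obj X →ₗ[k] O'.obj X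
  natural : ∀ {X Y : T.Vertex} (φ : Corolla.Iso X.1 Y.1) (a : O.obj X),
    app Y (O.map φ a) = O'.map φ (app X a)
  app_gr : ∀ X d a, a ∈ O.gr X d → app X a ∈ O'.gr X d

/-- The map induced on direct sums of coinvariants. -/
def Hom.coinv {O O' : SMod.{u} k T} (f : Hom O O')
    (χ : ∀ i : T.Index, Corolla.Iso (T.std i).1 (T.std i).1 → ℤˣ) :
    O.CoinvBy χ →ₗ[k] O'.CoinvBy χ :=
  DirectSum.lmap fun i => (O.coinvRel χ i).mapQ (O'.coinvRel χ i) (f.app (T.std i)) (by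
    refine Submodule.span_le.2 ?_
    rintro _ ⟨σ, a, rfl⟩
    refine Submodule.subset_span ⟨σ, f.app _ a, ?_⟩
    rw [map_sub, Units.smul_def, map_zsmul, f.natural, Units.smul_def])

end SMod

/-! ### Twisted structures -/

/-- The Koszul sign of the permutation of homogeneous factors of degrees `d`. -/
def koszulSign {V W : Type} [Fintype V] [LinearOrder V] [LinearOrder W] (σ : V ≃ W)
    (d : V → ℤ) : ℤˣ :=
  ∏ x : V × V, if x.1 < x.2 ∧ σ x.2 < σ x.1 then (d x.1 * d x.2).negOnePow else 1

/-- The structure of an algebra over the triple of graphs of type `T` twisted by `𝔎^{⊗p}`, where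
`𝔎(Γ) = Det(Edges(Γ))`: compatible compositions
`𝔎(Γ)^{⊗p} ⊗ ⨂_w O(Γ_w) → O(tails of Γ)` of degree zero along all graphs of type `T`.
`p = 0` is the untwisted case, `p = 1` the `𝔎`-twisted one. Since `𝔎(Γ)` sits in
degree `-|E|`, fixing a generator gives an operation of degree `-p|E|`. -/
structure Gluing {k : Type v} [Field k] {T : OpType} (p : ℕ) (O : SMod.{u} k T) where
  comp : ∀ (Γ : Graph) (h : T.Admissible Γ), Γ.EdgeOrder →
    MultilinearMap k (fun w => O.obj (Γ.at' h w)) (O.obj (Γ.total h))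
  comp_gr : ∀ (Γ : Graph) (h : T.Admissible Γ) (ω : Γ.EdgeOrder) (d : Γ.Vert → ℤ)
    (a : ∀ w, O.obj (Γ.at' h w)), (∀ w, a w ∈ O.gr _ (d w)) →
    comp Γ h ω a ∈ O.gr _ (∑ w, d w - p * ω.list.length)
  /-- Exchanging two consecutive edges. -/
  comp_swap : ∀ (Γ : Graph) (h : T.Admissible Γ) (ω ω' : Γ.EdgeOrder) (l₁ l₂ : List (Sym2 Γ.Flag))
    (e e' : Sym2 Γ.Flag), ω.list = l₁ ++ e :: e' :: l₂ → ω'.list = l₁ ++ e' :: e :: l₂ →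
    ∀ a, comp Γ h ω' a = (p : ℤ).negOnePow • comp Γ h ω a
  /-- Equivariance under isomorphisms of graphs, with the Koszul sign for the vertices. -/
  comp_iso : ∀ (Γ Γ' : Graph) (h : T.Admissible Γ) (h' : T.Admissible Γ') (Φ : Γ.Iso Γ')
    (φ : Corolla.Iso (Γ.residue T) (Γ'.residue T)), (∀ f, (φ.flag f).1 = Φ.flagE f.1) →
    ∀ (ω : Γ.EdgeOrder) (ω' : Γ'.EdgeOrder), ω'.list = ω.list.map (Sym2.map Φ.flagE) →
    ∀ (d : Γ.Vert → ℤ) (a : ∀ w, O.obj (Γ.at' h w)) (a' : ∀ w, O.obj (Γ'.at' h' w)),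
    (∀ w, a w ∈ O.gr _ (d w)) →
    (∀ w, a' (Φ.vertE w) = O.map (X := Γ.at' h w) (Y := Γ'.at' h' (Φ.vertE w)) (Φ.corolla w) (a w)) →
    comp Γ' h' ω' a' =
      koszulSign Φ.vertE d • O.map (X := Γ.total h) (Y := Γ'.total h') φ (comp Γ h ω a)
  /-- A graph with one vertex and no edges acts as the identity. -/
  comp_unit : ∀ (Γ : Graph) (h : T.Admissible Γ) (ω : Γ.EdgeOrder) (w : Γ.Vert),
    (∀ w', w' = w) → (∀ f, Γ.inv f = f) →
    ∀ (φ : Corolla.Iso (Γ.corolla w) (Γ.residue T)), (∀ f, (φ.flag f).1 = f.1) →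
    ∀ a, comp Γ h ω a = O.map (X := Γ.at' h w) (Y := Γ.total h) φ (a w)
  /-- Composing along the inserted graphs `Γ_x` and then along `Γ₀` is composing along `Γ`.  The
  sign moves the generators of `𝔎(Γ_x)^{⊗p}` to the left of the arguments. -/
  comp_nest : ∀ (Γ : Graph) (h : T.Admissible Γ) (N : Γ.Nest) (h₀ : T.Admissible (N.outer T))
    (hi : ∀ x, T.Admissible (N.inner x))
    (φ : Corolla.Iso ((N.outer T).residue T) (Γ.residue T)), (∀ f, (φ.flag f).1 = f.1.1) →
    ∀ (ω : Γ.EdgeOrder) (ω₀ : (N.outer T).EdgeOrder) (ωi : ∀ x, (N.inner x).EdgeOrder),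
    ω.list = ω₀.list.map (Sym2.map Subtype.val) ++
      ((Finset.univ : Finset N.Vert0).sort (· ≤ ·)).flatMap
        (fun x => (ωi x).list.map (Sym2.map Subtype.val)) →
    ∀ (d : Γ.Vert → ℤ) (a : ∀ w, O.obj (Γ.at' h w)), (∀ w, a w ∈ O.gr _ (d w)) →
    O.map (X := (N.outer T).total h₀) (Y := Γ.total h) φ
      (comp (N.outer T) h₀ ω₀ fun x =>
        O.map (X := (N.inner x).total (hi x)) (Y := (N.outer T).at' h₀ x) (N.insertIso T x)
          (comp (N.inner x) (hi x) (ωi x) fun w =>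
            O.map (X := Γ.at' h w.1) (Y := (N.inner x).at' (hi x) w) (N.vertexIso x w) (a w.1))) =
    (∏ y : N.Vert0 × N.Vert0, if y.1 < y.2 then
        ((p : ℤ) * (ωi y.2).list.length * ∑ w : (N.inner y.1).Vert, d w.1).negOnePow else 1) •
      comp Γ h ω a

namespace Gluing

variable {k : Type v} [Field k] {T : OpType} {p : ℕ} {O O' : SMod.{u} k T}

/-- The composition of `a` and `b` along the edge joining `s` to `t`. -/
def glue₂ (G : Gluing p O) {X Y : T.Vertex} (s : X.1.Flag) (t : Y.1.Flag)
    (h : T.Admissible (Graph.glue X.1 Y.1 s t)) (a : O.obj X) (b : O.obj Y) :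
    O.obj ((Graph.glue X.1 Y.1 s t).total h) :=
  G.comp _ h (Graph.glueOrder X.1 Y.1 s t) fun w => match w with
    | false => O.map (Y := (Graph.glue X.1 Y.1 s t).at' h false) (Graph.glueLeft X.1 Y.1 s t) a
    | true => O.map (Y := (Graph.glue X.1 Y.1 s t).at' h true) (Graph.glueRight X.1 Y.1 s t) b

open Classical in
/-- The class of the composition along the edge joining `s` to `t`, for those `s`, `t` that can be
joined (an input and an output in the directed types), and `0` for the other ones. -/
def edgeTerm (G : Gluing p O) {X Y : T.Vertex} (a : O.obj X) (b : O.obj Y)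
    (s : X.1.Flag) (t : Y.1.Flag) : O.Coinv :=
  if h : T.Admissible (Graph.glue X.1 Y.1 s t) then O.cls (G.glue₂ s t h a b) else 0

/-- `br` is the sum over all one-edge gluings `a • b`, the symbol `•` of odd degree standing
between `a` and `b`: `{[a] • [b]} = ∑_{s,t} (-1)^{|a|} [∘_{(s,t)}(a ⊗ b)]`. -/
def IsOddBracket (G : Gluing 1 O) (br : O.Coinv →ₗ[k] O.Coinv →ₗ[k] O.Coinv) : Prop :=
  ∀ (X Y : T.Vertex) (i : ℤ) (a : O.obj X) (b : O.obj Y), a ∈ O.gr X i →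
    br (O.cls a) (O.cls b) = i.negOnePow • ∑ᶠ (s : X.1.Flag) (t : Y.1.Flag), G.edgeTerm a b s t

/-- The class of `a ∘ b`, the sum over all gluings of an input of `a` to an output of `b`. -/
def circ (G : Gluing 0 O) {X Y : T.Vertex} (a : O.obj X) (b : O.obj Y) : O.Coinv :=
  ∑ᶠ (s : {s : X.1.Flag // X.1.out s = false}) (t : {t : Y.1.Flag // Y.1.out t = true}),
    G.edgeTerm a b s.1 t.1

/-- `br` is the commutator `[a] ∘ [b] - (-1)^{|a||b|} [b] ∘ [a]`. -/
def IsCommutator (G : Gluing 0 O) (br : O.Coinv →ₗ[k] O.Coinv →ₗ[k] O.Coinv) : Prop :=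
  ∀ (X Y : T.Vertex) (i j : ℤ) (a : O.obj X) (b : O.obj Y), a ∈ O.gr X i → b ∈ O.gr Y j →
    br (O.cls a) (O.cls b) = G.circ a b - (i * j).negOnePow • G.circ b a

open Classical in
/-- The contraction of the glued output `o` out of `(L ∧ M)`, tensored with the composition of `a`
and `b`:  the sign is `(-1)^{position of o}`, and the outputs that remain are listed in the
given order. -/
def outTerm (G : Gluing 0 O) {X Y : T.Vertex} (L : List X.1.Flag) (M : List Y.1.Flag)
    (a : O.obj X) (b : O.obj Y) (s : X.1.Flag) (t : Y.1.Flag) : O.OutCoinv :=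
  if h : T.Admissible (Graph.glue X.1 Y.1 s t) then
    (((L.map Sum.inl ++ M.map Sum.inr : List (X.1.Flag ⊕ Y.1.Flag)).findIdx
        fun f => decide ((Graph.glue X.1 Y.1 s t).inv f ≠ f) : ℕ) : ℤ).negOnePow •
      O.outCls (X := (Graph.glue X.1 Y.1 s t).total h)
        ((L.map Sum.inl ++ M.map Sum.inr : List (X.1.Flag ⊕ Y.1.Flag)).filterMap fun f =>
          if hf : (Graph.glue X.1 Y.1 s t).inv f = f then some ⟨f, hf⟩ else none)
        (G.glue₂ s t h a b)
  else 0

/-- The sum over all one-edge gluings for the output suspension `s_out P` of an untwisted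
structure `P`.  For `α = L ⊗ a`, `β = M ⊗ b` of degrees `|a| + |L|` and `|b| + |M|` one has
`∘_{(s,t)}(α ⊗ β) = (-1)^{|a||M|} ∂_o(L ∧ M) ⊗ (a ∘_{(s,t)} b)` with `o` the glued output, and
`{α • β} = ∑_{s,t} (-1)^{|α|} ∘_{(s,t)}(α ⊗ β)`. -/
def IsOutBracket (G : Gluing 0 O)
    (br : O.OutCoinv →ₗ[k] O.OutCoinv →ₗ[k] O.OutCoinv) : Prop :=
  ∀ (X Y : T.Vertex) (L : List X.1.Flag) (M : List Y.1.Flag) (i : ℤ) (a : O.obj X) (b : O.obj Y),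
    SMod.IsOutOrder X.1 L → SMod.IsOutOrder Y.1 M → a ∈ O.gr X i →
    br (O.outCls L a) (O.outCls M b) =
      (i + L.length + i * M.length).negOnePow •
        ∑ᶠ (s : X.1.Flag) (t : Y.1.Flag), G.outTerm L M a b s t

/-- A morphism of twisted structures respects all compositions. -/
def IsHom (G : Gluing p O) (G' : Gluing p O') (f : SMod.Hom O O') : Prop :=
  ∀ (Γ : Graph) (h : T.Admissible Γ) (ω : Γ.EdgeOrder) (a : ∀ w, O.obj (Γ.at' h w)),
    f.app _ (G.comp Γ h ω a) = G'.comp Γ h ω fun w => f.app _ (a w)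

end Gluing

/-! ### Anti-cyclic operads -/

/-- The set of flags `(S ∖ {s}) ⊔ (T ∖ {t})`. -/
def Corolla.join (X Y : Corolla) (s : X.Flag) (t : Y.Flag) : Corolla :=
  ⟨{f : X.Flag // f ≠ s} ⊕ {f : Y.Flag // f ≠ t}, inferInstance,
    Sum.elim (fun f => X.out f.1) (fun f => Y.out f.1), X.genus + Y.genus⟩

theorem Corolla.out_eq_false_of_numOut {X : Corolla} (h : X.numOut = 0) (f : X.Flag) :
    X.out f = false := by
  rw [Corolla.numOut, Finite.card_eq_zero_iff] at h
  by_contra hf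
  exact h.elim ⟨f, by simpa using hf⟩

def joinVertex (X Y : OpType.cyclic.Vertex) (s : X.1.Flag) (t : Y.1.Flag) :
    OpType.cyclic.Vertex :=
  ⟨X.1.join Y.1 s t, by
    refine ⟨by simp [Corolla.join, X.2.1, Y.2.1], ?_⟩
    rw [Corolla.numOut, Finite.card_eq_zero_iff]
    refine ⟨?_⟩
    rintro ⟨f | f, hf⟩
    · simp [Corolla.join, Corolla.out_eq_false_of_numOut X.2.2] at hf
    · simp [Corolla.join, Corolla.out_eq_false_of_numOut Y.2.2] at hf⟩

/-- The flag of `X` or `Y` that a flag of the join comes from. -/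
def joinVal {X Y : Corolla} {s : X.Flag} {t : Y.Flag} :
    (X.join Y s t).Flag → X.Flag ⊕ Y.Flag := Sum.map Subtype.val Subtype.val

/-- Anti-cyclic operads over finite sets: gluings `O(S) ⊗ O(T) → O((S ∖ s) ⊔ (T ∖ t))` that are
equivariant, associative, and anti-symmetric. -/
structure AntiCyclic {k : Type v} [Field k] (O : SMod.{u} k OpType.cyclic) where
  glue : ∀ (X Y : OpType.cyclic.Vertex) (s : X.1.Flag) (t : Y.1.Flag),
    O.obj X →ₗ[k] O.obj Y →ₗ[k] O.obj (joinVertex X Y s t)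
  glue_gr : ∀ (X Y : OpType.cyclic.Vertex) (s : X.1.Flag) (t : Y.1.Flag) (i j : ℤ)
    (a : O.obj X) (b : O.obj Y), a ∈ O.gr X i → b ∈ O.gr Y j →
    glue X Y s t a b ∈ O.gr _ (i + j)
  equivariant : ∀ (X X' Y Y' : OpType.cyclic.Vertex) (φ : Corolla.Iso X.1 X'.1)
    (ψ : Corolla.Iso Y.1 Y'.1) (s : X.1.Flag) (t : Y.1.Flag)
    (θ : Corolla.Iso (joinVertex X Y s t).1 (joinVertex X' Y' (φ.flag s) (ψ.flag t)).1),
    (∀ f, joinVal (θ.flag f) = Sum.map φ.flag ψ.flag (joinVal f)) →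
    ∀ (a : O.obj X) (b : O.obj Y),
    glue X' Y' (φ.flag s) (ψ.flag t) (O.map φ a) (O.map ψ b) = O.map θ (glue X Y s t a b)
  antisymm : ∀ (X Y : OpType.cyclic.Vertex) (s : X.1.Flag) (t : Y.1.Flag)
    (θ : Corolla.Iso (joinVertex Y X t s).1 (joinVertex X Y s t).1),
    (∀ f, joinVal (θ.flag f) = (joinVal f).swap) →
    ∀ (i j : ℤ) (a : O.obj X) (b : O.obj Y), a ∈ O.gr X i → b ∈ O.gr Y j →
    glue X Y s t a b = -((i * j).negOnePow • O.map θ (glue Y X t s b a))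
  assoc : ∀ (X Y Z : OpType.cyclic.Vertex) (s : X.1.Flag) (t t' : Y.1.Flag) (w : Z.1.Flag)
    (ht : t' ≠ t)
    (θ : Corolla.Iso
      (joinVertex (joinVertex X Y s t) Z (Sum.inr ⟨t', ht⟩) w).1
      (joinVertex X (joinVertex Y Z t' w) s (Sum.inl ⟨t, ht.symm⟩)).1),
    (∀ f, Sum.map id joinVal (joinVal (θ.flag f)) =
      Equiv.sumAssoc _ _ _ (Sum.map joinVal id (joinVal f))) →
    ∀ (a : O.obj X) (b : O.obj Y) (c : O.obj Z),
    O.map θ (glue (joinVertex X Y s t) Z (Sum.inr ⟨t', ht⟩) w (glue X Y s t a b) c) =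
      glue X (joinVertex Y Z t' w) s (Sum.inl ⟨t, ht.symm⟩) a (glue Y Z t' w b c)

namespace AntiCyclic

variable {k : Type v} [Field k] {O O' : SMod.{u} k OpType.cyclic}

/-- `br` is the sum over all gluings: `[[a] ⊙ [b]] = ∑_{s,t} [a _s∘_t b]`. -/
def IsBracket (G : AntiCyclic O) (br : O.Coinv →ₗ[k] O.Coinv →ₗ[k] O.Coinv) : Prop :=
  ∀ (X Y : OpType.cyclic.Vertex) (a : O.obj X) (b : O.obj Y),
    br (O.cls a) (O.cls b) = ∑ᶠ (s : X.1.Flag) (t : Y.1.Flag), O.cls (G.glue X Y s t a b)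

def IsHom (G : AntiCyclic O) (G' : AntiCyclic O') (f : SMod.Hom O O') : Prop :=
  ∀ (X Y : OpType.cyclic.Vertex) (s : X.1.Flag) (t : Y.1.Flag) (a : O.obj X) (b : O.obj Y),
    f.app _ (G.glue X Y s t a b) = G'.glue X Y s t (f.app _ a) (f.app _ b)

end AntiCyclic

/-! ### Graded Lie brackets -/

section Lie

variable {k : Type v} [Field k] {V : Type u} [AddCommGroup V] [Module k V]

/-- A graded Lie bracket on the graded vector space `(V, gr)`. -/
structure IsLieBracket (gr : ℤ → Submodule k V) (br : V →ₗ[k] V →ₗ[k] V) : Prop where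
  internal : DirectSum.IsInternal gr
  degree : ∀ i j a b, a ∈ gr i → b ∈ gr j → br a b ∈ gr (i + j)
  antisymm : ∀ i j a b, a ∈ gr i → b ∈ gr j → br a b = -((i * j).negOnePow • br b a)
  jacobi : ∀ i j l a b c, a ∈ gr i → b ∈ gr j → c ∈ gr l →
    br a (br b c) + (l * (i + j)).negOnePow • br c (br a b) +
      (i * (j + l)).negOnePow • br b (br c a) = 0

/-- An odd Lie bracket (of degree `-1`) on the graded vector space `(V, gr)`, with the signs of a
Lie bracket for the degree `s(a) = |a| + 1`. -/
structure IsOddLieBracket (gr : ℤ → Submodule k V) (br : V →ₗ[k] V →ₗ[k] V) : Prop where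
  internal : DirectSum.IsInternal gr
  degree : ∀ i j a b, a ∈ gr i → b ∈ gr j → br a b ∈ gr (i + j - 1)
  antisymm : ∀ i j a b, a ∈ gr i → b ∈ gr j →
    br a b = -(((i + 1) * (j + 1)).negOnePow • br b a)
  jacobi : ∀ i j l a b c, a ∈ gr i → b ∈ gr j → c ∈ gr l →
    br a (br b c) + ((l + 1) * ((i + 1) + (j + 1))).negOnePow • br c (br a b) +
      ((i + 1) * ((j + 1) + (l + 1))).negOnePow • br b (br c a) = 0

end Lie

end OddBracket

end

open OddBracket

noncomputable section

namespace OddBracket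

/-! ### Isomorphisms of corollas -/

namespace Corolla

/-! Every bracket in the statement is a sum over compositions along a single edge, so only graphs
with one edge and chains with two edges matter. Suppose that one-edge compositions of degree `0` are
given which are equivariant, antisymmetric in the graded sense, and associative: for one edge from
`X` to `Y` and another from `Y` to `Z`, contracting them in either order gives the same result
(`AntiGluing`). Let `[a, b]` be the sum over all edges joining `a` to `b`. In `[a, [b, c]]` the edge
issuing from `a` ends at a flag of `b` or of `c`, so the double bracket is the sum over chains `a -
b - c` minus `(-1)^(|b||c|)` times the sum over chains `a - c - b` (`sum_total_eq`). Associativity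
and two uses of antisymmetry show that a chain may be read backwards up to a Koszul sign
(`chainSum_reverse`). The six chain sums in the Jacobi identity therefore cancel in pairs, one pair
for each choice of the middle vertex (`AntiGluing.isLieBracket`).

The direct sum of coinvariants is the universal target of linear maps from all `O(X)` that are
invariant under isomorphisms (`Colim`, `twistColim`). Existence of a bracket is the universal
property, uniqueness holds because the classes of homogeneous elements generate, and all
computations may use arbitrary corollas. In the same spirit `Join` lets the result of a gluing be
any corolla `W` with a suitable embedding of its flags, so that symmetry and associativity are
equalities without transports.

It remains to bring the given structures into this form. For a structure twisted by the `p`-th power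
of the determinant of the edges, equivariance under graph isomorphisms gives graded symmetry
(`gl_symm`), and the axiom on nested graphs, applied to the two ways of contracting a chain, gives
associativity up to `(-1)^(p(|a|+1))` (`gl_assoc`): one factor for exchanging the two edges, one for
moving an edge past `a`. A `Weight` is a system of signs that corrects both identities after a shift
of degrees and a twist by a character. There are three: `(-1)^|a|` with shift `-1` (`oddWeight`), a
sign for the direction of the edge (`commWeight`), and the contraction of the glued output
(`outWeight`). The last rests on exterior algebra carried out with lists: `L ∧ M = (-1)^(|L||M|) M ∧
L` (`Alternating.append_comm`) and the anticommutation of contractions (`contract_comm`).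
Anti-cyclic operads are in the required form from the start.

Finally, a Lie bracket for the degree lowered by one is an odd Lie bracket (`IsLieBracket.odd`),
which produces the odd statements from the even ones. -/

@[ext]
theorem Iso.ext {X Y : Corolla} {φ ψ : Iso X Y} (h : ∀ f, φ.flag f = ψ.flag f) : φ = ψ := by
  cases φ; cases ψ
  congr
  exact Equiv.ext h

def Iso.symm {X Y : Corolla} (φ : Iso X Y) : Iso Y X :=
  ⟨φ.flag.symm, fun f => by rw [← φ.out_eq, Equiv.apply_symm_apply], φ.genus_eq.symm⟩

@[simp]
theorem Iso.trans_flag {X Y Z : Corolla} (φ : Iso X Y) (ψ : Iso Y Z) (f : X.Flag) :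
    (φ.trans ψ).flag f = ψ.flag (φ.flag f) := rfl

@[simp]
theorem Iso.symm_flag {X Y : Corolla} (φ : Iso X Y) : φ.symm.flag = φ.flag.symm := rfl

@[simp]
theorem Iso.refl_flag (X : Corolla) (f : X.Flag) : (Iso.refl X).flag f = f := rfl

@[simp]
theorem Iso.trans_symm {X Y : Corolla} (φ : Iso X Y) : φ.trans φ.symm = Iso.refl X := by
  ext f; simp

/-- Two corollas whose flags are identified with the same subset of a set `A`. -/
def Iso.over {X Y : Corolla} {A : Type} (j : X.Flag → A) (j' : Y.Flag → A)
    (hj : Function.Injective j) (hj' : Function.Injective j')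
    (hr : ∀ a, a ∈ Set.range j ↔ a ∈ Set.range j')
    (ho : ∀ x y, j x = j' y → X.out x = Y.out y) (hg : X.genus = Y.genus) : Iso X Y where
  flag := ((Equiv.ofInjective j hj).trans (Equiv.setCongr (Set.ext hr))).trans
    (Equiv.ofInjective j' hj').symm
  out_eq f := by
    refine (ho _ _ ?_).symm
    simp [Equiv.apply_ofInjective_symm hj']
  genus_eq := hg.symm

theorem Iso.over_spec {X Y : Corolla} {A : Type} (j : X.Flag → A) (j' : Y.Flag → A)
    (hj : Function.Injective j) (hj' : Function.Injective j')
    (hr : ∀ a, a ∈ Set.range j ↔ a ∈ Set.range j')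
    (ho : ∀ x y, j x = j' y → X.out x = Y.out y) (hg : X.genus = Y.genus) (f : X.Flag) :
    j' ((Iso.over j j' hj hj' hr ho hg).flag f) = j f := by
  simp [Iso.over, Equiv.apply_ofInjective_symm hj']

/-- The number of inputs (`b = false`) or outputs (`b = true`). -/
def count (X : Corolla) (b : Bool) : ℕ := Nat.card {f : X.Flag // X.out f = b}

theorem Iso.count_eq {X Y : Corolla} (φ : Iso X Y) (b : Bool) : X.count b = Y.count b :=
  Nat.card_congr (φ.flag.subtypeEquiv fun f => by rw [φ.out_eq])

theorem Iso.numIn_eq {X Y : Corolla} (φ : Iso X Y) : X.numIn = Y.numIn := φ.count_eq false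

theorem Iso.numOut_eq {X Y : Corolla} (φ : Iso X Y) : X.numOut = Y.numOut := φ.count_eq true

theorem Iso.occurs {T : OpType} {X Y : Corolla} (φ : Iso X Y)
    (h : T.Occurs X.genus X.numIn X.numOut) : T.Occurs Y.genus Y.numIn Y.numOut := by
  rwa [φ.genus_eq, ← φ.numIn_eq, ← φ.numOut_eq]

end Corolla

theorem index_eq_of_iso {T : OpType} {X Y : T.Vertex} (φ : Corolla.Iso X.1 Y.1) :
    T.index X = T.index Y := by
  apply Subtype.ext
  simp only [OpType.index]
  rw [φ.genus_eq, φ.numIn_eq, φ.numOut_eq]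

theorem index_std {T : OpType} (i : T.Index) : T.index (T.std i) = i := by
  apply Subtype.ext
  simp only [OpType.index, OpType.std, Corolla.std_numIn, Corolla.std_numOut]
  rfl

/-! ### Joining two corollas along an edge -/

/-- Flags of directions `x` and `y` can be joined to an edge. -/
def OpType.Joinable (T : OpType) (x y : Bool) : Prop := T.Directed → x ≠ y

theorem OpType.Joinable.symm {T : OpType} {x y : Bool} (h : T.Joinable x y) : T.Joinable y x :=
  fun hT => (h hT).symm

/-- Removing a flag lowers the count of one direction by one exactly when the flag has that
direction. The corrections are added on the left to avoid truncated subtraction. -/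
theorem card_sum_ne_ne {A B : Type} [Finite A] [Finite B] (x : A → Bool) (y : B → Bool) (s : A)
    (t : B) (b : Bool) :
    Nat.card {f : {f : A // f ≠ s} ⊕ {f : B // f ≠ t} //
        Sum.elim (fun f => x f.1) (fun f => y f.1) f = b} +
      ((if x s = b then 1 else 0) + (if y t = b then 1 else 0)) =
    Nat.card {f : A // x f = b} + Nat.card {f : B // y f = b} := by
  have key : ∀ {A : Type} [Finite A] (x : A → Bool) (s : A),
      Nat.card {f : {f : A // f ≠ s} // x f.1 = b} + (if x s = b then 1 else 0) =
        Nat.card {f : A // x f = b} := by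
    intro A _ x s
    have e : {f : {f : A // f ≠ s} // x f.1 = b} ≃ {f : A // f ∈ {f | x f = b} \ {s}} :=
      { toFun := fun f => ⟨f.1.1, f.2, f.1.2⟩
        invFun := fun f => ⟨⟨f.1, f.2.2⟩, f.2.1⟩
        left_inv := fun _ => rfl
        right_inv := fun _ => rfl }
    rw [Nat.card_congr e]
    change Set.ncard ({f | x f = b} \ {s}) + _ = Set.ncard {f | x f = b}
    split_ifs with h
    · exact Set.ncard_sdiff_singleton_add_one h (Set.toFinite _)
    · rw [Set.sdiff_singleton_eq_self (s := {f | x f = b}) h, add_zero]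
  have e : {f : {f : A // f ≠ s} ⊕ {f : B // f ≠ t} //
        Sum.elim (fun f => x f.1) (fun f => y f.1) f = b} ≃
      {f : {f : A // f ≠ s} // x f.1 = b} ⊕ {f : {f : B // f ≠ t} // y f.1 = b} :=
    { toFun := fun f => match f with
        | ⟨Sum.inl f, h⟩ => Sum.inl ⟨f, h⟩
        | ⟨Sum.inr f, h⟩ => Sum.inr ⟨f, h⟩
      invFun := Sum.elim (fun f => ⟨Sum.inl f.1, f.2⟩) (fun f => ⟨Sum.inr f.1, f.2⟩)
      left_inv := by rintro ⟨f | f, h⟩ <;> rfl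
      right_inv := by rintro (f | f) <;> rfl }
  rw [Nat.card_congr e, Nat.card_sum, ← key x s, ← key y t]
  omega

namespace Corolla

theorem join_count (X Y : Corolla) (s : X.Flag) (t : Y.Flag) (b : Bool) :
    (X.join Y s t).count b + ((if X.out s = b then 1 else 0) + (if Y.out t = b then 1 else 0)) =
      X.count b + Y.count b :=
  card_sum_ne_ne X.out Y.out s t b

/-- Each type is closed under gluing. For operads the edge uses up exactly one of the two outputs;
stability survives because `2g + n ≥ 3` on both sides and only two flags are lost. -/
theorem join_occurs {T : OpType} {X Y : Corolla} (hX : T.Occurs X.genus X.numIn X.numOut)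
    (hY : T.Occurs Y.genus Y.numIn Y.numOut) (s : X.Flag) (t : Y.Flag)
    (h : T.Joinable (X.out s) (Y.out t)) :
    T.Occurs (X.join Y s t).genus (X.join Y s t).numIn (X.join Y s t).numOut := by
  have hi := join_count X Y s t false
  have ho := join_count X Y s t true
  change (X.join Y s t).numIn + _ = X.numIn + Y.numIn at hi
  change (X.join Y s t).numOut + _ = X.numOut + Y.numOut at ho
  have hg : (X.join Y s t).genus = X.genus + Y.genus := rfl
  cases T
  · obtain ⟨h1, h2⟩ := hX
    obtain ⟨h3, h4⟩ := hY
    refine ⟨by omega, ?_⟩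
    have := h trivial
    cases hs : X.out s <;> cases ht : Y.out t <;> simp [hs, ht] at this ho <;> omega
  · obtain ⟨h1, h2⟩ := hX
    obtain ⟨h3, h4⟩ := hY
    exact ⟨by omega, by omega⟩
  · change _ = 0 at hX hY ⊢; omega
  · change _ = 0 at hX hY ⊢; omega
  · change _ = 0 at hX hY ⊢; omega
  · change _ = 0 at hX hY ⊢; omega
  · obtain ⟨h1, h2⟩ := hX
    obtain ⟨h3, h4⟩ := hY
    refine ⟨by omega, ?_⟩
    rw [out_eq_false_of_numOut h1, out_eq_false_of_numOut h3] at hi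
    simp at hi
    omega

end Corolla

/-- The corolla `W` consists of the flags of `X` and `Y` without `s` and `t`, which can be joined
to an edge. -/
structure Join {T : OpType} (X Y W : T.Vertex) (s : X.1.Flag) (t : Y.1.Flag) where
  val : W.1.Flag → X.1.Flag ⊕ Y.1.Flag
  injective : Function.Injective val
  mem_range : ∀ f, f ∈ Set.range val ↔ f ≠ Sum.inl s ∧ f ≠ Sum.inr t
  out_val : ∀ f, Sum.elim X.1.out Y.1.out (val f) = W.1.out f
  genus_eq : W.1.genus = X.1.genus + Y.1.genus
  joinable : T.Joinable (X.1.out s) (Y.1.out t)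

namespace Join

variable {T : OpType} {X Y Z W X' Y' W' : T.Vertex} {s : X.1.Flag} {t : Y.1.Flag}

def symm (D : Join X Y W s t) : Join Y X W t s where
  val f := (D.val f).swap
  injective := Sum.swap_leftInverse.injective.comp D.injective
  mem_range f := by
    have := D.mem_range f.swap
    simp only [Set.mem_range] at this ⊢
    rw [show (∃ y, (D.val y).swap = f) ↔ ∃ y, D.val y = f.swap from
      exists_congr fun y => ⟨fun h => by rw [← h, Sum.swap_swap], fun h => by rw [h, Sum.swap_swap]⟩,
      this]
    rcases f with f | f <;> simp
  out_val f := by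
    rw [← D.out_val f]
    rcases D.val f with g | g <;> rfl
  genus_eq := by rw [D.genus_eq, add_comm]
  joinable := D.joinable.symm

@[simp]
theorem symm_val (D : Join X Y W s t) (f : W.1.Flag) : D.symm.val f = (D.val f).swap := rfl

theorem symm_symm (D : Join X Y W s t) : D.symm.symm = D := by
  cases D
  simp only [symm, Sum.swap_swap]

/-- Replacing the result by an isomorphic corolla. -/
def congr (D : Join X Y W s t) (θ : Corolla.Iso W'.1 W.1) : Join X Y W' s t where
  val f := D.val (θ.flag f)
  injective := D.injective.comp θ.flag.injective
  mem_range f := by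
    rw [← D.mem_range, ← θ.flag.surjective.range_comp D.val]
    rfl
  out_val f := by rw [D.out_val, θ.out_eq]
  genus_eq := by rw [← D.genus_eq, θ.genus_eq]
  joinable := D.joinable

/-- The isomorphism of the results induced by isomorphisms of the factors. -/
def mapIso (φ : Corolla.Iso X.1 X'.1) (ψ : Corolla.Iso Y.1 Y'.1)
    (D : Join X Y W s t) (D' : Join X' Y' W' (φ.flag s) (ψ.flag t)) : Corolla.Iso W.1 W'.1 :=
  Corolla.Iso.over (fun f => Sum.map φ.flag ψ.flag (D.val f)) D'.val
    ((Sum.map_injective.2 ⟨φ.flag.injective, ψ.flag.injective⟩).comp D.injective) D'.injective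
    (fun f => by
      rw [D'.mem_range]
      have h : f ∈ Set.range (fun f => Sum.map φ.flag ψ.flag (D.val f)) ↔
          Sum.map φ.flag.symm ψ.flag.symm f ∈ Set.range D.val := by
        constructor
        · rintro ⟨y, rfl⟩
          exact ⟨y, by cases h : D.val y <;> simp [h]⟩
        · rintro ⟨y, hy⟩
          exact ⟨y, by
            change Sum.map φ.flag ψ.flag (D.val y) = f
            rw [hy]; rcases f with g | g <;> simp⟩
      rw [h, D.mem_range]
      rcases f with g | g <;> simp [Equiv.symm_apply_eq])
    (fun x y h => by
      rw [← D.out_val, ← D'.out_val, ← h]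
      rcases D.val x with g | g <;> simp [φ.out_eq, ψ.out_eq])
    (by rw [D.genus_eq, D'.genus_eq, φ.genus_eq, ψ.genus_eq])

theorem mapIso_spec (φ : Corolla.Iso X.1 X'.1) (ψ : Corolla.Iso Y.1 Y'.1)
    (D : Join X Y W s t) (D' : Join X' Y' W' (φ.flag s) (ψ.flag t)) (f : W.1.Flag) :
    D'.val ((mapIso φ ψ D D').flag f) = Sum.map φ.flag ψ.flag (D.val f) :=
  Corolla.Iso.over_spec _ _ _ _ _ _ _ f

theorem val_ne_inr (D : Join X Y W s t) (f : W.1.Flag) : D.val f ≠ Sum.inr t :=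
  ((D.mem_range _).1 ⟨f, rfl⟩).2

end Join

/-- The flags of `X` and `Y` without `s` and `t`. -/
def OpType.join {T : OpType} (X Y : T.Vertex) (s : X.1.Flag) (t : Y.1.Flag)
    (h : T.Joinable (X.1.out s) (Y.1.out t)) : T.Vertex :=
  ⟨X.1.join Y.1 s t, Corolla.join_occurs X.2 Y.2 s t h⟩

def Join.std {T : OpType} (X Y : T.Vertex) (s : X.1.Flag) (t : Y.1.Flag)
    (h : T.Joinable (X.1.out s) (Y.1.out t)) : Join X Y (T.join X Y s t h) s t where
  val := joinVal (X := X.1) (Y := Y.1) (s := s) (t := t)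
  injective := Sum.map_injective.2 ⟨Subtype.val_injective, Subtype.val_injective⟩
  mem_range f := by
    constructor
    · rintro ⟨g | g, rfl⟩
      · simpa [joinVal] using g.2
      · simpa [joinVal] using g.2
    · rintro ⟨h1, h2⟩
      rcases f with f | f
      · exact ⟨Sum.inl ⟨f, fun h => h1 (h ▸ rfl)⟩, rfl⟩
      · exact ⟨Sum.inr ⟨f, fun h => h2 (h ▸ rfl)⟩, rfl⟩
  out_val f := by rcases f with f | f <;> rfl
  genus_eq := rfl
  joinable := h

/-- The two ways of joining three corollas `X`, `Y`, `Z` along the edges `(s, t)` and `(t', w)`. -/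
structure JoinAssoc {T : OpType} {X Y Z U V W : T.Vertex} {s : X.1.Flag} {t t' : Y.1.Flag}
    {w : Z.1.Flag} {f : U.1.Flag} {g : V.1.Flag} (D₁ : Join X Y U s t) (D₂ : Join U Z W f w)
    (D₃ : Join Y Z V t' w) (D₄ : Join X V W s g) : Prop where
  left : D₁.val f = Sum.inr t'
  right : D₃.val g = Sum.inl t
  val_eq : ∀ x, Sum.map id D₃.val (D₄.val x) = Equiv.sumAssoc _ _ _ (Sum.map D₁.val id (D₂.val x))

/-! ### Graded modules over corollas -/

namespace SMod

variable {k : Type v} [Field k] {T : OpType} (O : SMod.{u} k T)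

theorem map_map {X Y Z : T.Vertex} (φ : Corolla.Iso X.1 Y.1) (ψ : Corolla.Iso Y.1 Z.1)
    (θ : Corolla.Iso X.1 Z.1) (h : ∀ f, ψ.flag (φ.flag f) = θ.flag f) (a : O.obj X) :
    O.map ψ (O.map φ a) = O.map θ a := by
  rw [← O.map_trans]
  congr 2
  ext f
  exact h f

theorem map_symm_map {X Y : T.Vertex} (φ : Corolla.Iso X.1 Y.1) (a : O.obj X) :
    O.map φ.symm (O.map φ a) = a := by
  rw [← O.map_trans, φ.trans_symm, O.map_refl]

/-- Every element is a finite sum of homogeneous ones. No separate case is needed for `0`, which is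
homogeneous of degree `0`. -/
theorem homogeneous_induction {X : T.Vertex} {p : O.obj X → Prop}
    (h : ∀ d a, a ∈ O.gr X d → p a) (hadd : ∀ a b, p a → p b → p (a + b)) (a : O.obj X) : p a := by
  have ha : a ∈ ⨆ d, O.gr X d := by
    rw [(O.internal X).submodule_iSup_eq_top]; trivial
  induction ha using Submodule.iSup_induction' with
  | mem d a ha => exact h d a ha
  | zero => exact h 0 0 (Submodule.zero_mem _)
  | add a b _ _ ha hb => exact hadd a b ha hb

/-- The linear map that acts on the part of degree `d` as the scalar `c d`. -/
def scale (c : ℤ → k) (X : T.Vertex) : O.obj X →ₗ[k] O.obj X :=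
  (DirectSum.toModule k ℤ _ fun d => c d • (O.gr X d).subtype) ∘ₗ
    (LinearEquiv.ofBijective (DirectSum.coeLinearMap (O.gr X)) (O.internal X)).symm.toLinearMap

theorem scale_apply (c : ℤ → k) {X : T.Vertex} {d : ℤ} {a : O.obj X} (ha : a ∈ O.gr X d) :
    O.scale c X a = c d • a := by
  have h : (LinearEquiv.ofBijective (DirectSum.coeLinearMap (O.gr X)) (O.internal X)).symm a =
      DirectSum.lof k ℤ (fun d => O.gr X d) d ⟨a, ha⟩ := by
    rw [LinearEquiv.symm_apply_eq]
    exact (DirectSum.coeLinearMap_lof (O.gr X) d ⟨a, ha⟩).symm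
  simp [scale, h]

theorem scale_map (c : ℤ → k) {X Y : T.Vertex} (φ : Corolla.Iso X.1 Y.1) (a : O.obj X) :
    O.scale c Y (O.map φ a) = O.map φ (O.scale c X a) := by
  induction a using O.homogeneous_induction with
  | h d a ha => rw [O.scale_apply c ha, O.scale_apply c (O.map_gr φ d a ha), map_smul]
  | hadd a b ha hb => simp only [map_add, ha, hb]

end SMod

/-! ### Signs -/

theorem negOnePow_congr {m n : ℤ} (h : Even (m - n)) : m.negOnePow = n.negOnePow :=
  (Int.negOnePow_eq_iff m n).2 h

theorem map_units_zsmul {k V W : Type*} [Field k] [AddCommGroup V] [Module k V] [AddCommGroup W]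
    [Module k W] (f : V →ₗ[k] W) (n : ℤˣ) (x : V) : f (n • x) = n • f x := by
  rw [Units.smul_def, map_zsmul, Units.smul_def]

theorem map_units_zsmul_left {k V W U : Type*} [Field k] [AddCommGroup V] [Module k V]
    [AddCommGroup W] [Module k W] [AddCommGroup U] [Module k U] (f : V →ₗ[k] W →ₗ[k] U) (n : ℤˣ)
    (x : V) (y : W) : f (n • x) y = n • f x y := by
  rw [map_units_zsmul, Units.smul_def, Units.smul_def, LinearMap.smul_apply]

theorem units_zsmul_mem {k V : Type*} [Field k] [AddCommGroup V] [Module k V] (p : Submodule k V)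
    (n : ℤˣ) {x : V} (hx : x ∈ p) : n • x ∈ p := by
  rw [Units.smul_def]; exact zsmul_mem hx _

/-! ### The universal invariant of a graded module over corollas -/

/-- `V` is the universal vector space with linear maps from all `O(X)` that are invariant under
isomorphisms of corollas. -/
structure Colim {k : Type v} [Field k] {T : OpType} (O : SMod.{u} k T) (V : Type u)
    [AddCommGroup V] [Module k V] where
  cl : ∀ X, O.obj X →ₗ[k] V
  cl_map : ∀ {X Y : T.Vertex} (φ : Corolla.Iso X.1 Y.1) (a : O.obj X), cl Y (O.map φ a) = cl X a
  eq_top : ∀ p : Submodule k V, (∀ X a, cl X a ∈ p) → p = ⊤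
  exists_desc : ∀ {W : Type u} [AddCommGroup W] [Module k W] (f : ∀ X, O.obj X →ₗ[k] W),
    (∀ {X Y : T.Vertex} (φ : Corolla.Iso X.1 Y.1) (a : O.obj X), f Y (O.map φ a) = f X a) →
    ∃ g : V →ₗ[k] W, ∀ X a, g (cl X a) = f X a

namespace Colim

variable {k : Type v} [Field k] {T : OpType} {O : SMod.{u} k T} {V : Type u}
  [AddCommGroup V] [Module k V] (C : Colim O V)

theorem hom_ext {W : Type*} [AddCommGroup W] [Module k W] {f g : V →ₗ[k] W}
    (h : ∀ X d a, a ∈ O.gr X d → f (C.cl X a) = g (C.cl X a)) : f = g := by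
  have := C.eq_top (LinearMap.eqLocus f g) fun X a => by
    induction a using O.homogeneous_induction with
    | h d a ha => exact h X d a ha
    | hadd a b ha hb => rw [map_add]; exact Submodule.add_mem _ ha hb
  exact LinearMap.ext fun x => show x ∈ LinearMap.eqLocus f g by rw [this]; trivial

theorem hom_ext₂ {W : Type*} [AddCommGroup W] [Module k W] {f g : V →ₗ[k] V →ₗ[k] W}
    (h : ∀ X Y i j a b, a ∈ O.gr X i → b ∈ O.gr Y j →
      f (C.cl X a) (C.cl Y b) = g (C.cl X a) (C.cl Y b)) : f = g :=
  C.hom_ext fun X i a ha => C.hom_ext fun Y j b hb => h X Y i j a b ha hb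

/-- The part of degree `d`. -/
def gr (d : ℤ) : Submodule k V :=
  Submodule.span k {x | ∃ X a, a ∈ O.gr X d ∧ C.cl X a = x}

theorem cl_mem {X : T.Vertex} {d : ℤ} {a : O.obj X} (ha : a ∈ O.gr X d) : C.cl X a ∈ C.gr d :=
  Submodule.subset_span ⟨X, a, ha, rfl⟩

theorem gr_induction {d : ℤ} {p : V → Prop} (hzero : p 0) (h : ∀ X a, a ∈ O.gr X d → p (C.cl X a))
    (hadd : ∀ x y, p x → p y → p (x + y)) {x : V} (hx : x ∈ C.gr d) : p x := by
  -- The predicate is not assumed stable under scalars, so the scalar is carried along and absorbed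
  -- into the homogeneous representative.
  have key : ∀ x ∈ C.gr d, ∀ c : k, p (c • x) := by
    intro x hx
    induction hx using Submodule.span_induction with
    | mem x hx =>
      obtain ⟨X, a, ha, rfl⟩ := hx
      intro c
      rw [← map_smul]
      exact h X _ (Submodule.smul_mem _ _ ha)
    | zero => intro c; rw [smul_zero]; exact hzero
    | add x y _ _ hx hy => intro c; rw [smul_add]; exact hadd _ _ (hx c) (hy c)
    | smul r x _ hx => intro c; rw [smul_smul]; exact hx _
  simpa using key x hx 1

/-- Isomorphisms preserve degrees, so the projection to degree `d` descends to the universal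
invariant. It is the identity on `C.gr d` and kills every other `C.gr e`, which gives independence.
-/
theorem isInternal : DirectSum.IsInternal C.gr := by
  rw [DirectSum.isInternal_submodule_iff_iSupIndep_and_iSup_eq_top]
  refine ⟨fun d => ?_, C.eq_top _ fun X a => ?_⟩
  · obtain ⟨g, hg⟩ := C.exists_desc
      (fun X => C.cl X ∘ₗ O.scale (fun e => if e = d then 1 else 0) X) (fun φ a => by
        rw [LinearMap.comp_apply, O.scale_map, C.cl_map, LinearMap.comp_apply])
    rw [Submodule.disjoint_def]
    intro x hx hx'
    have h1 : C.gr d ≤ LinearMap.eqLocus g LinearMap.id := by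
      refine Submodule.span_le.2 ?_
      rintro _ ⟨X, a, ha, rfl⟩
      change g (C.cl X a) = C.cl X a
      rw [hg, LinearMap.comp_apply, O.scale_apply _ ha, if_pos rfl, one_smul]
    have h2 : ⨆ e, ⨆ (_ : e ≠ d), C.gr e ≤ LinearMap.ker g := by
      refine iSup₂_le fun e he => Submodule.span_le.2 ?_
      rintro _ ⟨X, a, ha, rfl⟩
      change g (C.cl X a) = 0
      rw [hg, LinearMap.comp_apply, O.scale_apply _ ha, if_neg he, zero_smul, map_zero]
    exact (h1 hx).symm.trans (h2 hx')
  · induction a using O.homogeneous_induction with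
    | h d a ha => exact Submodule.mem_iSup_of_mem d (C.cl_mem ha)
    | hadd a b ha hb => rw [map_add]; exact Submodule.add_mem _ ha hb

end Colim

/-! ### Antisymmetric gluings and their brackets -/

/-- Compositions along single edges of degree `0` that are equivariant, associative and
antisymmetric. -/
structure AntiGluing {k : Type v} [Field k] {T : OpType} (O : SMod.{u} k T) where
  glue : ∀ {X Y W : T.Vertex} {s : X.1.Flag} {t : Y.1.Flag}, Join X Y W s t →
    O.obj X →ₗ[k] O.obj Y →ₗ[k] O.obj W
  glue_gr : ∀ {X Y W : T.Vertex} {s : X.1.Flag} {t : Y.1.Flag} (D : Join X Y W s t) {i j : ℤ}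
    {a : O.obj X} {b : O.obj Y}, a ∈ O.gr X i → b ∈ O.gr Y j → glue D a b ∈ O.gr W (i + j)
  equivariant : ∀ {X Y W X' Y' W' : T.Vertex} {s : X.1.Flag} {t : Y.1.Flag}
    (φ : Corolla.Iso X.1 X'.1) (ψ : Corolla.Iso Y.1 Y'.1) (χ : Corolla.Iso W.1 W'.1)
    (D : Join X Y W s t) (D' : Join X' Y' W' (φ.flag s) (ψ.flag t)),
    (∀ f, D'.val (χ.flag f) = Sum.map φ.flag ψ.flag (D.val f)) →
    ∀ {i j : ℤ} {a : O.obj X} {b : O.obj Y}, a ∈ O.gr X i → b ∈ O.gr Y j →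
    glue D' (O.map φ a) (O.map ψ b) = O.map χ (glue D a b)
  antisymm : ∀ {X Y W : T.Vertex} {s : X.1.Flag} {t : Y.1.Flag} (D : Join X Y W s t) {i j : ℤ}
    {a : O.obj X} {b : O.obj Y}, a ∈ O.gr X i → b ∈ O.gr Y j →
    glue D a b = -((i * j).negOnePow • glue D.symm b a)
  assoc : ∀ {X Y Z U V W : T.Vertex} {s : X.1.Flag} {t t' : Y.1.Flag}
    {w : Z.1.Flag} {f : U.1.Flag} {g : V.1.Flag} {D₁ : Join X Y U s t} {D₂ : Join U Z W f w}
    {D₃ : Join Y Z V t' w} {D₄ : Join X V W s g}, JoinAssoc D₁ D₂ D₃ D₄ →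
    ∀ {i j l : ℤ} {a : O.obj X} {b : O.obj Y} {c : O.obj Z},
    a ∈ O.gr X i → b ∈ O.gr Y j → c ∈ O.gr Z l →
    glue D₂ (glue D₁ a b) c = glue D₄ a (glue D₃ b c)

/-- The pairs of flags that can be joined to an edge. -/
abbrev Pairs {T : OpType} (X Y : T.Vertex) : Type :=
  {p : X.1.Flag × Y.1.Flag // T.Joinable (X.1.out p.1) (Y.1.out p.2)}

instance {T : OpType} (X Y : T.Vertex) : Fintype (Pairs X Y) := Fintype.ofFinite _

/-- The pairs of edges that join `X`, `Y`, `Z` to a chain. -/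
abbrev Chains {T : OpType} (X Y Z : T.Vertex) : Type :=
  {q : (X.1.Flag × Y.1.Flag) × (Y.1.Flag × Z.1.Flag) //
    T.Joinable (X.1.out q.1.1) (Y.1.out q.1.2) ∧ T.Joinable (Y.1.out q.2.1) (Z.1.out q.2.2) ∧
      q.1.2 ≠ q.2.1}

instance {T : OpType} (X Y Z : T.Vertex) : Fintype (Chains X Y Z) := Fintype.ofFinite _

abbrev Pairs.join {T : OpType} {X Y : T.Vertex} (p : Pairs X Y) :
    Join X Y (T.join X Y p.1.1 p.1.2 p.2) p.1.1 p.1.2 := Join.std X Y p.1.1 p.1.2 p.2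

def Pairs.equiv {T : OpType} {X Y X' Y' : T.Vertex} (φ : Corolla.Iso X.1 X'.1)
    (ψ : Corolla.Iso Y.1 Y'.1) : Pairs X Y ≃ Pairs X' Y' :=
  (φ.flag.prodCongr ψ.flag).subtypeEquiv fun p => by simp [φ.out_eq, ψ.out_eq]

/-- The first edge of a chain, after the second one has been contracted. -/
def Chains.outer {T : OpType} {X Y Z : T.Vertex} (q : Chains X Y Z) :
    Pairs X (T.join Y Z q.1.2.1 q.1.2.2 q.2.2.1) :=
  ⟨(q.1.1.1, Sum.inl ⟨q.1.1.2, q.2.2.2⟩), q.2.1⟩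

def Chains.reverse {T : OpType} (X Y Z : T.Vertex) : Chains X Y Z ≃ Chains Z Y X where
  toFun q := ⟨((q.1.2.2, q.1.2.1), (q.1.1.2, q.1.1.1)), q.2.2.1.symm, q.2.1.symm, q.2.2.2.symm⟩
  invFun q := ⟨((q.1.2.2, q.1.2.1), (q.1.1.2, q.1.1.1)), q.2.2.1.symm, q.2.1.symm, q.2.2.2.symm⟩
  left_inv _ := rfl
  right_inv _ := rfl

/-- Joining `X` to the join of `Y` and `Z`, the edge ends at a flag of `Y` or of `Z`. -/
def chainsEquiv {T : OpType} (X Y Z : T.Vertex) :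
    Chains X Y Z ⊕ Chains X Z Y ≃ Σ q : Pairs Y Z, Pairs X (T.join Y Z q.1.1 q.1.2 q.2) where
  toFun := Sum.elim (fun q => ⟨⟨q.1.2, q.2.2.1⟩, q.outer⟩)
    (fun q => ⟨⟨q.1.2.swap, q.2.2.1.symm⟩, ⟨(q.1.1.1, Sum.inr ⟨q.1.1.2, q.2.2.2⟩), q.2.1⟩⟩)
  invFun r := match r with
    | ⟨⟨(t, w), h⟩, ⟨(s, Sum.inl t'), h'⟩⟩ => Sum.inl ⟨((s, t'.1), (t, w)), h', h, t'.2⟩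
    | ⟨⟨(t, w), h⟩, ⟨(s, Sum.inr w'), h'⟩⟩ => Sum.inr ⟨((s, w'.1), (w, t)), h', h.symm, w'.2⟩
  left_inv := by rintro (⟨⟨⟨s, t⟩, ⟨t', w⟩⟩, h⟩ | ⟨⟨⟨s, t⟩, ⟨t', w⟩⟩, h⟩) <;> rfl
  right_inv := by rintro ⟨⟨⟨t, w⟩, h⟩, ⟨⟨s, t' | t'⟩, h'⟩⟩ <;> rfl

/-- The flags surviving in a triple join are described inside `X ⊕ (Y ⊕ Z)`, without reference to
the order of the gluings; this is what makes the two bracketings comparable. -/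
theorem Join.mem_range_assoc {T : OpType} {X Y Z V W : T.Vertex} {s : X.1.Flag} {t t' : Y.1.Flag}
    {w : Z.1.Flag} {g : V.1.Flag} (D₃ : Join Y Z V t' w) (D₄ : Join X V W s g)
    (hr : D₃.val g = Sum.inl t) (a : X.1.Flag ⊕ (Y.1.Flag ⊕ Z.1.Flag)) :
    a ∈ Set.range (fun x => Sum.map id D₃.val (D₄.val x)) ↔
      a ≠ Sum.inl s ∧ a ≠ Sum.inr (Sum.inl t) ∧ a ≠ Sum.inr (Sum.inl t') ∧
        a ≠ Sum.inr (Sum.inr w) := by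
  have h1 : a ∈ Set.range (fun x => Sum.map id D₃.val (D₄.val x)) ↔ ∃ b, b ∈ Set.range D₄.val ∧ Sum.map id D₃.val b = a := by
    simp
  rw [h1]
  constructor
  · rintro ⟨b, hb, rfl⟩
    rw [D₄.mem_range] at hb
    rcases b with b | b
    · simpa using hb.1
    · have h3 := (D₃.mem_range (D₃.val b)).1 ⟨b, rfl⟩
      have h4 : b ≠ g := fun h => hb.2 (h ▸ rfl)
      refine ⟨by simp, ?_, ?_, ?_⟩
      · simpa [← hr] using fun h => h4 (D₃.injective h)
      · simpa using h3.1
      · simpa using h3.2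
  · rintro ⟨h1, h2, h3, h4⟩
    rcases a with a | a
    · exact ⟨Sum.inl a, (D₄.mem_range _).2 ⟨by simpa using h1, by simp⟩, rfl⟩
    · obtain ⟨b, rfl⟩ := (D₃.mem_range a).2 ⟨by simpa using h3, by simpa using h4⟩
      refine ⟨Sum.inr b, (D₄.mem_range _).2 ⟨by simp, ?_⟩, rfl⟩
      rintro h
      rw [Sum.inr.injEq] at h
      subst h
      exact h2 (by rw [hr])

/-- Both bracketings delete the same four flags `s`, `t`, `t'`, `w`, so a result `W` of the
right-hand one also serves as a result of the left-hand one. -/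
theorem Join.exists_assoc {T : OpType} {X Y Z U V W : T.Vertex} {s : X.1.Flag} {t t' : Y.1.Flag}
    {w : Z.1.Flag} {f : U.1.Flag} {g : V.1.Flag} (D₁ : Join X Y U s t)
    (D₃ : Join Y Z V t' w) (D₄ : Join X V W s g) (hl : D₁.val f = Sum.inr t')
    (hr : D₃.val g = Sum.inl t) : ∃ D₂ : Join U Z W f w, JoinAssoc D₁ D₂ D₃ D₄ := by
  have hf : U.1.out f = Y.1.out t' := by rw [← D₁.out_val, hl]; rfl
  let E := Join.std U Z f w (by rw [hf]; exact D₃.joinable)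
  let l : W.1.Flag → X.1.Flag ⊕ (Y.1.Flag ⊕ Z.1.Flag) := fun x => Sum.map id D₃.val (D₄.val x)
  let r : (T.join U Z f w E.joinable).1.Flag → X.1.Flag ⊕ (Y.1.Flag ⊕ Z.1.Flag) :=
    fun x => Equiv.sumAssoc _ _ _ (Sum.map D₁.val id (E.val x))
  have hls := Join.mem_range_assoc D₃ D₄ hr
  have hrs : ∀ a, a ∈ Set.range r ↔
      a ≠ Sum.inl s ∧ a ≠ Sum.inr (Sum.inl t) ∧ a ≠ Sum.inr (Sum.inl t') ∧
        a ≠ Sum.inr (Sum.inr w) := by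
    intro a
    have h1 : a ∈ Set.range r ↔ ∃ b, b ∈ Set.range E.val ∧
        Equiv.sumAssoc _ _ _ (Sum.map D₁.val id b) = a := by
      simp [r]
    rw [h1]
    constructor
    · rintro ⟨b, hb, rfl⟩
      rw [E.mem_range] at hb
      rcases b with b | b
      · have h3 := (D₁.mem_range (D₁.val b)).1 ⟨b, rfl⟩
        have h4 : b ≠ f := fun h => hb.1 (h ▸ rfl)
        have h5 : D₁.val b ≠ Sum.inr t' := by rw [← hl]; exact fun h => h4 (D₁.injective h)
        rcases hd : D₁.val b with y | y <;> simp [hd] at h3 h5 ⊢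
        · exact h3
        · exact ⟨h3, h5⟩
      · simpa using hb.2
    · rintro ⟨h1, h2, h3, h4⟩
      have key : ∀ c : X.1.Flag ⊕ Y.1.Flag, c ≠ Sum.inl s → c ≠ Sum.inr t → c ≠ Sum.inr t' →
          ∃ b, b ∈ Set.range E.val ∧ Sum.map D₁.val id b = Sum.inl c := by
        intro c hc1 hc2 hc3
        obtain ⟨b, rfl⟩ := (D₁.mem_range c).2 ⟨hc1, hc2⟩
        refine ⟨Sum.inl b, (E.mem_range _).2 ⟨?_, by simp⟩, rfl⟩
        intro h
        rw [Sum.inl.injEq] at h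
        exact hc3 (by rw [h, hl])
      rcases a with a | a | a
      · obtain ⟨b, hb, hb'⟩ := key (Sum.inl a) (by simpa using h1) (by simp) (by simp)
        exact ⟨b, hb, by rw [hb']; rfl⟩
      · obtain ⟨b, hb, hb'⟩ := key (Sum.inr a) (by simp) (by simpa using h2) (by simpa using h3)
        exact ⟨b, hb, by rw [hb']; rfl⟩
      · exact ⟨Sum.inr a, (E.mem_range _).2 ⟨by simp, by simpa using h4⟩, rfl⟩
  -- The comparison of `W` with the standard left-hand join, both embedded in the disjoint union of
  -- all three sets of flags.
  let θ : Corolla.Iso W.1 (T.join U Z f w E.joinable).1 := Corolla.Iso.over l r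
    ((Sum.map_injective.2 ⟨Function.injective_id, D₃.injective⟩).comp D₄.injective)
    ((Equiv.injective _).comp ((Sum.map_injective.2 ⟨D₁.injective, Function.injective_id⟩).comp
      E.injective))
    (fun a => (hls a).trans (hrs a).symm)
    (fun x y h => by
      have h1 : Sum.elim X.1.out (Sum.elim Y.1.out Z.1.out) (l x) = W.1.out x := by
        rw [← D₄.out_val]
        simp only [l]
        rcases D₄.val x with z | z
        · rfl
        · simp [← D₃.out_val]
      have h2 : Sum.elim X.1.out (Sum.elim Y.1.out Z.1.out) (r y) =
          (T.join U Z f w E.joinable).1.out y := by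
        rw [← E.out_val]
        simp only [r]
        rcases E.val y with z | z
        · simp only [Sum.map_inl, Sum.elim_inl, ← D₁.out_val]
          rcases D₁.val z with z | z <;> rfl
        · rfl
      rw [← h1, ← h2, h])
    (by rw [D₄.genus_eq, E.genus_eq, D₃.genus_eq, D₁.genus_eq, add_assoc])
  refine ⟨E.congr θ, hl, hr, fun x => ?_⟩
  exact (Corolla.Iso.over_spec l r _ _ _ _ _ x).symm

/-! ### The bracket of an antisymmetric gluing and its Jacobi identity -/

namespace AntiGluing

variable {k : Type v} [Field k] {T : OpType} {O : SMod.{u} k T} {V : Type u}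
  [AddCommGroup V] [Module k V] (C : Colim O V) (E : AntiGluing O)

theorem equivariant_all {X Y W X' Y' W' : T.Vertex} {s : X.1.Flag} {t : Y.1.Flag}
    (φ : Corolla.Iso X.1 X'.1) (ψ : Corolla.Iso Y.1 Y'.1) (χ : Corolla.Iso W.1 W'.1)
    (D : Join X Y W s t) (D' : Join X' Y' W' (φ.flag s) (ψ.flag t))
    (h : ∀ f, D'.val (χ.flag f) = Sum.map φ.flag ψ.flag (D.val f)) (a : O.obj X) (b : O.obj Y) :
    E.glue D' (O.map φ a) (O.map ψ b) = O.map χ (E.glue D a b) := by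
  induction a using O.homogeneous_induction with
  | h i a ha =>
    induction b using O.homogeneous_induction with
    | h j b hb => exact E.equivariant φ ψ χ D D' h ha hb
    | hadd b b' h1 h2 => simp only [map_add, h1, h2]
  | hadd a a' h1 h2 => simp only [map_add, LinearMap.add_apply, h1, h2]

include E in
-- The isomorphisms of the factors induce one of the results, which the class does not see. With
-- identities for `φ` and `ψ` this says that the class does not depend on the corolla chosen as the
-- result of the gluing.
theorem cl_glue_map {X Y W X' Y' W' : T.Vertex} {s : X.1.Flag} {t : Y.1.Flag} {s' : X'.1.Flag}
    {t' : Y'.1.Flag} (φ : Corolla.Iso X.1 X'.1) (ψ : Corolla.Iso Y.1 Y'.1)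
    (D : Join X Y W s t) (D' : Join X' Y' W' s' t') (hs : φ.flag s = s') (ht : ψ.flag t = t')
    (a : O.obj X) (b : O.obj Y) :
    C.cl W' (E.glue D' (O.map φ a) (O.map ψ b)) = C.cl W (E.glue D a b) := by
  subst hs ht
  rw [E.equivariant_all φ ψ (Join.mapIso φ ψ D D') D D' (Join.mapIso_spec φ ψ D D'), C.cl_map]

/-- The sum over all compositions along a single edge. -/
def total (X Y : T.Vertex) : O.obj X →ₗ[k] O.obj Y →ₗ[k] V :=
  ∑ p : Pairs X Y, (E.glue p.join).compr₂ (C.cl _)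

theorem total_apply {X Y : T.Vertex} (a : O.obj X) (b : O.obj Y) :
    E.total C X Y a b = ∑ p : Pairs X Y, C.cl _ (E.glue p.join a b) := by
  simp [total, LinearMap.sum_apply]

theorem total_map {X Y X' Y' : T.Vertex} (φ : Corolla.Iso X.1 X'.1) (ψ : Corolla.Iso Y.1 Y'.1)
    (a : O.obj X) (b : O.obj Y) :
    E.total C X' Y' (O.map φ a) (O.map ψ b) = E.total C X Y a b := by
  rw [total_apply, total_apply]
  refine (Fintype.sum_equiv (Pairs.equiv φ ψ) _ _ fun p => ?_).symm
  exact (E.cl_glue_map C φ ψ _ _ rfl rfl a b).symm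

/-- The universal property is used twice, first in the second argument for fixed `a`, then in the
first argument with values in linear maps. Linearity in `a` of the intermediate maps follows from
their uniqueness. -/
theorem exists_bracket : ∃ br : V →ₗ[k] V →ₗ[k] V, ∀ X Y a b,
    br (C.cl X a) (C.cl Y b) = E.total C X Y a b := by
  have h1 : ∀ X (a : O.obj X), ∃ g : V →ₗ[k] V, ∀ Y b, g (C.cl Y b) = E.total C X Y a b := by
    intro X a
    refine C.exists_desc (fun Y => E.total C X Y a) fun {Y Y'} ψ b => ?_
    -- Writing `a` as its image under the identity allows `total_map`, which moves both arguments,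
    -- to move `b` alone.
    conv_lhs => rw [← O.map_refl X a]
    exact E.total_map C (Corolla.Iso.refl X.1) ψ a b
  choose g hg using h1
  obtain ⟨br, hbr⟩ := C.exists_desc (W := V →ₗ[k] V)
    (fun X =>
      { toFun := g X
        map_add' := fun a b => C.hom_ext fun Y _ c _ => by
          simp only [LinearMap.add_apply, hg, map_add]
        map_smul' := fun r a => C.hom_ext fun Y _ c _ => by
          simp only [LinearMap.smul_apply, hg, map_smul, RingHom.id_apply] })
    (fun {X X'} φ a => C.hom_ext fun Y _ c _ => by
      change g X' (O.map φ a) (C.cl Y c) = g X a (C.cl Y c)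
      rw [hg, hg]
      conv_lhs => rw [← O.map_refl Y c]
      exact E.total_map C φ (Corolla.Iso.refl Y.1) a c)
  exact ⟨br, fun X Y a b => by rw [hbr]; exact hg X a Y b⟩

theorem total_antisymm {X Y : T.Vertex} {i j : ℤ} {a : O.obj X} {b : O.obj Y}
    (ha : a ∈ O.gr X i) (hb : b ∈ O.gr Y j) :
    E.total C X Y a b = -((i * j).negOnePow • E.total C Y X b a) := by
  rw [total_apply, total_apply, Finset.smul_sum, ← Finset.sum_neg_distrib]
  refine Fintype.sum_equiv
    ((Equiv.prodComm _ _).subtypeEquiv fun p => ⟨fun h => h.symm, fun h => h.symm⟩) _ _ fun p => ?_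
  rw [E.antisymm _ ha hb, map_neg, map_units_zsmul]
  congr 2
  conv_rhs => rw [← O.map_refl X a, ← O.map_refl Y b]
  exact (E.cl_glue_map C (Corolla.Iso.refl Y.1) (Corolla.Iso.refl X.1) _ _ rfl rfl b a).symm

/-- The sum of the compositions `a ∘ (b ∘ c)` along all chains. -/
def chainSum {X Y Z : T.Vertex} (a : O.obj X) (b : O.obj Y) (c : O.obj Z) : V :=
  ∑ q : Chains X Y Z, C.cl _ (E.glue q.outer.join a
    (E.glue (Join.std Y Z q.1.2.1 q.1.2.2 q.2.2.1) b c))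

/-- Antisymmetry inside a double composition. The inner result `U'` need not be `U` with its factors
exchanged, so `D.symm` is compared with `D'` by an isomorphism; the hypothesis on `g'` says that the
outer edge ends at the same flag. -/
theorem cl_glue_comm {X Y Z U U' W W' : T.Vertex} {s : X.1.Flag} {t : Y.1.Flag} {w : Z.1.Flag}
    {g : U.1.Flag} {g' : U'.1.Flag} (D : Join Y Z U t w) (D' : Join Z Y U' w t)
    (D₀ : Join X U W s g) (D₀' : Join X U' W' s g') (hg : D'.val g' = (D.val g).swap)
    {j l : ℤ} (a : O.obj X) {b : O.obj Y} {c : O.obj Z} (hb : b ∈ O.gr Y j) (hc : c ∈ O.gr Z l) :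
    C.cl W (E.glue D₀ a (E.glue D b c)) =
      -((j * l).negOnePow • C.cl W' (E.glue D₀' a (E.glue D' c b))) := by
  rw [E.antisymm D hb hc, map_neg, map_neg, map_units_zsmul, map_units_zsmul]
  congr 2
  have hχ := Join.mapIso_spec (Corolla.Iso.refl Z.1) (Corolla.Iso.refl Y.1) D.symm D'
  have h1 := E.equivariant_all (Corolla.Iso.refl Z.1) (Corolla.Iso.refl Y.1) _ D.symm D' hχ c b
  rw [O.map_refl, O.map_refl] at h1
  have h2 := E.cl_glue_map C (Corolla.Iso.refl X.1) (Join.mapIso (Corolla.Iso.refl Z.1)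
    (Corolla.Iso.refl Y.1) D.symm D') D₀ D₀' rfl (D'.injective (by
      rw [hχ, hg, Join.symm_val]; cases D.val g <;> rfl)) a (E.glue D.symm c b)
  rw [O.map_refl] at h2
  exact h2.symm.trans (congrArg (fun y => C.cl W' (E.glue D₀' a y)) h1.symm)

/-- Associativity turns `a(bc)` into `(ab)c`; antisymmetry for the outer and the inner product turns
this into `c(ba)`. The two minus signs cancel, leaving `(i+j)l` from moving `c` past `ab` and `ij`
from exchanging `a` and `b`. -/
theorem cl_glue_reverse {X Y Z V₁ V₂ W W' : T.Vertex} {s : X.1.Flag} {t t' : Y.1.Flag}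
    {w : Z.1.Flag} {g : V₁.1.Flag} {g' : V₂.1.Flag} (D : Join Y Z V₁ t' w) (D' : Join Y X V₂ t s)
    (D₀ : Join X V₁ W s g) (D₀' : Join Z V₂ W' w g') (hg : D.val g = Sum.inl t)
    (hg' : D'.val g' = Sum.inl t') {i j l : ℤ} {a : O.obj X} {b : O.obj Y} {c : O.obj Z}
    (ha : a ∈ O.gr X i) (hb : b ∈ O.gr Y j) (hc : c ∈ O.gr Z l) :
    C.cl W (E.glue D₀ a (E.glue D b c)) =
      ((i + j) * l + i * j).negOnePow • C.cl W' (E.glue D₀' c (E.glue D' b a)) := by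
  obtain ⟨D₂, hD⟩ := Join.exists_assoc (f := g') D'.symm D D₀ (by rw [Join.symm_val, hg']; rfl) hg
  rw [← E.assoc hD ha hb hc, E.antisymm D₂ (E.glue_gr D'.symm ha hb) hc, E.antisymm D'.symm ha hb,
    map_neg, map_units_zsmul, map_neg, map_units_zsmul, map_neg, map_units_zsmul, smul_neg, neg_neg,
    smul_smul, ← Int.negOnePow_add, D'.symm_symm]
  have h2 := E.cl_glue_map C (Corolla.Iso.refl Z.1) (Corolla.Iso.refl V₂.1) D₂.symm D₀' rfl rfl c
    (E.glue D' b a)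
  rw [O.map_refl, O.map_refl] at h2
  rw [h2]

/-- The edge leaving `a` ends either at a flag of `b`, giving a chain with `b` in the middle, or at
a flag of `c`. In the second case exchanging `b` and `c` in the inner product gives a chain with `c`
in the middle, at the cost of the antisymmetry sign. -/
theorem sum_total_eq {X Y Z : T.Vertex} {j l : ℤ} (a : O.obj X) {b : O.obj Y} {c : O.obj Z}
    (hb : b ∈ O.gr Y j) (hc : c ∈ O.gr Z l) :
    ∑ q : Pairs Y Z, E.total C X _ a (E.glue q.join b c) =
      E.chainSum C a b c - (j * l).negOnePow • E.chainSum C a c b := by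
  have h1 : ∑ q : Pairs Y Z, E.total C X _ a (E.glue q.join b c) =
      ∑ r : Σ q : Pairs Y Z, Pairs X (T.join Y Z q.1.1 q.1.2 q.2),
        C.cl _ (E.glue r.2.join a (E.glue r.1.join b c)) := by
    rw [Fintype.sum_sigma]
    refine Finset.sum_congr rfl fun q _ => ?_
    rw [total_apply]
  refine h1.trans (((chainsEquiv X Y Z).sum_comp _).symm.trans ((Fintype.sum_sum_type _).trans ?_))
  refine (congrArg₂ (· + ·) rfl ?_).trans (sub_eq_add_neg (E.chainSum C a b c) _).symm
  refine Eq.trans ?_ (congrArg Neg.neg (Finset.smul_sum ..).symm)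
  rw [← Finset.sum_neg_distrib]
  refine Finset.sum_congr rfl fun q _ => ?_
  exact E.cl_glue_comm C _ _ _ _ rfl a hb hc

theorem chainSum_reverse {X Y Z : T.Vertex} {i j l : ℤ} {a : O.obj X} {b : O.obj Y} {c : O.obj Z}
    (ha : a ∈ O.gr X i) (hb : b ∈ O.gr Y j) (hc : c ∈ O.gr Z l) :
    E.chainSum C a b c = ((i + j) * l + i * j).negOnePow • E.chainSum C c b a := by
  rw [chainSum, chainSum, Finset.smul_sum]
  refine Fintype.sum_equiv (Chains.reverse X Y Z) _ _ fun q => ?_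
  exact E.cl_glue_reverse C _ _ _ _ rfl rfl ha hb hc

/-- All identities are multilinear and may be tested on classes of homogeneous elements, where the
double brackets become signed chain sums. -/
theorem isLieBracket {br : V →ₗ[k] V →ₗ[k] V}
    (hbr : ∀ X Y i j a b, a ∈ O.gr X i → b ∈ O.gr Y j →
      br (C.cl X a) (C.cl Y b) = E.total C X Y a b) : IsLieBracket C.gr br where
  internal := C.isInternal
  degree i j x y hx hy := by
    refine C.gr_induction (p := fun x => br x y ∈ C.gr (i + j)) (by simp) (fun X a ha => ?_)
      (fun x x' h h' => by rw [map_add]; exact Submodule.add_mem _ h h') hx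
    refine C.gr_induction (p := fun y => br _ y ∈ C.gr (i + j)) (by simp) (fun Y b hb => ?_)
      (fun x x' h h' => by rw [map_add]; exact Submodule.add_mem _ h h') hy
    rw [hbr X Y i j a b ha hb, total_apply]
    exact Submodule.sum_mem _ fun p _ => C.cl_mem (E.glue_gr p.join ha hb)
  antisymm i j x y hx hy := by
    refine C.gr_induction (p := fun x => br x y = -((i * j).negOnePow • br y x)) (by simp)
      (fun X a ha => ?_)
      (fun x x' h h' => by rw [map_add, map_add, LinearMap.add_apply, h, h', smul_add, neg_add]) hx
    refine C.gr_induction (p := fun y => br _ y = -((i * j).negOnePow • br y _)) (by simp)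
      (fun Y b hb => ?_)
      (fun x x' h h' => by rw [map_add, map_add, LinearMap.add_apply, h, h', smul_add, neg_add]) hy
    rw [hbr X Y i j a b ha hb, hbr Y X j i b a hb ha]
    exact E.total_antisymm C ha hb
  jacobi i j l x y z hx hy hz := by
    have aux : ∀ {A B C A' B' C' : V}, A + B + C = 0 → A' + B' + C' = 0 →
        (A + A') + (B + B') + (C + C') = 0 := by
      intro A B C A' B' C' h h'
      rw [show (A + A') + (B + B') + (C + C') = (A + B + C) + (A' + B' + C') by abel, h, h', add_zero]
    have key : ∀ {X Y Z : T.Vertex} {i j l : ℤ} {a : O.obj X} {b : O.obj Y} {c : O.obj Z},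
        a ∈ O.gr X i → b ∈ O.gr Y j → c ∈ O.gr Z l →
        br (C.cl X a) (br (C.cl Y b) (C.cl Z c)) =
          E.chainSum C a b c - (j * l).negOnePow • E.chainSum C a c b := by
      intro X Y Z i j l a b c ha hb hc
      rw [hbr Y Z j l b c hb hc, total_apply, map_sum, ← E.sum_total_eq C a hb hc]
      exact Finset.sum_congr rfl fun q _ => hbr _ _ _ _ _ _ ha (E.glue_gr q.join hb hc)
    let J : V → V → V → Prop := fun x y z => br x (br y z) +
      (l * (i + j)).negOnePow • br z (br x y) + (i * (j + l)).negOnePow • br y (br z x) = 0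
    refine C.gr_induction (p := fun x => J x y z) (by simp [J]) (fun X a ha => ?_)
      (fun x x' h h' => by
        simp only [J, map_add, LinearMap.add_apply, smul_add]; exact aux h h') hx
    refine C.gr_induction (p := fun y => J _ y z) (by simp [J]) (fun Y b hb => ?_)
      (fun x x' h h' => by
        simp only [J, map_add, LinearMap.add_apply, smul_add]; exact aux h h') hy
    refine C.gr_induction (p := fun z => J _ _ z) (by simp [J]) (fun Z c hc => ?_)
      (fun x x' h h' => by
        simp only [J, map_add, LinearMap.add_apply, smul_add]; exact aux h h') hz
    simp only [J]
    -- Of the six chain sums, three are reversed. There remain three chains, with middle vertices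
    -- `b`, `c` and `a`, each occurring twice; the congruences below show that the two signs are
    -- opposite.
    rw [key ha hb hc, key hc ha hb, key hb hc ha, E.chainSum_reverse C hc hb ha,
      E.chainSum_reverse C hb ha hc, E.chainSum_reverse C hb hc ha]
    simp only [smul_sub, smul_smul, ← Int.negOnePow_add]
    rw [show (l * (i + j) + (i * j + ((l + j) * i + l * j))).negOnePow = 1 from
        Int.negOnePow_even _ ⟨l * i + l * j + i * j, by ring⟩,
      show (i * (j + l) + (l * i + ((j + i) * l + j * i))).negOnePow = (l * (i + j)).negOnePow from
        negOnePow_congr ⟨i * j + i * l, by ring⟩,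
      show (i * (j + l) + ((j + l) * i + j * l)).negOnePow = (j * l).negOnePow from
        negOnePow_congr ⟨i * j + i * l, by ring⟩, one_smul]
    abel

end AntiGluing

/-! ### Twisting by a sign, and the direct sum of coinvariants -/

/-- A functor from corollas to the group `{1, -1}`. -/
structure SignRule (T : OpType) where
  sgn : ∀ {X Y : T.Vertex}, Corolla.Iso X.1 Y.1 → ℤˣ
  sgn_refl : ∀ X : T.Vertex, sgn (X := X) (Y := X) (Corolla.Iso.refl X.1) = 1
  sgn_trans : ∀ {X Y Z : T.Vertex} (φ : Corolla.Iso X.1 Y.1) (ψ : Corolla.Iso Y.1 Z.1),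
    sgn (X := X) (Y := Z) (φ.trans ψ) = sgn φ * sgn ψ

def SignRule.trivial (T : OpType) : SignRule T := ⟨fun _ => 1, fun _ => rfl, fun _ _ => rfl⟩

namespace SMod

variable {k : Type v} [Field k] {T : OpType}

/-- The degree of `O(X)` is shifted by `δ`, the action of isomorphisms multiplied by a sign. -/
abbrev twist (O : SMod.{u} k T) (S : SignRule T) (δ : T.Index → ℤ) : SMod.{u} k T where
  obj := O.obj
  addCommGroup := O.addCommGroup
  module := O.module
  gr X d := O.gr X (d - δ (T.index X))
  internal X := by
    have h := O.internal X
    rw [DirectSum.isInternal_submodule_iff_iSupIndep_and_iSup_eq_top] at h ⊢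
    refine ⟨h.1.comp (sub_left_injective (b := δ (T.index X))), ?_⟩
    rw [← h.2]
    exact (Equiv.subRight (δ (T.index X))).iSup_comp (g := O.gr X)
  map φ := S.sgn φ • O.map φ
  map_refl X a := by rw [S.sgn_refl, one_smul, O.map_refl]
  map_trans φ ψ a := by
    simp only [Units.smul_def, LinearMap.smul_apply, map_zsmul]
    rw [S.sgn_trans, O.map_trans, smul_smul, Units.val_mul]
  map_gr {X Y} φ d a ha := by
    simp only [Units.smul_def, LinearMap.smul_apply]
    rw [← index_eq_of_iso φ]
    exact zsmul_mem (O.map_gr φ _ a ha) _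

theorem twist_map (O : SMod.{u} k T) (S : SignRule T) (δ : T.Index → ℤ) {X Y : T.Vertex}
    (φ : Corolla.Iso X.1 Y.1) (a : O.obj X) : (O.twist S δ).map φ a = S.sgn φ • O.map φ a := by
  simp only [Units.smul_def, LinearMap.smul_apply]

variable (O : SMod.{u} k T) (S : SignRule T) (δ : T.Index → ℤ)
  (χ : ∀ i : T.Index, Corolla.Iso (T.std i).1 (T.std i).1 → ℤˣ)

/-- The class of an element of the value at the standard corolla. -/
def stdCls (i : T.Index) : O.obj (T.std i) →ₗ[k] O.CoinvBy χ :=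
  DirectSum.lof k T.Index (fun i => O.obj (T.std i) ⧸ O.coinvRel χ i) i ∘ₗ (O.coinvRel χ i).mkQ

theorem stdCls_map (i : T.Index) (σ : Corolla.Iso (T.std i).1 (T.std i).1)
    (a : O.obj (T.std i)) : O.stdCls χ i (χ i σ • O.map σ a) = O.stdCls χ i a := by
  simp only [stdCls, LinearMap.comp_apply]
  congr 1
  rw [← sub_eq_zero, ← map_sub, Submodule.mkQ_apply, Submodule.Quotient.mk_eq_zero]
  exact Submodule.subset_span ⟨σ, a, rfl⟩

/-- The class of an element in the coinvariants of the twisted action. -/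
def twistCls (X : T.Vertex) : O.obj X →ₗ[k] O.CoinvBy χ :=
  O.stdCls χ (T.index X) ∘ₗ (O.twist S δ).map (Classical.choice X.1.exists_iso_std)

variable {S χ} (hχ : ∀ i σ, χ i σ = S.sgn σ)

include hχ in
-- Two isomorphisms to the standard corolla differ by an automorphism of it, which acts trivially on
-- the twisted coinvariants; hence the chosen isomorphism may be replaced by any other.
theorem twistCls_eq {X : T.Vertex} {i : T.Index} (φ : Corolla.Iso X.1 (T.std i).1) (a : O.obj X) :
    O.twistCls S δ χ X a = O.stdCls χ i (S.sgn φ • O.map φ a) := by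
  obtain rfl : i = T.index X := by rw [index_eq_of_iso φ, index_std]
  set c : Corolla.Iso X.1 (T.std (T.index X)).1 := Classical.choice X.1.exists_iso_std
  have h1 : φ = c.trans (c.symm.trans φ) := by ext f; simp
  have h2 : S.sgn φ • O.map φ a = χ _ (c.symm.trans φ) •
      O.map (c.symm.trans φ) ((O.twist S δ).map c a) := by
    rw [hχ, ← twist_map (O := O) S δ, ← twist_map (O := O) S δ, ← SMod.map_trans]
    exact congrArg (fun ψ => (O.twist S δ).map ψ a) h1
  rw [h2, stdCls_map]
  rfl

include hχ in
theorem twistCls_std (i : T.Index) (a : O.obj (T.std i)) :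
    O.twistCls S δ χ (T.std i) a = O.stdCls χ i a := by
  rw [O.twistCls_eq δ hχ (Corolla.Iso.refl _), S.sgn_refl, one_smul, O.map_refl]

theorem coinvBy_eq_top (p : Submodule k (O.CoinvBy χ)) (h : ∀ i a, O.stdCls χ i a ∈ p) :
    p = ⊤ := by
  rw [eq_top_iff]
  rintro x -
  induction x using DirectSum.induction_on with
  | zero => exact Submodule.zero_mem _
  | of i x =>
    obtain ⟨a, rfl⟩ := Submodule.mkQ_surjective _ x
    exact h i a
  | add x y hx hy => exact Submodule.add_mem _ hx hy

/-- The direct sum of coinvariants is the universal invariant. -/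
def twistColim : Colim (O.twist S δ) (O.CoinvBy χ) where
  cl := O.twistCls S δ χ
  cl_map {X Y} φ a := by
    let c : Corolla.Iso Y.1 (T.std (T.index Y)).1 := Classical.choice Y.1.exists_iso_std
    rw [O.twistCls_eq δ hχ c, O.twistCls_eq δ hχ (φ.trans c), twist_map, S.sgn_trans, O.map_trans,
      map_units_zsmul (O.map c), smul_smul, mul_comm]
  eq_top p h := O.coinvBy_eq_top p fun i a => by rw [← O.twistCls_std δ hχ i a]; exact h _ a
  exists_desc {W} _ _ f hf := by
    refine ⟨DirectSum.toModule k T.Index W fun i =>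
      (O.coinvRel χ i).liftQ (f (T.std i)) ?_, fun X a => ?_⟩
    · refine Submodule.span_le.2 ?_
      rintro _ ⟨σ, a, rfl⟩
      change f _ _ = 0
      rw [map_sub, hχ, ← twist_map (O := O) S δ, hf, sub_self]
    · change DirectSum.toModule k T.Index W _ (DirectSum.lof k T.Index _ _ _) = _
      rw [DirectSum.toModule_lof]
      exact hf _ a

/-- Reconciles the grading spanned by classes of homogeneous elements with the one defined
componentwise. The nontrivial inclusion writes an element as the finite sum of its components, each
of which lifts to a homogeneous element. -/
theorem coinvByGr_eq (d : ℤ) : (O.twistColim δ hχ).gr d = O.coinvByGr χ δ d := by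
  apply le_antisymm
  · refine Submodule.span_le.2 ?_
    rintro _ ⟨X, a, ha, rfl⟩
    change O.twistCls S δ χ X a ∈ O.coinvByGr χ δ d
    simp only [coinvByGr, Submodule.mem_iInf, Submodule.mem_comap]
    intro i
    have hm := (O.twist S δ).map_gr (Y := T.std (T.index X)) (Classical.choice X.1.exists_iso_std)
      d a ha
    change _ ∈ O.gr _ (d - δ (T.index (T.std (T.index X)))) at hm
    rw [index_std] at hm
    by_cases hi : T.index X = i
    · subst hi
      refine ⟨_, hm, ?_⟩
      exact (DirectSum.component.lof_self k (ι := T.Index)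
        (M := fun i => O.obj (T.std i) ⧸ O.coinvRel χ i) _ _).symm
    · have : DirectSum.component k T.Index (fun i => O.obj (T.std i) ⧸ O.coinvRel χ i) i
          (O.twistCls S δ χ X a) = 0 := DirectSum.of_eq_of_ne _ _ _ (Ne.symm hi)
      rw [this]
      exact Submodule.zero_mem _
  · intro x hx
    simp only [coinvByGr, Submodule.mem_iInf, Submodule.mem_comap] at hx
    classical
    rw [← DirectSum.sum_support_of x]
    refine Submodule.sum_mem _ fun i _ => ?_
    obtain ⟨a, ha, hax⟩ := hx i
    have h1 : DirectSum.of (fun i => O.obj (T.std i) ⧸ O.coinvRel χ i) i (x i) =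
        (O.twistColim δ hχ).cl (T.std i) a := by
      change _ = O.twistCls S δ χ _ a
      rw [O.twistCls_std δ hχ]
      exact congrArg (DirectSum.of (fun i => O.obj (T.std i) ⧸ O.coinvRel χ i) i) hax.symm
    rw [h1]
    refine (O.twistColim δ hχ).cl_mem ?_
    change a ∈ O.gr _ (d - δ (T.index (T.std i)))
    rwa [index_std]

/-- The shift `Σ^c O`. -/
abbrev shift (c : ℤ) : SMod.{u} k T := O.twist (SignRule.trivial T) fun _ => c

theorem shift_map (c : ℤ) {X Y : T.Vertex} (φ : Corolla.Iso X.1 Y.1) (a : O.obj X) :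
    (O.shift c).map φ a = O.map φ a := by
  rw [twist_map]; exact one_smul _ _

def shiftColim (c : ℤ) : Colim (O.shift c) O.Coinv :=
  O.twistColim (fun _ => c) (S := SignRule.trivial T) fun _ _ => rfl

theorem shiftColim_cl (c : ℤ) {X : T.Vertex} (a : O.obj X) :
    (O.shiftColim c).cl X a = O.cls a := by
  change O.stdCls (fun _ _ => 1) _ ((O.shift c).map _ a) = _
  rw [shift_map]
  rfl

theorem shiftColim_gr (c : ℤ) : (O.shiftColim c).gr = O.coinvGr c :=
  funext fun d => O.coinvByGr_eq (fun _ => c) (S := SignRule.trivial T) (fun _ _ => rfl) d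

theorem cls_map {X Y : T.Vertex} (φ : Corolla.Iso X.1 Y.1) (a : O.obj X) :
    O.cls (O.map φ a) = O.cls a := by
  rw [← shiftColim_cl (c := 0), ← shiftColim_cl (c := 0), ← (O.shiftColim 0).cl_map φ a, shift_map]

theorem Hom.coinv_stdCls {O O' : SMod.{u} k T} (f : Hom O O') (i : T.Index) (a : O.obj (T.std i)) :
    f.coinv χ (O.stdCls χ i a) = O'.stdCls χ i (f.app _ a) := by
  change DirectSum.lmap _ (DirectSum.lof k T.Index _ i _) = _
  rw [DirectSum.lmap_lof]
  rfl

theorem Hom.coinv_cls {O O' : SMod.{u} k T} (f : Hom O O') {X : T.Vertex} (a : O.obj X) :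
    f.coinv _ (O.cls a) = O'.cls (f.app _ a) := by
  change f.coinv _ (O.stdCls _ _ _) = O'.stdCls _ _ _
  rw [f.coinv_stdCls, f.natural]

end SMod

/-! ### Odd Lie brackets are Lie brackets of a shift -/

/-- An element of degree `i` has Lie degree `i - 1`, which has the parity of `i + 1`, so the signs
agree; the brackets of Lie degree `0` acquire degree `-1`. -/
theorem IsLieBracket.odd {k : Type v} [Field k] {V : Type u} [AddCommGroup V] [Module k V]
    {gr : ℤ → Submodule k V} {br : V →ₗ[k] V →ₗ[k] V}
    (h : IsLieBracket (fun d => gr (d + 1)) br) : IsOddLieBracket gr br where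
  internal := by
    have := h.internal
    rw [DirectSum.isInternal_submodule_iff_iSupIndep_and_iSup_eq_top] at this ⊢
    have e : gr = (fun d => gr (d + 1)) ∘ (Equiv.subRight (1 : ℤ)) := by
      funext d; simp
    rw [e]
    exact ⟨this.1.comp (Equiv.injective _), by
      rw [← this.2]; exact (Equiv.subRight (1 : ℤ)).iSup_comp (g := fun d => gr (d + 1))⟩
  degree i j a b ha hb := by
    have := h.degree (i - 1) (j - 1) a b (by simpa using ha) (by simpa using hb)
    convert this using 2
    ring
  antisymm i j a b ha hb := by
    rw [h.antisymm (i - 1) (j - 1) a b (by simpa using ha) (by simpa using hb),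
      negOnePow_congr (m := (i - 1) * (j - 1)) (n := (i + 1) * (j + 1)) ⟨-i - j, by ring⟩]
  jacobi i j l a b c ha hb hc := by
    have := h.jacobi (i - 1) (j - 1) (l - 1) a b c (by simpa using ha) (by simpa using hb)
      (by simpa using hc)
    rwa [negOnePow_congr (m := (l - 1) * (i - 1 + (j - 1))) (n := (l + 1) * (i + 1 + (j + 1)))
        ⟨-2 * l - i - j, by ring⟩,
      negOnePow_congr (m := (i - 1) * (j - 1 + (l - 1))) (n := (i + 1) * (j + 1 + (l + 1)))
        ⟨-2 * i - l - j, by ring⟩] at this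

theorem isOddLieBracket_coinvGr {k : Type v} [Field k] {T : OpType} {O : SMod.{u} k T} {c : ℤ}
    {br : O.Coinv →ₗ[k] O.Coinv →ₗ[k] O.Coinv} (h : IsLieBracket (O.coinvGr (c - 1)) br) :
    IsOddLieBracket (O.coinvGr c) br := by
  apply IsLieBracket.odd
  convert h using 2 with d
  simp only [SMod.coinvGr, SMod.coinvByGr]
  congr! 5
  ring

/-! ### Trees -/

theorem OpType.Occurs.genus_eq_zero {T : OpType} (hT : T ≠ .modular) {g n m : ℕ}
    (h : T.Occurs g n m) : g = 0 := by
  cases T <;> first | exact absurd rfl hT | exact h.1 | exact h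

namespace Graph

theorem EdgeOrder.numEdges_eq {Γ : Graph} (ω : Γ.EdgeOrder) : Γ.numEdges = ω.list.length := by
  classical
  have e : {e : Sym2 Γ.Flag // Γ.IsEdge e} ≃ {e // e ∈ ω.list.toFinset} :=
    Equiv.subtypeEquivRight fun e => by rw [List.mem_toFinset, ω.mem_iff]
  rw [numEdges, Nat.card_congr e, Nat.card_eq_fintype_card, Fintype.card_coe,
    List.toFinset_card_of_nodup ω.nodup]

/-- A tree has no loops to contribute, and outside the modular case all genera vanish. The formula
is thus uniform in the type. -/
theorem totalGenus_of_tree {T : OpType} {Γ : Graph}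
    (hv : ∀ w, T.Occurs (Γ.corolla w).genus (Γ.corolla w).numIn (Γ.corolla w).numOut)
    (ht : Fintype.card Γ.Vert = Γ.numEdges + 1) : Γ.totalGenus T = ∑ w, Γ.genus w := by
  by_cases hT : T = .modular
  · subst hT; simp [totalGenus, ht]
  · have h1 : ∀ w, Γ.genus w = 0 := fun w => (hv w).genus_eq_zero hT
    have h2 : Γ.totalGenus T = 0 := by cases T <;> first | exact absurd rfl hT | rfl
    simp [h1, h2]

/-- Trees are allowed for every type once the edges are coherently directed. The condition on the
corolla of tails is inherited from a corolla `W` already known to have type `T`. -/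
theorem admissible_of_tree {T : OpType} {Γ : Graph}
    (hv : ∀ w, T.Occurs (Γ.corolla w).genus (Γ.corolla w).numIn (Γ.corolla w).numOut)
    (hc : Γ.Connected) (ht : Fintype.card Γ.Vert = Γ.numEdges + 1)
    (hd : T.Directed → Γ.EdgesDirected ∧ Γ.NoWheels) {W : T.Vertex}
    (ρ : Corolla.Iso W.1 (Γ.residue T)) : T.Admissible Γ where
  nonempty := Fintype.card_pos_iff.1 (by omega)
  vertex := hv
  total := ρ.occurs W.2
  shape := by
    cases T
    · exact ⟨⟨hc, ht⟩, (hd trivial).1⟩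
    · exact ⟨hc, ht⟩
    · exact hd trivial
    · exact ⟨hc, hd trivial⟩
    · exact (hd trivial).1
    · exact ⟨hc, (hd trivial).1⟩
    · exact hc

/-- A function that increases strictly along oriented edges rules out oriented cycles. -/
theorem noWheels_of_rank {Γ : Graph} (r : Γ.Vert → ℕ)
    (h : ∀ f, Γ.inv f ≠ f → Γ.out f = true → r (Γ.vert f) < r (Γ.vert (Γ.inv f))) :
    Γ.NoWheels := by
  intro w hw
  have key : ∀ {x y}, Relation.TransGen (fun x y => ∃ f, Γ.inv f ≠ f ∧ Γ.out f = true ∧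
      Γ.vert f = x ∧ Γ.vert (Γ.inv f) = y) x y → r x < r y := by
    intro x y hxy
    induction hxy with
    | single h' => obtain ⟨f, h1, h2, rfl, rfl⟩ := h'; exact h f h1 h2
    | tail _ h' ih => obtain ⟨f, h1, h2, rfl, rfl⟩ := h'; exact ih.trans (h f h1 h2)
  exact lt_irrefl _ (key hw)

theorem EdgesDirected.joinable {T : OpType} {Γ : Graph} (h : T.Admissible Γ) {f : Γ.Flag}
    (hf : Γ.inv f ≠ f) : T.Joinable (Γ.out f) (Γ.out (Γ.inv f)) := by
  have key : Γ.EdgesDirected → T.Joinable (Γ.out f) (Γ.out (Γ.inv f)) := fun hd _ => by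
    rw [hd f hf]; simp
  have hs := h.shape
  cases T
  · exact key hs.2
  · exact False.elim
  · exact key hs.1
  · exact key hs.2.1
  · exact key hs
  · exact key hs.2
  · exact False.elim

/-! ### Graphs with two vertices and one edge -/

/-- The only edge of the graph joins the flag `f₀` of `w₀` to the flag `f₁` of `w₁`, and there are
no vertices besides `w₀` and `w₁`. -/
structure IsTwo (Γ : Graph) (w₀ w₁ : Γ.Vert) (f₀ f₁ : Γ.Flag) : Prop where
  ne : w₀ ≠ w₁
  cover : ∀ w, w = w₀ ∨ w = w₁
  vert₀ : Γ.vert f₀ = w₀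
  vert₁ : Γ.vert f₁ = w₁
  inv₀ : Γ.inv f₀ = f₁
  inv_eq : ∀ f, f ≠ f₀ → f ≠ f₁ → Γ.inv f = f

namespace IsTwo

variable {Γ : Graph} {w₀ w₁ : Γ.Vert} {f₀ f₁ : Γ.Flag}

theorem inv₁ (h : Γ.IsTwo w₀ w₁ f₀ f₁) : Γ.inv f₁ = f₀ := by rw [← h.inv₀, Γ.inv_inv]

theorem flag_ne (h : Γ.IsTwo w₀ w₁ f₀ f₁) : f₁ ≠ f₀ := by
  rintro rfl; exact h.ne (h.vert₀.symm.trans h.vert₁)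

theorem inv_eq_iff (h : Γ.IsTwo w₀ w₁ f₀ f₁) (f : Γ.Flag) :
    Γ.inv f = f ↔ f ≠ f₀ ∧ f ≠ f₁ := by
  refine ⟨fun hf => ⟨?_, ?_⟩, fun hf => h.inv_eq f hf.1 hf.2⟩
  · rintro rfl; exact h.flag_ne (h.inv₀.symm.trans hf)
  · rintro rfl; exact h.flag_ne (hf.symm.trans h.inv₁)

theorem isEdge_iff (h : Γ.IsTwo w₀ w₁ f₀ f₁) (e : Sym2 Γ.Flag) : Γ.IsEdge e ↔ e = s(f₀, f₁) := by
  constructor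
  · rintro ⟨f, hf, rfl⟩
    rw [Ne, h.inv_eq_iff] at hf
    by_cases h0 : f = f₀
    · subst h0; rw [h.inv₀]
    · have h1 : f = f₁ := by by_contra h1; exact hf ⟨h0, h1⟩
      subst h1; rw [h.inv₁, Sym2.eq_swap]
  · rintro rfl
    exact ⟨f₀, by rw [h.inv₀]; exact h.flag_ne, by rw [h.inv₀]⟩

def order (h : Γ.IsTwo w₀ w₁ f₀ f₁) : Γ.EdgeOrder where
  list := [s(f₀, f₁)]
  nodup := List.nodup_singleton _
  mem_iff e := by rw [List.mem_singleton, h.isEdge_iff]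

theorem list_eq (h : Γ.IsTwo w₀ w₁ f₀ f₁) (ω : Γ.EdgeOrder) : ω.list = [s(f₀, f₁)] := by
  have hp : ω.list.Perm [s(f₀, f₁)] := (List.perm_ext_iff_of_nodup ω.nodup
    (List.nodup_singleton _)).2 fun e => by rw [ω.mem_iff, List.mem_singleton, h.isEdge_iff]
  exact List.perm_singleton.1 hp

theorem univ_eq (h : Γ.IsTwo w₀ w₁ f₀ f₁) : (Finset.univ : Finset Γ.Vert) = {w₀, w₁} := by
  ext w; simpa using h.cover w

theorem card_eq (h : Γ.IsTwo w₀ w₁ f₀ f₁) : Fintype.card Γ.Vert = Γ.numEdges + 1 := by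
  rw [h.order.numEdges_eq, ← Finset.card_univ, h.univ_eq, Finset.card_pair h.ne]
  rfl

theorem totalGenus_eq (h : Γ.IsTwo w₀ w₁ f₀ f₁) {T : OpType}
    (hv : ∀ w, T.Occurs (Γ.corolla w).genus (Γ.corolla w).numIn (Γ.corolla w).numOut) :
    Γ.totalGenus T = Γ.genus w₀ + Γ.genus w₁ := by
  rw [totalGenus_of_tree hv h.card_eq, h.univ_eq, Finset.sum_pair h.ne]

theorem connected (h : Γ.IsTwo w₀ w₁ f₀ f₁) : Γ.Connected := by
  have h1 : Relation.ReflTransGen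
    (fun x y => ∃ f, Γ.vert f = x ∧ Γ.vert (Γ.inv f) = y) w₀ w₁ :=
    .single ⟨f₀, h.vert₀, by rw [h.inv₀, h.vert₁]⟩
  have h2 : Relation.ReflTransGen
    (fun x y => ∃ f, Γ.vert f = x ∧ Γ.vert (Γ.inv f) = y) w₁ w₀ :=
    .single ⟨f₁, h.vert₁, by rw [h.inv₁, h.vert₀]⟩
  intro w w'
  rcases h.cover w with rfl | rfl <;> rcases h.cover w' with rfl | rfl
  · exact .refl
  · exact h1
  · exact h2
  · exact .refl

theorem noWheels (h : Γ.IsTwo w₀ w₁ f₀ f₁) (hd : Γ.out f₀ ≠ Γ.out f₁) : Γ.NoWheels := by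
  classical
  -- Rank `0` goes to the vertex from which the edge departs: `w₀` if `f₀` is an output, otherwise
  -- `w₁`.
  refine noWheels_of_rank (fun w => if (w = w₀) = (Γ.out f₀ = true) then 0 else 1) fun f hf ho => ?_
  have hne := h.ne.symm
  rw [Ne, h.inv_eq_iff] at hf
  by_cases h0 : f = f₀
  · subst h0
    simp [h.inv₀, h.vert₀, h.vert₁, ho, hne]
  · have h1 : f = f₁ := by by_contra h1; exact hf ⟨h0, h1⟩
    subst h1
    have : Γ.out f₀ = false := by rw [ho] at hd; simpa using hd
    simp [h.inv₁, h.vert₀, h.vert₁, this, hne]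

theorem edgesDirected (h : Γ.IsTwo w₀ w₁ f₀ f₁) (hd : Γ.out f₀ ≠ Γ.out f₁) :
    Γ.EdgesDirected := by
  intro f hf
  rw [Ne, h.inv_eq_iff] at hf
  by_cases h0 : f = f₀
  · subst h0; rw [h.inv₀]; revert hd; cases Γ.out f <;> cases Γ.out f₁ <;> simp
  · have h1 : f = f₁ := by by_contra h1; exact hf ⟨h0, h1⟩
    subst h1; rw [h.inv₁]; revert hd; cases Γ.out f <;> cases Γ.out f₀ <;> simp

/-- The residue of a graph with two vertices and one edge is the join of its vertices. -/
def residueIso (h : Γ.IsTwo w₀ w₁ f₀ f₁) {T : OpType}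
    (hv : ∀ w, T.Occurs (Γ.corolla w).genus (Γ.corolla w).numIn (Γ.corolla w).numOut)
    {X Y W : T.Vertex} {s : X.1.Flag} {t : Y.1.Flag} (D : Join X Y W s t)
    (ψ₁ : Corolla.Iso X.1 (Γ.corolla w₀)) (ψ₂ : Corolla.Iso Y.1 (Γ.corolla w₁))
    (hs : (ψ₁.flag s).1 = f₀) (ht : (ψ₂.flag t).1 = f₁) : Corolla.Iso W.1 (Γ.residue T) :=
  Corolla.Iso.over
    (fun f => Sum.elim (fun x => (ψ₁.flag x).1) (fun y => (ψ₂.flag y).1) (D.val f))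
    Subtype.val
    (by
      refine Function.Injective.comp ?_ D.injective
      rintro (x | x) (y | y) hxy
      · exact congrArg Sum.inl (ψ₁.flag.injective (Subtype.ext hxy))
      · exact absurd ((ψ₁.flag x).2.symm.trans ((congrArg Γ.vert hxy).trans (ψ₂.flag y).2)) h.ne
      · exact absurd ((ψ₁.flag y).2.symm.trans ((congrArg Γ.vert hxy.symm).trans
          (ψ₂.flag x).2)) h.ne
      · exact congrArg Sum.inr (ψ₂.flag.injective (Subtype.ext hxy)))
    Subtype.val_injective
    (fun f => by
      have hr : f ∈ Set.range (Subtype.val : (Γ.residue T).Flag → Γ.Flag) ↔ Γ.inv f = f :=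
        ⟨by rintro ⟨x, rfl⟩; exact x.2, fun hf => ⟨⟨f, hf⟩, rfl⟩⟩
      refine Iff.trans ?_ ((h.inv_eq_iff f).symm.trans hr.symm)
      constructor
      · rintro ⟨x, rfl⟩
        have hx := (D.mem_range (D.val x)).1 ⟨x, rfl⟩
        change Sum.elim (fun x => (ψ₁.flag x).1) (fun y => (ψ₂.flag y).1) (D.val x) ≠ f₀ ∧
          Sum.elim (fun x => (ψ₁.flag x).1) (fun y => (ψ₂.flag y).1) (D.val x) ≠ f₁
        generalize D.val x = z at hx ⊢
        rcases z with y | y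
        · refine ⟨?_, ?_⟩
          · rw [← hs]
            exact fun e => hx.1 (congrArg Sum.inl (ψ₁.flag.injective (Subtype.ext e)))
          · intro e
            exact h.ne ((ψ₁.flag y).2.symm.trans ((congrArg Γ.vert e).trans h.vert₁))
        · refine ⟨?_, ?_⟩
          · intro e
            exact h.ne (h.vert₀.symm.trans ((congrArg Γ.vert e.symm).trans (ψ₂.flag y).2))
          · rw [← ht]
            exact fun e => hx.2 (congrArg Sum.inr (ψ₂.flag.injective (Subtype.ext e)))
      · rintro ⟨h0, h1⟩
        rcases h.cover (Γ.vert f) with hf | hf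
        · obtain ⟨x, hx⟩ := ψ₁.flag.surjective ⟨f, hf⟩
          have hx' : (ψ₁.flag x).1 = f := congrArg Subtype.val hx
          obtain ⟨y, hy⟩ := (D.mem_range (Sum.inl x)).2
            ⟨fun e => h0 (by rw [← hx', ← hs, Sum.inl_injective e]), by simp⟩
          exact ⟨y, (congrArg (Sum.elim (fun x => (ψ₁.flag x).1) fun y => (ψ₂.flag y).1) hy).trans hx'⟩
        · obtain ⟨x, hx⟩ := ψ₂.flag.surjective ⟨f, hf⟩
          have hx' : (ψ₂.flag x).1 = f := congrArg Subtype.val hx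
          obtain ⟨y, hy⟩ := (D.mem_range (Sum.inr x)).2
            ⟨by simp, fun e => h1 (by rw [← hx', ← ht, Sum.inr_injective e])⟩
          exact ⟨y, (congrArg (Sum.elim (fun x => (ψ₁.flag x).1) fun y => (ψ₂.flag y).1) hy).trans hx'⟩)
    (fun x y hxy => by
      rw [← D.out_val]
      change _ = Γ.out y.1
      rw [← hxy]
      rcases D.val x with z | z
      · exact (ψ₁.out_eq z).symm
      · exact (ψ₂.out_eq z).symm)
    (by
      change _ = Γ.totalGenus T
      rw [D.genus_eq, h.totalGenus_eq hv, ← ψ₁.genus_eq, ← ψ₂.genus_eq]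
      rfl)

theorem residueIso_spec (h : Γ.IsTwo w₀ w₁ f₀ f₁) {T : OpType}
    (hv : ∀ w, T.Occurs (Γ.corolla w).genus (Γ.corolla w).numIn (Γ.corolla w).numOut)
    {X Y W : T.Vertex} {s : X.1.Flag} {t : Y.1.Flag} (D : Join X Y W s t)
    (ψ₁ : Corolla.Iso X.1 (Γ.corolla w₀)) (ψ₂ : Corolla.Iso Y.1 (Γ.corolla w₁))
    (hs : (ψ₁.flag s).1 = f₀) (ht : (ψ₂.flag t).1 = f₁) (f : W.1.Flag) :
    ((h.residueIso hv D ψ₁ ψ₂ hs ht).flag f).1 =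
      Sum.elim (fun x => (ψ₁.flag x).1) (fun y => (ψ₂.flag y).1) (D.val f) := by
  unfold residueIso
  exact Corolla.Iso.over_spec (Y := Γ.residue T) _ Subtype.val _ _ _ _ _ f

theorem admissible (h : Γ.IsTwo w₀ w₁ f₀ f₁) {T : OpType}
    (hv : ∀ w, T.Occurs (Γ.corolla w).genus (Γ.corolla w).numIn (Γ.corolla w).numOut)
    (hd : T.Joinable (Γ.out f₀) (Γ.out f₁)) : T.Admissible Γ :=
  admissible_of_tree hv h.connected h.card_eq
    (fun hT => ⟨h.edgesDirected (hd hT), h.noWheels (hd hT)⟩)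
    (h.residueIso hv (Join.std ⟨Γ.corolla w₀, hv w₀⟩ ⟨Γ.corolla w₁, hv w₁⟩ ⟨f₀, h.vert₀⟩
      ⟨f₁, h.vert₁⟩ hd) (Corolla.Iso.refl _) (Corolla.Iso.refl _) rfl rfl)

theorem joinable (h : Γ.IsTwo w₀ w₁ f₀ f₁) {T : OpType} (ha : T.Admissible Γ) :
    T.Joinable (Γ.out f₀) (Γ.out f₁) := by
  rw [← h.inv₀]
  exact EdgesDirected.joinable ha (by rw [h.inv₀]; exact h.flag_ne)

end IsTwo

theorem isTwo_glue (X Y : Corolla) (s : X.Flag) (t : Y.Flag) :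
    (glue X Y s t).IsTwo false true (Sum.inl s) (Sum.inr t) where
  ne := Bool.false_ne_true
  cover w := by cases w; exacts [Or.inl rfl, Or.inr rfl]
  vert₀ := rfl
  vert₁ := rfl
  inv₀ := by
    let _ : DecidableEq (X.Flag ⊕ Y.Flag) := Classical.decEq _
    exact Equiv.swap_apply_left (α := X.Flag ⊕ Y.Flag) _ _
  inv_eq f h0 h1 := by
    let _ : DecidableEq (X.Flag ⊕ Y.Flag) := Classical.decEq _
    exact Equiv.swap_apply_of_ne_of_ne (α := X.Flag ⊕ Y.Flag) h0 h1

theorem glue_vertex {T : OpType} (X Y : T.Vertex) (s : X.1.Flag) (t : Y.1.Flag) (w : Bool) :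
    T.Occurs ((glue X.1 Y.1 s t).corolla w).genus ((glue X.1 Y.1 s t).corolla w).numIn
      ((glue X.1 Y.1 s t).corolla w).numOut := by
  cases w
  · exact (glueLeft X.1 Y.1 s t).occurs X.2
  · exact (glueRight X.1 Y.1 s t).occurs Y.2

/-- Translates the condition under which a term enters the bracket into one on the directions of the
two flags alone. -/
theorem glue_admissible_iff {T : OpType} (X Y : T.Vertex) (s : X.1.Flag) (t : Y.1.Flag) :
    T.Admissible (glue X.1 Y.1 s t) ↔ T.Joinable (X.1.out s) (Y.1.out t) :=
  ⟨fun h => (isTwo_glue X.1 Y.1 s t).joinable h,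
    fun h => (isTwo_glue X.1 Y.1 s t).admissible (glue_vertex X Y s t) h⟩

end Graph

namespace Join

variable {T : OpType} {X Y W : T.Vertex} {s : X.1.Flag} {t : Y.1.Flag}

theorem admissible (D : Join X Y W s t) : T.Admissible (Graph.glue X.1 Y.1 s t) :=
  (Graph.glue_admissible_iff X Y s t).2 D.joinable

/-- The result of joining two corollas is the residue of the graph with a single edge. -/
def glueIso (D : Join X Y W s t) : Corolla.Iso ((Graph.glue X.1 Y.1 s t).residue T) W.1 :=
  ((Graph.isTwo_glue X.1 Y.1 s t).residueIso (Graph.glue_vertex X Y s t) D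
    (Graph.glueLeft X.1 Y.1 s t) (Graph.glueRight X.1 Y.1 s t) rfl rfl).symm

theorem glueIso_spec (D : Join X Y W s t) (f) : D.val (D.glueIso.flag f) = f.1 := by
  obtain ⟨g, rfl⟩ := D.glueIso.symm.flag.surjective f
  have h := (Graph.isTwo_glue X.1 Y.1 s t).residueIso_spec (Graph.glue_vertex X Y s t) D
    (Graph.glueLeft X.1 Y.1 s t) (Graph.glueRight X.1 Y.1 s t) rfl rfl g
  rw [Corolla.Iso.symm_flag, Equiv.apply_symm_apply]
  refine Eq.trans ?_ h.symm
  rcases D.val g with x | x <;> rfl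

end Join

/-! ### Compositions along a single edge -/

/-- Only the pair `(false, true)` can be inverted. -/
theorem koszulSign_bool {V : Type} [LinearOrder V] (σ : Bool ≃ V) (d : Bool → ℤ) :
    koszulSign σ d = if σ true < σ false then (d false * d true).negOnePow else 1 := by
  have h : ¬ (true < false) := by decide
  rw [koszulSign, Fintype.prod_prod_type]
  simp [h]

/-- The bijection from `Bool` onto the vertices of a graph with two vertices. -/
def Graph.IsTwo.vertE {Γ : Graph} {w₀ w₁ : Γ.Vert} {f₀ f₁ : Γ.Flag} (h : Γ.IsTwo w₀ w₁ f₀ f₁) :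
    Bool ≃ Γ.Vert :=
  Equiv.ofBijective (fun b => Bool.rec w₀ w₁ b) ⟨by
    rintro (_ | _) (_ | _) hb
    · rfl
    · exact absurd hb h.ne
    · exact absurd hb.symm h.ne
    · rfl, fun w => by
    rcases h.cover w with rfl | rfl
    exacts [⟨false, rfl⟩, ⟨true, rfl⟩]⟩

/-- A graph with two vertices and one edge is isomorphic to a standard one. -/
def Graph.IsTwo.glueIso {Γ : Graph} {w₀ w₁ : Γ.Vert} {f₀ f₁ : Γ.Flag} (h : Γ.IsTwo w₀ w₁ f₀ f₁)
    {X Y : Corolla} {s : X.Flag} {t : Y.Flag}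
    (ψ₁ : Corolla.Iso X (Γ.corolla w₀)) (ψ₂ : Corolla.Iso Y (Γ.corolla w₁))
    (hs : (ψ₁.flag s).1 = f₀) (ht : (ψ₂.flag t).1 = f₁) : (Graph.glue X Y s t).Iso Γ where
  vertE := h.vertE
  flagE := Equiv.ofBijective (Sum.elim (fun x => (ψ₁.flag x).1) (fun y => (ψ₂.flag y).1)) ⟨by
      rintro (x | x) (y | y) hxy
      · exact congrArg Sum.inl (ψ₁.flag.injective (Subtype.ext hxy))
      · exact absurd ((ψ₁.flag x).2.symm.trans ((congrArg Γ.vert hxy).trans (ψ₂.flag y).2)) h.ne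
      · exact absurd ((ψ₁.flag y).2.symm.trans ((congrArg Γ.vert hxy.symm).trans
          (ψ₂.flag x).2)) h.ne
      · exact congrArg Sum.inr (ψ₂.flag.injective (Subtype.ext hxy)), fun f => by
      rcases h.cover (Γ.vert f) with hf | hf
      · obtain ⟨x, hx⟩ := ψ₁.flag.surjective ⟨f, hf⟩
        exact ⟨Sum.inl x, congrArg Subtype.val hx⟩
      · obtain ⟨x, hx⟩ := ψ₂.flag.surjective ⟨f, hf⟩
        exact ⟨Sum.inr x, congrArg Subtype.val hx⟩⟩
  vert_flag f := by
    rcases f with f | f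
    · exact (ψ₁.flag f).2
    · exact (ψ₂.flag f).2
  inv_flag f := by
    by_cases h0 : f = Sum.inl s
    · subst h0
      rw [(Graph.isTwo_glue X Y s t).inv₀]
      exact (congrArg Γ.inv hs).trans (h.inv₀.trans ht.symm)
    by_cases h1 : f = Sum.inr t
    · subst h1
      rw [(Graph.isTwo_glue X Y s t).inv₁]
      exact (congrArg Γ.inv ht).trans (h.inv₁.trans hs.symm)
    rw [(Graph.isTwo_glue X Y s t).inv_eq f h0 h1]
    refine h.inv_eq _ ?_ ?_
    · rcases f with f | f
      · exact fun e => h0 (congrArg Sum.inl (ψ₁.flag.injective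
          (Subtype.ext (e.trans hs.symm))))
      · exact fun e => h.ne (h.vert₀.symm.trans ((congrArg Γ.vert e.symm).trans (ψ₂.flag f).2))
    · rcases f with f | f
      · exact fun e => h.ne ((ψ₁.flag f).2.symm.trans ((congrArg Γ.vert e).trans h.vert₁))
      · exact fun e => h1 (congrArg Sum.inr (ψ₂.flag.injective
          (Subtype.ext (e.trans ht.symm))))
  out_flag f := by
    rcases f with f | f
    · exact ψ₁.out_eq f
    · exact ψ₂.out_eq f
  genus_vert w := by
    cases w
    · exact ψ₁.genus_eq
    · exact ψ₂.genus_eq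

namespace Gluing

variable {k : Type v} [Field k] {T : OpType} {p : ℕ} {O O' : SMod.{u} k T} (G : Gluing p O)

/-- The decoration of the two vertices of `Graph.glue`. -/
def decor {X Y : T.Vertex} {s : X.1.Flag} {t : Y.1.Flag}
    (h : T.Admissible (Graph.glue X.1 Y.1 s t)) (a : O.obj X) (b : O.obj Y)
    (w : (Graph.glue X.1 Y.1 s t).Vert) : O.obj ((Graph.glue X.1 Y.1 s t).at' h w) :=
  Bool.rec (motive := fun w => O.obj ((Graph.glue X.1 Y.1 s t).at' h w))
    (O.map (Y := (Graph.glue X.1 Y.1 s t).at' h false) (Graph.glueLeft X.1 Y.1 s t) a)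
    (O.map (Y := (Graph.glue X.1 Y.1 s t).at' h true) (Graph.glueRight X.1 Y.1 s t) b) w

open Classical in
-- Exhibits the decoration as an update of one that does not involve `a`, so that multilinearity of
-- `comp` gives linearity in `a`.
theorem decor_left {X Y : T.Vertex} {s : X.1.Flag} {t : Y.1.Flag}
    (h : T.Admissible (Graph.glue X.1 Y.1 s t)) (a : O.obj X) (b : O.obj Y) :
    decor h a b = Function.update (decor h 0 b) (false : Bool)
      (O.map (Y := (Graph.glue X.1 Y.1 s t).at' h false) (Graph.glueLeft X.1 Y.1 s t) a) := by
  funext w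
  cases w
  · exact (Function.update_self (α := (Graph.glue X.1 Y.1 s t).Vert)
      (β := fun w => O.obj ((Graph.glue X.1 Y.1 s t).at' h w)) _ _ _).symm
  · exact (Function.update_of_ne (α := (Graph.glue X.1 Y.1 s t).Vert)
      (β := fun w => O.obj ((Graph.glue X.1 Y.1 s t).at' h w)) (by exact Bool.false_ne_true.symm) _ _).symm

open Classical in
theorem decor_right {X Y : T.Vertex} {s : X.1.Flag} {t : Y.1.Flag}
    (h : T.Admissible (Graph.glue X.1 Y.1 s t)) (a : O.obj X) (b : O.obj Y) :
    decor h a b = Function.update (decor h a 0) (true : Bool)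
      (O.map (Y := (Graph.glue X.1 Y.1 s t).at' h true) (Graph.glueRight X.1 Y.1 s t) b) := by
  funext w
  cases w
  · exact (Function.update_of_ne (α := (Graph.glue X.1 Y.1 s t).Vert)
      (β := fun w => O.obj ((Graph.glue X.1 Y.1 s t).at' h w)) (by exact Bool.false_ne_true) _ _).symm
  · exact (Function.update_self (α := (Graph.glue X.1 Y.1 s t).Vert)
      (β := fun w => O.obj ((Graph.glue X.1 Y.1 s t).at' h w)) _ _ _).symm

theorem glue₂_eq {X Y : T.Vertex} (s : X.1.Flag) (t : Y.1.Flag)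
    (h : T.Admissible (Graph.glue X.1 Y.1 s t)) (a : O.obj X) (b : O.obj Y) :
    G.glue₂ s t h a b = G.comp _ h (Graph.glueOrder X.1 Y.1 s t) (decor h a b) := by
  unfold glue₂
  congr 1
  funext w
  cases w <;> rfl

/-- The composition along a single edge, with values in any corolla obtained by joining. -/
def gl {X Y W : T.Vertex} {s : X.1.Flag} {t : Y.1.Flag} (D : Join X Y W s t) :
    O.obj X →ₗ[k] O.obj Y →ₗ[k] O.obj W :=
  LinearMap.mk₂ k (fun a b => O.map (X := (Graph.glue X.1 Y.1 s t).total D.admissible) D.glueIso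
      (G.glue₂ s t D.admissible a b))
    (fun a a' b => by
      rw [glue₂_eq, glue₂_eq, glue₂_eq, ← map_add, decor_left, decor_left _ a, decor_left _ a',
        map_add]
      exact congrArg _ ((G.comp _ D.admissible _).map_update_add _ _ _ _))
    (fun c a b => by
      rw [glue₂_eq, glue₂_eq, ← map_smul, decor_left, decor_left _ a, map_smul]
      exact congrArg _ ((G.comp _ D.admissible _).map_update_smul _ _ _ _))
    (fun a b b' => by
      rw [glue₂_eq, glue₂_eq, glue₂_eq, ← map_add, decor_right, decor_right _ a b,
        decor_right _ a b', map_add]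
      exact congrArg _ ((G.comp _ D.admissible _).map_update_add _ _ _ _))
    (fun c a b => by
      rw [glue₂_eq, glue₂_eq, ← map_smul, decor_right, decor_right _ a b, map_smul]
      exact congrArg _ ((G.comp _ D.admissible _).map_update_smul _ _ _ _))

theorem gl_apply {X Y W : T.Vertex} {s : X.1.Flag} {t : Y.1.Flag} (D : Join X Y W s t)
    (a : O.obj X) (b : O.obj Y) :
    G.gl D a b = O.map (X := (Graph.glue X.1 Y.1 s t).total D.admissible) D.glueIso
      (G.glue₂ s t D.admissible a b) := rfl

theorem decor_gr {X Y : T.Vertex} {s : X.1.Flag} {t : Y.1.Flag}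
    (h : T.Admissible (Graph.glue X.1 Y.1 s t)) {i j : ℤ} {a : O.obj X} {b : O.obj Y}
    (ha : a ∈ O.gr X i) (hb : b ∈ O.gr Y j) (w : (Graph.glue X.1 Y.1 s t).Vert) :
    decor h a b w ∈ O.gr ((Graph.glue X.1 Y.1 s t).at' h w) (cond w j i) := by
  cases w
  · exact O.map_gr _ _ _ ha
  · exact O.map_gr _ _ _ hb

theorem gl_gr {X Y W : T.Vertex} {s : X.1.Flag} {t : Y.1.Flag} (D : Join X Y W s t) {i j : ℤ}
    {a : O.obj X} {b : O.obj Y} (ha : a ∈ O.gr X i) (hb : b ∈ O.gr Y j) :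
    G.gl D a b ∈ O.gr W (i + j - p) := by
  rw [gl_apply, glue₂_eq]
  refine O.map_gr _ _ _ ?_
  have h := G.comp_gr _ D.admissible (Graph.glueOrder X.1 Y.1 s t) (fun w => cond w j i)
    (decor D.admissible a b) (decor_gr D.admissible ha hb)
  have h1 : ∑ w : (Graph.glue X.1 Y.1 s t).Vert, cond w j i = i + j :=
    (Fintype.sum_bool fun w => cond w j i).trans (add_comm _ _)
  rw [h1] at h
  simpa [Graph.glueOrder] using h

/-- Composition along any graph with two vertices and one edge. -/
theorem comp_two {Γ : Graph} {w₀ w₁ : Γ.Vert} {f₀ f₁ : Γ.Flag} (h2 : Γ.IsTwo w₀ w₁ f₀ f₁)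
    (h : T.Admissible Γ) (ω : Γ.EdgeOrder) {X Y W : T.Vertex} {s : X.1.Flag} {t : Y.1.Flag}
    (D : Join X Y W s t) (ψ₁ : Corolla.Iso X.1 (Γ.corolla w₀))
    (ψ₂ : Corolla.Iso Y.1 (Γ.corolla w₁)) (hs : (ψ₁.flag s).1 = f₀) (ht : (ψ₂.flag t).1 = f₁)
    (φ : Corolla.Iso (Γ.residue T) W.1)
    (hφ : ∀ f, Sum.elim (fun x => (ψ₁.flag x).1) (fun y => (ψ₂.flag y).1) (D.val (φ.flag f)) = f.1)
    {i j : ℤ} {a : O.obj X} {b : O.obj Y} (ha : a ∈ O.gr X i) (hb : b ∈ O.gr Y j)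
    (A : ∀ w, O.obj (Γ.at' h w)) (hA₀ : A w₀ = O.map (Y := Γ.at' h w₀) ψ₁ a)
    (hA₁ : A w₁ = O.map (Y := Γ.at' h w₁) ψ₂ b) :
    O.map (X := Γ.total h) (Y := W) φ (G.comp Γ h ω A) =
      (if w₁ < w₀ then (i * j).negOnePow else 1) • G.gl D a b := by
  let Φ := h2.glueIso (s := s) (t := t) ψ₁ ψ₂ hs ht
  -- Equivariance needs the isomorphism of residues covering `Φ`; it is obtained by passing through
  -- `W`.
  let φ₀ : Corolla.Iso ((Graph.glue X.1 Y.1 s t).residue T) (Γ.residue T) := D.glueIso.trans φ.symm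
  have hφ₀ : ∀ f, (φ₀.flag f).1 = Φ.flagE f.1 := by
    intro f
    rw [← hφ, ← D.glueIso_spec f]
    change Sum.elim _ _ (D.val (φ.flag (φ.flag.symm (D.glueIso.flag f)))) = _
    rw [Equiv.apply_symm_apply]
    rfl
  have key := G.comp_iso (Graph.glue X.1 Y.1 s t) Γ D.admissible h Φ φ₀ hφ₀
    (Graph.glueOrder X.1 Y.1 s t) ω (by
      rw [h2.list_eq ω]
      change _ = [s((ψ₁.flag s).1, (ψ₂.flag t).1)]
      rw [hs, ht]) (fun w => cond w j i) (decor D.admissible a b) A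
    (decor_gr D.admissible ha hb) (by
      intro w
      cases w
      · exact hA₀.trans (O.map_map (X := X) (Y := (Graph.glue X.1 Y.1 s t).at' D.admissible false)
          (Z := Γ.at' h w₀) _ _ _ (fun _ => rfl) a).symm
      · exact hA₁.trans (O.map_map (X := Y) (Y := (Graph.glue X.1 Y.1 s t).at' D.admissible true)
          (Z := Γ.at' h w₁) _ _ _ (fun _ => rfl) b).symm)
  -- A sign appears only if the vertices of `Γ` are listed in the order opposite to that of `X` and
  -- `Y`.
  have hk : koszulSign Φ.vertE (fun w => cond w j i) =
      if w₁ < w₀ then (i * j).negOnePow else 1 := koszulSign_bool h2.vertE _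
  rw [key, map_units_zsmul, hk, gl_apply, glue₂_eq]
  congr 1
  exact O.map_map (X := (Graph.glue X.1 Y.1 s t).total D.admissible) (Y := Γ.total h) φ₀ φ
    D.glueIso (fun f => φ.flag.apply_symm_apply _) _

/-- The standard graph of `X'` and `Y'` is also a one-edge graph for `X` and `Y`, by way of `φ` and
`ψ`, so `comp_two` compares both sides. -/
theorem gl_equivariant {X Y W X' Y' W' : T.Vertex} {s : X.1.Flag} {t : Y.1.Flag}
    (φ : Corolla.Iso X.1 X'.1) (ψ : Corolla.Iso Y.1 Y'.1) (χ : Corolla.Iso W.1 W'.1)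
    (D : Join X Y W s t) (D' : Join X' Y' W' (φ.flag s) (ψ.flag t))
    (hχ : ∀ f, D'.val (χ.flag f) = Sum.map φ.flag ψ.flag (D.val f)) {i j : ℤ} {a : O.obj X}
    {b : O.obj Y} (ha : a ∈ O.gr X i) (hb : b ∈ O.gr Y j) :
    G.gl D' (O.map φ a) (O.map ψ b) = O.map χ (G.gl D a b) := by
  have key := G.comp_two (Graph.isTwo_glue X'.1 Y'.1 (φ.flag s) (ψ.flag t)) D'.admissible
    (Graph.glueOrder _ _ _ _) D (φ.trans (Graph.glueLeft X'.1 Y'.1 _ _))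
    (ψ.trans (Graph.glueRight X'.1 Y'.1 _ _)) rfl rfl (D'.glueIso.trans χ.symm) (fun f => by
      rw [← D'.glueIso_spec f]
      obtain ⟨g, hg⟩ := χ.flag.surjective (D'.glueIso.flag f)
      rw [← hg, hχ]
      change Sum.elim _ _ (D.val (χ.flag.symm (D'.glueIso.flag f))) = _
      rw [← hg, Equiv.symm_apply_apply]
      rcases D.val g with x | x <;> rfl) ha hb
    (decor D'.admissible (O.map φ a) (O.map ψ b)) (O.map_trans _ _ _).symm (O.map_trans _ _ _).symm
  replace key := key.trans ((congrArg (· • G.gl D a b) (if_neg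
    (show ¬ ((true : Bool) < false) by decide))).trans (one_smul _ _))
  rw [← key, gl_apply, glue₂_eq]
  exact (O.map_map (X := (Graph.glue X'.1 Y'.1 _ _).total D'.admissible) _ χ D'.glueIso
    (fun f => χ.flag.apply_symm_apply _) _).symm

/-- It is the same graph with the vertices listed in the other order. An edge is an unordered pair
of flags, so reversing it costs nothing and only the Koszul sign of the arguments remains, for every
`p`. -/
theorem gl_symm {X Y W : T.Vertex} {s : X.1.Flag} {t : Y.1.Flag} (D : Join X Y W s t) {i j : ℤ}
    {a : O.obj X} {b : O.obj Y} (ha : a ∈ O.gr X i) (hb : b ∈ O.gr Y j) :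
    G.gl D.symm b a = (i * j).negOnePow • G.gl D a b := by
  have h2 : (Graph.glue Y.1 X.1 t s).IsTwo true false (Sum.inr s) (Sum.inl t) := by
    have h := Graph.isTwo_glue Y.1 X.1 t s
    exact ⟨h.ne.symm, fun w => (h.cover w).symm, h.vert₁, h.vert₀, h.inv₁,
      fun f h0 h1 => h.inv_eq f h1 h0⟩
  have key := G.comp_two h2 D.symm.admissible (Graph.glueOrder _ _ _ _) D
    (Graph.glueRight Y.1 X.1 t s) (Graph.glueLeft Y.1 X.1 t s) rfl rfl D.symm.glueIso (fun f => by
      rw [← D.symm.glueIso_spec f, Join.symm_val]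
      rcases D.val _ with x | x <;> rfl) ha hb (decor D.symm.admissible b a) rfl rfl
  replace key := key.trans (congrArg (· • G.gl D a b) (if_pos
    (show (false : Bool) < true by decide)))
  rw [← key, gl_apply, glue₂_eq]

end Gluing

namespace Graph

/-! ### Graphs with one vertex -/

/-- A graph with a single vertex and no edges is a corolla. -/
def singleIso {T : OpType} {Γ : Graph} {w : Γ.Vert} (hw : ∀ w', w' = w) (hf : ∀ f, Γ.inv f = f)
    (hv : T.Occurs (Γ.corolla w).genus (Γ.corolla w).numIn (Γ.corolla w).numOut) :
    Corolla.Iso (Γ.corolla w) (Γ.residue T) where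
  flag :=
    { toFun := fun f => ⟨f.1, hf f.1⟩
      invFun := fun f => ⟨f.1, hw _⟩
      left_inv := fun _ => rfl
      right_inv := fun _ => rfl }
  out_eq _ := rfl
  genus_eq := by
    have e : Γ.numEdges = 0 := by
      rw [numEdges, Finite.card_eq_zero_iff]
      exact ⟨fun e => by obtain ⟨_, f, h, _⟩ := e; exact h (hf f)⟩
    have hu : (Finset.univ : Finset Γ.Vert) = {w} := by ext w'; simp [hw w']
    have hc : Fintype.card Γ.Vert = Γ.numEdges + 1 := by
      rw [e, ← Finset.card_univ, hu, Finset.card_singleton]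
    refine (totalGenus_of_tree (fun w' => by rw [hw w']; exact hv) hc).trans ?_
    rw [hu, Finset.sum_singleton]
    rfl

theorem admissible_single {T : OpType} {Γ : Graph} {w : Γ.Vert} (hw : ∀ w', w' = w)
    (hf : ∀ f, Γ.inv f = f)
    (hv : T.Occurs (Γ.corolla w).genus (Γ.corolla w).numIn (Γ.corolla w).numOut) :
    T.Admissible Γ := by
  have e : Γ.numEdges = 0 := by
    rw [numEdges, Finite.card_eq_zero_iff]
    exact ⟨fun e => by obtain ⟨_, f, h, _⟩ := e; exact h (hf f)⟩
  have hu : (Finset.univ : Finset Γ.Vert) = {w} := by ext w'; simp [hw w']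
  refine admissible_of_tree (W := ⟨Γ.corolla w, hv⟩) (fun w' => by rw [hw w']; exact hv) ?_ ?_ ?_
    (singleIso hw hf hv)
  · intro x y
    rw [hw x, hw y]
  · rw [e, ← Finset.card_univ, hu, Finset.card_singleton]
  · exact fun _ => ⟨fun f h => absurd (hf f) h, noWheels_of_rank (fun _ => 0)
      fun f h => absurd (hf f) h⟩

def emptyOrder {Γ : Graph} (hf : ∀ f, Γ.inv f = f) : Γ.EdgeOrder where
  list := []
  nodup := List.nodup_nil
  mem_iff e := by
    simp only [List.not_mem_nil, false_iff]
    rintro ⟨f, h, _⟩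
    exact h (hf f)

end Graph

/-! ### Nested compositions -/

namespace Gluing

variable {k : Type v} [Field k] {T : OpType} {p : ℕ} {O : SMod.{u} k T} (G : Gluing p O)
  {Γ : Graph} (h : T.Admissible Γ) (N : Γ.Nest) (h₀ : T.Admissible (N.outer T))
  (hi : ∀ x, T.Admissible (N.inner x)) (ωi : ∀ x, (N.inner x).EdgeOrder)

/-- The result of composing along the graph inserted into the vertex `x`. -/
def innerComp (A : ∀ w, O.obj (Γ.at' h w)) (x : N.Vert0) : O.obj ((N.outer T).at' h₀ x) :=
  O.map (X := (N.inner x).total (hi x)) (Y := (N.outer T).at' h₀ x) (N.insertIso T x)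
    (G.comp (N.inner x) (hi x) (ωi x) fun w =>
      O.map (X := Γ.at' h w.1) (Y := (N.inner x).at' (hi x) w) (N.vertexIso x w) (A w.1))

/-- Evaluates a vertex into which a one-edge graph is inserted. The isomorphism `ψ` remembers the
original flags, and the assumption `u₀ < u₁` excludes a Koszul sign. -/
theorem innerComp_two {x : N.Vert0} {u₀ u₁ : (N.inner x).Vert} {g₀ g₁ : (N.inner x).Flag}
    (h2 : (N.inner x).IsTwo u₀ u₁ g₀ g₁) (hlt : u₀ < u₁) {X Y U : T.Vertex} {s : X.1.Flag}
    {t : Y.1.Flag} (D : Join X Y U s t) (α : Corolla.Iso X.1 (Γ.corolla u₀.1))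
    (β : Corolla.Iso Y.1 (Γ.corolla u₁.1)) (hs : (α.flag s).1 = g₀.1) (ht : (β.flag t).1 = g₁.1)
    {i j : ℤ} {a : O.obj X} {b : O.obj Y} (ha : a ∈ O.gr X i) (hb : b ∈ O.gr Y j)
    (A : ∀ w, O.obj (Γ.at' h w)) (hA₀ : A u₀.1 = O.map (Y := Γ.at' h u₀.1) α a)
    (hA₁ : A u₁.1 = O.map (Y := Γ.at' h u₁.1) β b) :
    ∃ ψ : Corolla.Iso U.1 ((N.outer T).corolla x),
      (∀ f, (ψ.flag f).1.1 = Sum.elim (fun x => (α.flag x).1) (fun y => (β.flag y).1) (D.val f)) ∧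
      G.innerComp h N h₀ hi ωi A x = O.map (Y := (N.outer T).at' h₀ x) ψ (G.gl D a b) := by
  let α' := α.trans (N.vertexIso x u₀)
  let β' := β.trans (N.vertexIso x u₁)
  have hs' : (α'.flag s).1 = g₀ := Subtype.ext hs
  have ht' : (β'.flag t).1 = g₁ := Subtype.ext ht
  let θ := h2.residueIso (hi x).vertex D α' β' hs' ht'
  have hθ := h2.residueIso_spec (hi x).vertex D α' β' hs' ht'
  refine ⟨θ.trans (N.insertIso T x), fun f => ?_, ?_⟩
  · refine (congrArg Subtype.val (hθ f)).trans ?_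
    rcases D.val f with y | y <;> rfl
  · have key := G.comp_two h2 (hi x) (ωi x) D α' β' hs' ht' θ.symm (fun f => by
        rw [← hθ]
        exact congrArg Subtype.val (θ.flag.apply_symm_apply f)) ha hb
      (fun w => O.map (X := Γ.at' h w.1) (Y := (N.inner x).at' (hi x) w) (N.vertexIso x w) (A w.1))
      (by
        rw [hA₀]
        exact O.map_map (X := X) (Y := Γ.at' h u₀.1) (Z := (N.inner x).at' (hi x) u₀) _ _ α'
          (fun _ => rfl) a)
      (by
        rw [hA₁]
        exact O.map_map (X := Y) (Y := Γ.at' h u₁.1) (Z := (N.inner x).at' (hi x) u₁) _ _ β'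
          (fun _ => rfl) b)
    rw [if_neg (not_lt.2 hlt.le), one_smul] at key
    rw [← key]
    exact (O.map_map (X := (N.inner x).total (hi x)) (Y := U) (Z := (N.outer T).at' h₀ x) θ.symm
      (θ.trans (N.insertIso T x)) (N.insertIso T x) (fun f => congrArg (N.insertIso T x).flag
        (θ.flag.apply_symm_apply f)) _).symm

/-- The unit axiom: a vertex into which a bare corolla is inserted keeps its decoration. -/
theorem innerComp_single {x : N.Vert0} {w : (N.inner x).Vert} (hw : ∀ w', w' = w)
    (hf : ∀ f, (N.inner x).inv f = f) {Z : T.Vertex} (α : Corolla.Iso Z.1 (Γ.corolla w.1))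
    (c : O.obj Z) (A : ∀ w, O.obj (Γ.at' h w)) (hA : A w.1 = O.map (Y := Γ.at' h w.1) α c) :
    ∃ ψ : Corolla.Iso Z.1 ((N.outer T).corolla x),
      (∀ f, (ψ.flag f).1.1 = (α.flag f).1) ∧
      G.innerComp h N h₀ hi ωi A x = O.map (Y := (N.outer T).at' h₀ x) ψ c := by
  let θ := Graph.singleIso hw hf ((hi x).vertex w)
  refine ⟨((α.trans (N.vertexIso x w)).trans θ).trans (N.insertIso T x), fun f => rfl, ?_⟩
  unfold innerComp
  rw [G.comp_unit (N.inner x) (hi x) (ωi x) w hw hf θ (fun _ => rfl), hA]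
  have h1 := O.map_map (X := Z) (Y := Γ.at' h w.1) (Z := (N.inner x).at' (hi x) w) α
    (N.vertexIso x w) (α.trans (N.vertexIso x w)) (fun _ => rfl) c
  have h2 := O.map_map (X := Z) (Y := (N.inner x).at' (hi x) w) (Z := (N.inner x).total (hi x))
    (α.trans (N.vertexIso x w)) θ ((α.trans (N.vertexIso x w)).trans θ) (fun _ => rfl) c
  rw [h1, h2]
  exact O.map_map (X := Z) (Y := (N.inner x).total (hi x)) (Z := (N.outer T).at' h₀ x) _ _ _
    (fun _ => rfl) c

/-- The nesting axiom for a graph that becomes a one-edge graph after contraction: the outer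
composition is evaluated by `comp_two`, and only the sign of the nesting axiom is left. -/
theorem comp_nest_two {x₀ x₁ : N.Vert0} {g₀ g₁ : (N.outer T).Flag}
    (h2 : (N.outer T).IsTwo x₀ x₁ g₀ g₁) (hlt : x₀ < x₁) (ω : Γ.EdgeOrder)
    (hω : ω.list = s(g₀.1, g₁.1) :: ((Finset.univ : Finset N.Vert0).sort (· ≤ ·)).flatMap
        (fun x => (ωi x).list.map (Sym2.map Subtype.val)))
    (d : Γ.Vert → ℤ) (A : ∀ w, O.obj (Γ.at' h w)) (hA : ∀ w, A w ∈ O.gr _ (d w))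
    {U V W : T.Vertex} {s : U.1.Flag} {t : V.1.Flag} (D : Join U V W s t)
    (ψ₀ : Corolla.Iso U.1 ((N.outer T).corolla x₀)) (ψ₁ : Corolla.Iso V.1 ((N.outer T).corolla x₁))
    (hs : (ψ₀.flag s).1 = g₀) (ht : (ψ₁.flag t).1 = g₁) (ρ : Corolla.Iso W.1 (Γ.residue T))
    (hρ : ∀ f, (ρ.flag f).1 =
      Sum.elim (fun x => (ψ₀.flag x).1.1) (fun y => (ψ₁.flag y).1.1) (D.val f))
    {i j : ℤ} {a : O.obj U} {b : O.obj V} (ha : a ∈ O.gr U i) (hb : b ∈ O.gr V j)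
    (hA₀ : G.innerComp h N h₀ hi ωi A x₀ = O.map (Y := (N.outer T).at' h₀ x₀) ψ₀ a)
    (hA₁ : G.innerComp h N h₀ hi ωi A x₁ = O.map (Y := (N.outer T).at' h₀ x₁) ψ₁ b) :
    O.map (Y := Γ.total h) ρ (G.gl D a b) =
      (∏ y : N.Vert0 × N.Vert0, if y.1 < y.2 then
        ((p : ℤ) * (ωi y.2).list.length * ∑ w : (N.inner y.1).Vert, d w.1).negOnePow else 1) •
      G.comp Γ h ω A := by
  let θ := h2.residueIso h₀.vertex D ψ₀ ψ₁ hs ht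
  have hθ := h2.residueIso_spec h₀.vertex D ψ₀ ψ₁ hs ht
  have hθ' : ∀ f, ((θ.flag f).1).1 = (ρ.flag f).1 := by
    intro f
    rw [hρ]
    refine (congrArg Subtype.val (hθ f)).trans ?_
    rcases D.val f with y | y <;> rfl
  have h1 := G.comp_nest Γ h N h₀ hi (θ.symm.trans ρ) (fun f => by
      obtain ⟨g, rfl⟩ := θ.flag.surjective f
      rw [hθ']
      change (ρ.flag (θ.flag.symm (θ.flag g))).1 = _
      rw [Equiv.symm_apply_apply]) ω h2.order ωi hω d A hA
  have key := G.comp_two h2 h₀ h2.order D ψ₀ ψ₁ hs ht θ.symm (fun f => by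
        rw [← hθ]
        exact congrArg Subtype.val (θ.flag.apply_symm_apply f)) ha hb
      (G.innerComp h N h₀ hi ωi A) hA₀ hA₁
  replace key := key.trans ((congrArg (· • G.gl D a b) (if_neg (not_lt.2 hlt.le))).trans
    (one_smul _ _))
  rw [← h1, ← key]
  exact O.map_map (X := (N.outer T).total h₀) (Y := W) (Z := Γ.total h) θ.symm ρ
    (θ.symm.trans ρ) (fun f => rfl) _

end Gluing

/-! ### Chains of three vertices -/

namespace Graph

section Chain

variable (X Y Z : Corolla) (s : X.Flag) (t t' : Y.Flag) (w : Z.Flag) (ht : t ≠ t')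

open Classical in
/-- The involution with the edges `(s, t)` and `(t', w)`. -/
def chainInv (f : X.Flag ⊕ (Y.Flag ⊕ Z.Flag)) : X.Flag ⊕ (Y.Flag ⊕ Z.Flag) :=
  if f = Sum.inl s then Sum.inr (Sum.inl t) else
  if f = Sum.inr (Sum.inl t) then Sum.inl s else
  if f = Sum.inr (Sum.inl t') then Sum.inr (Sum.inr w) else
  if f = Sum.inr (Sum.inr w) then Sum.inr (Sum.inl t') else f

theorem chainInv_s : chainInv X Y Z s t t' w (Sum.inl s) = Sum.inr (Sum.inl t) := by
  simp [chainInv]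

theorem chainInv_t : chainInv X Y Z s t t' w (Sum.inr (Sum.inl t)) = Sum.inl s := by
  simp [chainInv]

include ht in
theorem chainInv_t' : chainInv X Y Z s t t' w (Sum.inr (Sum.inl t')) = Sum.inr (Sum.inr w) := by
  simp [chainInv, ht.symm]

theorem chainInv_w : chainInv X Y Z s t t' w (Sum.inr (Sum.inr w)) = Sum.inr (Sum.inl t') := by
  simp [chainInv]

include ht in
theorem chainInv_eq_iff (f : X.Flag ⊕ (Y.Flag ⊕ Z.Flag)) :
    chainInv X Y Z s t t' w f = f ↔
      f ≠ Sum.inl s ∧ f ≠ Sum.inr (Sum.inl t) ∧ f ≠ Sum.inr (Sum.inl t') ∧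
        f ≠ Sum.inr (Sum.inr w) := by
  constructor
  · intro h
    refine ⟨?_, ?_, ?_, ?_⟩ <;> rintro rfl
    · rw [chainInv_s] at h; simp at h
    · rw [chainInv_t] at h; simp at h
    · rw [chainInv_t' _ _ _ _ _ _ _ ht] at h; simp at h
    · rw [chainInv_w] at h; simp at h
  · rintro ⟨h1, h2, h3, h4⟩
    simp only [chainInv, h1, h2, h3, h4, if_false]

include ht in
-- A statement about all flags lying on edges reduces to the four flags `s`, `t`, `t'`, `w`.
theorem chainInv_cases {P : X.Flag ⊕ (Y.Flag ⊕ Z.Flag) → X.Flag ⊕ (Y.Flag ⊕ Z.Flag) → Prop}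
    (h₁ : P (Sum.inl s) (Sum.inr (Sum.inl t))) (h₂ : P (Sum.inr (Sum.inl t)) (Sum.inl s))
    (h₃ : P (Sum.inr (Sum.inl t')) (Sum.inr (Sum.inr w)))
    (h₄ : P (Sum.inr (Sum.inr w)) (Sum.inr (Sum.inl t'))) (f : X.Flag ⊕ (Y.Flag ⊕ Z.Flag))
    (hf : chainInv X Y Z s t t' w f ≠ f) : P f (chainInv X Y Z s t t' w f) := by
  rw [Ne, chainInv_eq_iff _ _ _ _ _ _ _ ht] at hf
  by_cases h1 : f = Sum.inl s
  · rw [h1, chainInv_s]; exact h₁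
  by_cases h2 : f = Sum.inr (Sum.inl t)
  · rw [h2, chainInv_t]; exact h₂
  by_cases h3 : f = Sum.inr (Sum.inl t')
  · rw [h3, chainInv_t' _ _ _ _ _ _ _ ht]; exact h₃
  by_cases h4 : f = Sum.inr (Sum.inr w)
  · rw [h4, chainInv_w]; exact h₄
  exact absurd ⟨h1, h2, h3, h4⟩ hf

/-- The chain of the vertices `X`, `Y`, `Z` with the edges `(s, t)` and `(t', w)`. -/
def chain : Graph where
  Vert := Fin 3
  fintype := inferInstance
  order := inferInstance
  Flag := X.Flag ⊕ (Y.Flag ⊕ Z.Flag)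
  finite := inferInstance
  vert := Sum.elim (fun _ => 0) (Sum.elim (fun _ => 1) (fun _ => 2))
  inv := chainInv X Y Z s t t' w
  inv_inv f := by
    by_cases h1 : f = Sum.inl s
    · rw [h1, chainInv_s, chainInv_t]
    by_cases h2 : f = Sum.inr (Sum.inl t)
    · rw [h2, chainInv_t, chainInv_s]
    by_cases h3 : f = Sum.inr (Sum.inl t')
    · rw [h3, chainInv_t' _ _ _ _ _ _ _ ht, chainInv_w]
    by_cases h4 : f = Sum.inr (Sum.inr w)
    · rw [h4, chainInv_w, chainInv_t' _ _ _ _ _ _ _ ht]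
    rw [(chainInv_eq_iff _ _ _ _ _ _ _ ht f).2 ⟨h1, h2, h3, h4⟩,
      (chainInv_eq_iff _ _ _ _ _ _ _ ht f).2 ⟨h1, h2, h3, h4⟩]
  out := Sum.elim X.out (Sum.elim Y.out Z.out)
  genus := ![X.genus, Y.genus, Z.genus]

def chainX : Corolla.Iso X ((chain X Y Z s t t' w ht).corolla (0 : Fin 3)) where
  flag :=
    { toFun := fun f => ⟨Sum.inl f, rfl⟩
      invFun := fun f => match f with
        | ⟨Sum.inl g, _⟩ => g
        | ⟨Sum.inr (Sum.inl _), h⟩ => absurd h (by simp [chain])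
        | ⟨Sum.inr (Sum.inr _), h⟩ => absurd h (by simp [chain])
      left_inv := fun _ => rfl
      right_inv := by
        rintro ⟨g | g | g, h⟩
        · rfl
        · exact absurd h (by simp [chain])
        · exact absurd h (by simp [chain]) }
  out_eq _ := rfl
  genus_eq := rfl

def chainY : Corolla.Iso Y ((chain X Y Z s t t' w ht).corolla (1 : Fin 3)) where
  flag :=
    { toFun := fun f => ⟨Sum.inr (Sum.inl f), rfl⟩
      invFun := fun f => match f with
        | ⟨Sum.inl _, h⟩ => absurd h (by simp [chain])
        | ⟨Sum.inr (Sum.inl g), _⟩ => g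
        | ⟨Sum.inr (Sum.inr _), h⟩ => absurd h (by simp [chain])
      left_inv := fun _ => rfl
      right_inv := by
        rintro ⟨g | g | g, h⟩
        · exact absurd h (by simp [chain])
        · rfl
        · exact absurd h (by simp [chain]) }
  out_eq _ := rfl
  genus_eq := rfl

def chainZ : Corolla.Iso Z ((chain X Y Z s t t' w ht).corolla (2 : Fin 3)) where
  flag :=
    { toFun := fun f => ⟨Sum.inr (Sum.inr f), rfl⟩
      invFun := fun f => match f with
        | ⟨Sum.inl _, h⟩ => absurd h (by simp [chain])
        | ⟨Sum.inr (Sum.inl _), h⟩ => absurd h (by simp [chain])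
        | ⟨Sum.inr (Sum.inr g), _⟩ => g
      left_inv := fun _ => rfl
      right_inv := by
        rintro ⟨g | g | g, h⟩
        · exact absurd h (by simp [chain])
        · exact absurd h (by simp [chain])
        · rfl }
  out_eq _ := rfl
  genus_eq := rfl

theorem chain_isEdge_iff (e : Sym2 (X.Flag ⊕ (Y.Flag ⊕ Z.Flag))) :
    (chain X Y Z s t t' w ht).IsEdge e ↔
      e = s(Sum.inl s, Sum.inr (Sum.inl t)) ∨
        e = s(Sum.inr (Sum.inl t'), Sum.inr (Sum.inr w)) := by
  constructor
  · rintro ⟨f, hf, rfl⟩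
    exact chainInv_cases X Y Z s t t' w ht (P := fun f g =>
      s(f, g) = s(Sum.inl s, Sum.inr (Sum.inl t)) ∨
        s(f, g) = s(Sum.inr (Sum.inl t'), Sum.inr (Sum.inr w)))
      (Or.inl rfl) (Or.inl Sym2.eq_swap) (Or.inr rfl) (Or.inr Sym2.eq_swap) f hf
  · rintro (rfl | rfl)
    · exact ⟨Sum.inl s, fun h => (by cases (chainInv_s X Y Z s t t' w).symm.trans h),
        congrArg (fun g => s(_, g)) (chainInv_s X Y Z s t t' w).symm⟩
    · exact ⟨(Sum.inr (Sum.inl t') : X.Flag ⊕ (Y.Flag ⊕ Z.Flag)),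
        fun h => (by cases (chainInv_t' X Y Z s t t' w ht).symm.trans h),
        congrArg (fun g => s(_, g)) (chainInv_t' X Y Z s t t' w ht).symm⟩

theorem chain_edge_ne : (s(Sum.inl s, Sum.inr (Sum.inl t)) : Sym2 (X.Flag ⊕ (Y.Flag ⊕ Z.Flag))) ≠
    s(Sum.inr (Sum.inl t'), Sum.inr (Sum.inr w)) := by
  simp

/-- The order of the edges with `(s, t)` first. -/
def chainOrder : (chain X Y Z s t t' w ht).EdgeOrder where
  list := [s(Sum.inl s, Sum.inr (Sum.inl t)), s(Sum.inr (Sum.inl t'), Sum.inr (Sum.inr w))]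
  nodup := List.nodup_cons.2
    ⟨fun h => chain_edge_ne X Y Z s t t' w (List.mem_singleton.1 h), List.nodup_singleton _⟩
  mem_iff e := List.mem_pair.trans (chain_isEdge_iff X Y Z s t t' w ht e).symm

/-- The order of the edges with `(t', w)` first. -/
def chainOrder' : (chain X Y Z s t t' w ht).EdgeOrder where
  list := [s(Sum.inr (Sum.inl t'), Sum.inr (Sum.inr w)), s(Sum.inl s, Sum.inr (Sum.inl t))]
  nodup := List.nodup_cons.2
    ⟨fun h => chain_edge_ne X Y Z s t t' w (List.mem_singleton.1 h).symm, List.nodup_singleton _⟩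
  mem_iff e := (List.mem_pair.trans or_comm).trans (chain_isEdge_iff X Y Z s t t' w ht e).symm

theorem chain_card :
    Fintype.card (chain X Y Z s t t' w ht).Vert = (chain X Y Z s t t' w ht).numEdges + 1 := by
  rw [(chainOrder X Y Z s t t' w ht).numEdges_eq]
  exact Fintype.card_fin 3

theorem chain_connected : (chain X Y Z s t t' w ht).Connected := by
  let R : Fin 3 → Fin 3 → Prop := fun x y => ∃ f, (chain X Y Z s t t' w ht).vert f = x ∧
    (chain X Y Z s t t' w ht).vert ((chain X Y Z s t t' w ht).inv f) = y
  have h01 : R 0 1 := ⟨Sum.inl s, rfl,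
    congrArg (chain X Y Z s t t' w ht).vert (chainInv_s X Y Z s t t' w)⟩
  have h10 : R 1 0 := ⟨(Sum.inr (Sum.inl t) : X.Flag ⊕ (Y.Flag ⊕ Z.Flag)), rfl,
    congrArg (chain X Y Z s t t' w ht).vert (chainInv_t X Y Z s t t' w)⟩
  have h12 : R 1 2 := ⟨(Sum.inr (Sum.inl t') : X.Flag ⊕ (Y.Flag ⊕ Z.Flag)), rfl,
    congrArg (chain X Y Z s t t' w ht).vert (chainInv_t' X Y Z s t t' w ht)⟩
  have h21 : R 2 1 := ⟨(Sum.inr (Sum.inr w) : X.Flag ⊕ (Y.Flag ⊕ Z.Flag)), rfl,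
    congrArg (chain X Y Z s t t' w ht).vert (chainInv_w X Y Z s t t' w)⟩
  have key : ∀ x y : Fin 3, Relation.ReflTransGen R x y := by
    intro x y
    have h1 : Relation.ReflTransGen R x 1 := by
      fin_cases x
      exacts [.single h01, .refl, .single h21]
    have h2 : Relation.ReflTransGen R 1 y := by
      fin_cases y
      exacts [.single h10, .refl, .single h12]
    exact h1.trans h2
  exact key

theorem chain_directed (h1 : X.out s ≠ Y.out t) (h2 : Y.out t' ≠ Z.out w) :
    (chain X Y Z s t t' w ht).EdgesDirected ∧ (chain X Y Z s t t' w ht).NoWheels := by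
  constructor
  · refine chainInv_cases X Y Z s t t' w ht (P := fun f g => (chain X Y Z s t t' w ht).out g =
      !(chain X Y Z s t t' w ht).out f) ?_ ?_ ?_ ?_
    · change Y.out t = !X.out s
      revert h1; cases X.out s <;> cases Y.out t <;> simp
    · change X.out s = !Y.out t
      revert h1; cases X.out s <;> cases Y.out t <;> simp
    · change Z.out w = !Y.out t'
      revert h2; cases Y.out t' <;> cases Z.out w <;> simp
    · change Y.out t' = !Z.out w
      revert h2; cases Y.out t' <;> cases Z.out w <;> simp
  -- The middle vertex has rank `1`; an end vertex has rank `0` if its edge runs towards the middle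
  -- and `2` if it runs away from it.
  · refine noWheels_of_rank (![cond (X.out s) 0 2, 1, cond (Y.out t') 2 0] : Fin 3 → ℕ) ?_
    refine chainInv_cases X Y Z s t t' w ht (P := fun f g => (chain X Y Z s t t' w ht).out f = true →
      (![cond (X.out s) 0 2, 1, cond (Y.out t') 2 0] : Fin 3 → ℕ)
        ((chain X Y Z s t t' w ht).vert f) < (![cond (X.out s) 0 2, 1, cond (Y.out t') 2 0] :
          Fin 3 → ℕ) ((chain X Y Z s t t' w ht).vert g)) ?_ ?_ ?_ ?_
    · intro (h : X.out s = true)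
      change cond (X.out s) 0 2 < 1
      simp [h]
    · intro (h : Y.out t = true)
      change 1 < cond (X.out s) 0 2
      have : X.out s = false := by rw [h] at h1; simpa using h1
      simp [this]
    · intro (h : Y.out t' = true)
      change 1 < cond (Y.out t') 2 0
      simp [h]
    · intro (h : Z.out w = true)
      change cond (Y.out t') 2 0 < 1
      have : Y.out t' = false := by rw [h] at h2; simpa using h2
      simp [this]

end Chain

section

variable {T : OpType} (X Y Z : T.Vertex) (s : X.1.Flag) (t t' : Y.1.Flag) (w : Z.1.Flag)
  (ht : t ≠ t')

theorem chain_vertex (v : (chain X.1 Y.1 Z.1 s t t' w ht).Vert) :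
    T.Occurs ((chain X.1 Y.1 Z.1 s t t' w ht).corolla v).genus
      ((chain X.1 Y.1 Z.1 s t t' w ht).corolla v).numIn
      ((chain X.1 Y.1 Z.1 s t t' w ht).corolla v).numOut := by
  have key : ∀ v : Fin 3, T.Occurs ((chain X.1 Y.1 Z.1 s t t' w ht).corolla v).genus
      ((chain X.1 Y.1 Z.1 s t t' w ht).corolla v).numIn
      ((chain X.1 Y.1 Z.1 s t t' w ht).corolla v).numOut := by
    intro v
    fin_cases v
    · exact (chainX X.1 Y.1 Z.1 s t t' w ht).occurs X.2
    · exact (chainY X.1 Y.1 Z.1 s t t' w ht).occurs Y.2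
    · exact (chainZ X.1 Y.1 Z.1 s t t' w ht).occurs Z.2
  exact key v

variable {X Y Z s t t' w} {V W : T.Vertex} {g : V.1.Flag} (D₃ : Join Y Z V t' w)
  (D₄ : Join X V W s g) (hr : D₃.val g = Sum.inl t)

/-- The residue of a chain is the repeated join. -/
def chainResidue : Corolla.Iso W.1 ((chain X.1 Y.1 Z.1 s t t' w ht).residue T) :=
  Corolla.Iso.over (Y := (chain X.1 Y.1 Z.1 s t t' w ht).residue T)
    (A := X.1.Flag ⊕ (Y.1.Flag ⊕ Z.1.Flag))
    (fun x => Sum.map id D₃.val (D₄.val x)) Subtype.val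
    ((Sum.map_injective.2 ⟨Function.injective_id, D₃.injective⟩).comp D₄.injective)
    Subtype.val_injective
    (fun f => by
      rw [Join.mem_range_assoc D₃ D₄ hr, ← chainInv_eq_iff _ _ _ _ _ _ _ ht]
      exact ⟨fun hf => ⟨⟨f, hf⟩, rfl⟩, by rintro ⟨x, rfl⟩; exact x.2⟩)
    (fun x y hxy => by
      rw [← D₄.out_val]
      change _ = Sum.elim X.1.out (Sum.elim Y.1.out Z.1.out) y.1
      rw [← hxy]
      rcases D₄.val x with z | z
      · rfl
      · exact (D₃.out_val z).symm)
    (by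
      refine Eq.trans ?_ (totalGenus_of_tree (chain_vertex X Y Z s t t' w ht)
        (chain_card X.1 Y.1 Z.1 s t t' w ht)).symm
      rw [D₄.genus_eq, D₃.genus_eq, ← add_assoc]
      exact (Fin.sum_univ_three (![X.1.genus, Y.1.genus, Z.1.genus])).symm)

theorem chainResidue_spec (f : W.1.Flag) :
    ((chainResidue ht D₃ D₄ hr).flag f).1 = Sum.map id D₃.val (D₄.val f) := by
  unfold chainResidue
  exact Corolla.Iso.over_spec (Y := (chain X.1 Y.1 Z.1 s t t' w ht).residue T) _ Subtype.val
    _ _ _ _ _ f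

include D₃ D₄ hr in
theorem chain_admissible (h1 : T.Joinable (X.1.out s) (Y.1.out t)) :
    T.Admissible (chain X.1 Y.1 Z.1 s t t' w ht) :=
  admissible_of_tree (chain_vertex X Y Z s t t' w ht) (chain_connected X.1 Y.1 Z.1 s t t' w ht)
    (chain_card X.1 Y.1 Z.1 s t t' w ht)
    (fun hT => chain_directed X.1 Y.1 Z.1 s t t' w ht (h1 hT) (D₃.joinable hT))
    (chainResidue ht D₃ D₄ hr)

end

end Graph

/-! ### The two ways of contracting a chain in two steps -/

namespace Graph

section Nests

variable (X Y Z : Corolla) (s : X.Flag) (t t' : Y.Flag) (w : Z.Flag) (ht : t ≠ t')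

/-- Contraction of the first edge of a chain. -/
def nestLeft : (chain X Y Z s t t' w ht).Nest where
  Vert0 := Bool
  fintype := inferInstance
  order := inferInstance
  proj := fun v : Fin 3 => decide (v = 2)
  mono := by
    have key : ∀ a b : Fin 3, a ≤ b → decide (a = 2) ≤ decide (b = 2) := by decide
    exact fun a b h => key a b h
  inside f := f = (Sum.inl s : X.Flag ⊕ (Y.Flag ⊕ Z.Flag)) ∨
    f = (Sum.inr (Sum.inl t) : X.Flag ⊕ (Y.Flag ⊕ Z.Flag))
  inside_inv f := by
    rintro (rfl | rfl)
    · exact Or.inr (chainInv_s X Y Z s t t' w)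
    · exact Or.inl (chainInv_t X Y Z s t t' w)
  inside_ne f := by
    rintro (rfl | rfl) h
    · cases (chainInv_s X Y Z s t t' w).symm.trans h
    · cases (chainInv_t X Y Z s t t' w).symm.trans h
  inside_proj f := by
    rintro (rfl | rfl)
    · exact (congrArg (fun g => (fun v : Fin 3 => decide (v = 2)) ((chain X Y Z s t t' w ht).vert g))
        (chainInv_s X Y Z s t t' w)).trans rfl
    · exact (congrArg (fun g => (fun v : Fin 3 => decide (v = 2)) ((chain X Y Z s t t' w ht).vert g))
        (chainInv_t X Y Z s t t' w)).trans rfl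

/-- Contraction of the second edge of a chain. -/
def nestRight : (chain X Y Z s t t' w ht).Nest where
  Vert0 := Bool
  fintype := inferInstance
  order := inferInstance
  proj := fun v : Fin 3 => decide (v ≠ 0)
  mono := by
    have key : ∀ a b : Fin 3, a ≤ b → decide (a ≠ 0) ≤ decide (b ≠ 0) := by decide
    exact fun a b h => key a b h
  inside f := f = (Sum.inr (Sum.inl t') : X.Flag ⊕ (Y.Flag ⊕ Z.Flag)) ∨
    f = (Sum.inr (Sum.inr w) : X.Flag ⊕ (Y.Flag ⊕ Z.Flag))
  inside_inv f := by
    rintro (rfl | rfl)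
    · exact Or.inr (chainInv_t' X Y Z s t t' w ht)
    · exact Or.inl (chainInv_w X Y Z s t t' w)
  inside_ne f := by
    rintro (rfl | rfl) h
    · cases (chainInv_t' X Y Z s t t' w ht).symm.trans h
    · cases (chainInv_w X Y Z s t t' w).symm.trans h
  inside_proj f := by
    rintro (rfl | rfl)
    · exact (congrArg (fun g => (fun v : Fin 3 => decide (v ≠ 0)) ((chain X Y Z s t t' w ht).vert g))
        (chainInv_t' X Y Z s t t' w ht)).trans rfl
    · exact (congrArg (fun g => (fun v : Fin 3 => decide (v ≠ 0)) ((chain X Y Z s t t' w ht).vert g))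
        (chainInv_w X Y Z s t t' w)).trans rfl

theorem Nest.inner_inv_of_not_inside {Γ : Graph} (N : Γ.Nest) {x : N.Vert0} (f : (N.inner x).Flag)
    (h : ¬ N.inside f.1) : (N.inner x).inv f = f := (N.inner_inv_eq_iff x f).2 h

theorem Nest.inner_inv_of_inside {Γ : Graph} (N : Γ.Nest) {x : N.Vert0} (f g : (N.inner x).Flag)
    (h : N.inside f.1) (hg : Γ.inv f.1 = g.1) : (N.inner x).inv f = g :=
  (dif_pos h).trans (Subtype.ext hg)

theorem nestLeft_inner :
    ((nestLeft X Y Z s t t' w ht).inner (false : Bool)).IsTwo ⟨(0 : Fin 3), rfl⟩ ⟨(1 : Fin 3), rfl⟩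
      ⟨(Sum.inl s : X.Flag ⊕ (Y.Flag ⊕ Z.Flag)), rfl⟩
      ⟨(Sum.inr (Sum.inl t) : X.Flag ⊕ (Y.Flag ⊕ Z.Flag)), rfl⟩ where
  ne h := absurd (congrArg Subtype.val h) (by decide : (0 : Fin 3) ≠ 1)
  cover v := by
    have key : ∀ a : Fin 3, decide (a = 2) = false → a = 0 ∨ a = 1 := by decide
    exact (key v.1 v.2).imp (fun h => Subtype.ext h) (fun h => Subtype.ext h)
  vert₀ := rfl
  vert₁ := rfl
  inv₀ := Nest.inner_inv_of_inside _ _ _ (Or.inl rfl) (chainInv_s X Y Z s t t' w)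
  inv_eq f h0 h1 := Nest.inner_inv_of_not_inside _ _ fun h => h.elim
    (fun h => h0 (Subtype.ext h)) (fun h => h1 (Subtype.ext h))

theorem nestLeft_single (v : ((nestLeft X Y Z s t t' w ht).inner (true : Bool)).Vert) :
    v = ⟨(2 : Fin 3), rfl⟩ := by
  have key : ∀ a : Fin 3, decide (a = 2) = true → a = 2 := by decide
  exact Subtype.ext (key v.1 v.2)

theorem nestLeft_inv (f : ((nestLeft X Y Z s t t' w ht).inner (true : Bool)).Flag) :
    ((nestLeft X Y Z s t t' w ht).inner (true : Bool)).inv f = f := by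
  refine Nest.inner_inv_of_not_inside _ _ fun h => ?_
  obtain ⟨f, hf⟩ := f
  rcases h with rfl | rfl
  · exact absurd hf (by decide : decide ((0 : Fin 3) = 2) ≠ true)
  · exact absurd hf (by decide : decide ((1 : Fin 3) = 2) ≠ true)

theorem nestLeft_outer (T : OpType) :
    ((nestLeft X Y Z s t t' w ht).outer T).IsTwo (false : Bool) (true : Bool)
      ⟨(Sum.inr (Sum.inl t') : X.Flag ⊕ (Y.Flag ⊕ Z.Flag)), by
        rintro (h | h)
        · cases h
        · exact ht (Sum.inl_injective (Sum.inr_injective h)).symm⟩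
      ⟨(Sum.inr (Sum.inr w) : X.Flag ⊕ (Y.Flag ⊕ Z.Flag)), by
        rintro (h | h) <;> cases h⟩ where
  ne := Bool.false_ne_true
  cover v := by cases v; exacts [Or.inl rfl, Or.inr rfl]
  vert₀ := rfl
  vert₁ := rfl
  inv₀ := Subtype.ext (chainInv_t' X Y Z s t t' w ht)
  inv_eq f h0 h1 := Subtype.ext ((chainInv_eq_iff X Y Z s t t' w ht f.1).2
    ⟨fun h => f.2 (Or.inl h), fun h => f.2 (Or.inr h), fun h => h0 (Subtype.ext h),
      fun h => h1 (Subtype.ext h)⟩)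

theorem nestRight_inner :
    ((nestRight X Y Z s t t' w ht).inner (true : Bool)).IsTwo ⟨(1 : Fin 3), rfl⟩ ⟨(2 : Fin 3), rfl⟩
      ⟨(Sum.inr (Sum.inl t') : X.Flag ⊕ (Y.Flag ⊕ Z.Flag)), rfl⟩
      ⟨(Sum.inr (Sum.inr w) : X.Flag ⊕ (Y.Flag ⊕ Z.Flag)), rfl⟩ where
  ne h := absurd (congrArg Subtype.val h) (by decide : (1 : Fin 3) ≠ 2)
  cover v := by
    have key : ∀ a : Fin 3, decide (a ≠ 0) = true → a = 1 ∨ a = 2 := by decide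
    exact (key v.1 v.2).imp (fun h => Subtype.ext h) (fun h => Subtype.ext h)
  vert₀ := rfl
  vert₁ := rfl
  inv₀ := Nest.inner_inv_of_inside _ _ _ (Or.inl rfl) (chainInv_t' X Y Z s t t' w ht)
  inv_eq f h0 h1 := Nest.inner_inv_of_not_inside _ _ fun h => h.elim
    (fun h => h0 (Subtype.ext h)) (fun h => h1 (Subtype.ext h))

theorem nestRight_single (v : ((nestRight X Y Z s t t' w ht).inner (false : Bool)).Vert) :
    v = ⟨(0 : Fin 3), rfl⟩ := by
  have key : ∀ a : Fin 3, decide (a ≠ 0) = false → a = 0 := by decide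
  exact Subtype.ext (key v.1 v.2)

theorem nestRight_inv (f : ((nestRight X Y Z s t t' w ht).inner (false : Bool)).Flag) :
    ((nestRight X Y Z s t t' w ht).inner (false : Bool)).inv f = f := by
  refine Nest.inner_inv_of_not_inside _ _ fun h => ?_
  obtain ⟨f, hf⟩ := f
  rcases h with rfl | rfl
  · exact absurd hf (by decide : decide ((1 : Fin 3) ≠ 0) ≠ false)
  · exact absurd hf (by decide : decide ((2 : Fin 3) ≠ 0) ≠ false)

theorem nestRight_outer (T : OpType) :
    ((nestRight X Y Z s t t' w ht).outer T).IsTwo (false : Bool) (true : Bool)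
      ⟨(Sum.inl s : X.Flag ⊕ (Y.Flag ⊕ Z.Flag)), by rintro (h | h) <;> cases h⟩
      ⟨(Sum.inr (Sum.inl t) : X.Flag ⊕ (Y.Flag ⊕ Z.Flag)), by
        rintro (h | h)
        · exact ht (Sum.inl_injective (Sum.inr_injective h))
        · cases h⟩ where
  ne := Bool.false_ne_true
  cover v := by cases v; exacts [Or.inl rfl, Or.inr rfl]
  vert₀ := rfl
  vert₁ := rfl
  inv₀ := Subtype.ext (chainInv_s X Y Z s t t' w)
  inv_eq f h0 h1 := Subtype.ext ((chainInv_eq_iff X Y Z s t t' w ht f.1).2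
    ⟨fun h => h0 (Subtype.ext h), fun h => h1 (Subtype.ext h), fun h => f.2 (Or.inl h),
      fun h => f.2 (Or.inr h)⟩)

end Nests

theorem Nest.inner_vertex {T : OpType} {Γ : Graph} (N : Γ.Nest)
    (hv : ∀ w, T.Occurs (Γ.corolla w).genus (Γ.corolla w).numIn (Γ.corolla w).numOut)
    (x : N.Vert0) (w : (N.inner x).Vert) : T.Occurs ((N.inner x).corolla w).genus
      ((N.inner x).corolla w).numIn ((N.inner x).corolla w).numOut :=
  (N.vertexIso x w).occurs (hv w.1)

theorem Nest.outer_vertex {T : OpType} {Γ : Graph} (N : Γ.Nest)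
    (hi : ∀ x, T.Admissible (N.inner x)) (x : N.Vert0) : T.Occurs ((N.outer T).corolla x).genus
      ((N.outer T).corolla x).numIn ((N.outer T).corolla x).numOut :=
  (N.insertIso T x).occurs (hi x).total

end Graph

/-- Fixes the order in which the nesting axiom lists the edges of the two inserted graphs. -/
theorem sort_univ_bool : (Finset.univ : Finset Bool).sort (· ≤ ·) = [false, true] := by
  refine List.Perm.eq_of_pairwise' (r := (· ≤ ·)) (Finset.pairwise_sort _ _) (by simp) ?_
  exact (List.perm_ext_iff_of_nodup (Finset.sort_nodup _ _) (by simp)).2 (by simp)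

theorem sum_eq_of_forall_eq {ι : Type*} [Fintype ι] (x : ι) (h : ∀ y, y = x) (F : ι → ℤ) :
    ∑ y, F y = F x :=
  Fintype.sum_eq_single x fun y hy => absurd (h y) hy

theorem prod_bool_lt (F : Bool → Bool → ℤˣ) :
    (∏ y : Bool × Bool, if y.1 < y.2 then F y.1 y.2 else 1) = F false true := by
  have h : ¬ (true < false) := by decide
  rw [Fintype.prod_prod_type]
  simp [h]

/-! ### Associativity of one-edge compositions up to sign -/

namespace Gluing

open OddBracket.Graph

variable {k : Type v} [Field k] {T : OpType} {p : ℕ} {O : SMod.{u} k T} (G : Gluing p O)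
  {X Y Z U V W : T.Vertex} {s : X.1.Flag} {t t' : Y.1.Flag} {w : Z.1.Flag} {f : U.1.Flag}
  {g : V.1.Flag} {D₁ : Join X Y U s t} {D₂ : Join U Z W f w} {D₃ : Join Y Z V t' w}
  {D₄ : Join X V W s g}

/-- The decoration of the vertices of a chain. -/
def chainDecor {ht : t ≠ t'} (h : T.Admissible (chain X.1 Y.1 Z.1 s t t' w ht)) (a : O.obj X)
    (b : O.obj Y) (c : O.obj Z) (v : Fin 3) :
    O.obj ((chain X.1 Y.1 Z.1 s t t' w ht).at' h v) :=
  match v with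
  | 0 => O.map (Y := (chain X.1 Y.1 Z.1 s t t' w ht).at' h (0 : Fin 3))
      (chainX X.1 Y.1 Z.1 s t t' w ht) a
  | 1 => O.map (Y := (chain X.1 Y.1 Z.1 s t t' w ht).at' h (1 : Fin 3))
      (chainY X.1 Y.1 Z.1 s t t' w ht) b
  | 2 => O.map (Y := (chain X.1 Y.1 Z.1 s t t' w ht).at' h (2 : Fin 3))
      (chainZ X.1 Y.1 Z.1 s t t' w ht) c

theorem chainDecor_gr {ht : t ≠ t'} (h : T.Admissible (chain X.1 Y.1 Z.1 s t t' w ht))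
    {i j l : ℤ} {a : O.obj X} {b : O.obj Y} {c : O.obj Z} (ha : a ∈ O.gr X i)
    (hb : b ∈ O.gr Y j) (hc : c ∈ O.gr Z l) (v : (chain X.1 Y.1 Z.1 s t t' w ht).Vert) :
    chainDecor h a b c v ∈ O.gr _ ((![i, j, l] : Fin 3 → ℤ) v) := by
  have key : ∀ v : Fin 3, chainDecor h a b c v ∈ O.gr ((chain X.1 Y.1 Z.1 s t t' w ht).at' h v)
      ((![i, j, l] : Fin 3 → ℤ) v) := by
    intro v
    match v with
    | 0 => exact O.map_gr _ _ _ ha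
    | 1 => exact O.map_gr _ _ _ hb
    | 2 => exact O.map_gr _ _ _ hc
  exact key v

/-- The edge `(s, t)` is inserted at the first vertex, so its generator passes no argument and there
is no sign. The nesting axiom lists the outer edge `(t', w)` first, whence `chainOrder'`. -/
theorem gl_gl_left (hD : JoinAssoc D₁ D₂ D₃ D₄) {ht : t ≠ t'}
    (h : T.Admissible (chain X.1 Y.1 Z.1 s t t' w ht)) {i j l : ℤ} {a : O.obj X} {b : O.obj Y}
    {c : O.obj Z} (ha : a ∈ O.gr X i) (hb : b ∈ O.gr Y j) (hc : c ∈ O.gr Z l) :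
    O.map (Y := (chain X.1 Y.1 Z.1 s t t' w ht).total h) (chainResidue ht D₃ D₄ hD.right)
        (G.gl D₂ (G.gl D₁ a b) c) =
      G.comp _ h (chainOrder' X.1 Y.1 Z.1 s t t' w ht) (chainDecor h a b c) := by
  let N := nestLeft X.1 Y.1 Z.1 s t t' w ht
  have hv := N.inner_vertex (chain_vertex X Y Z s t t' w ht)
  have h2 := nestLeft_inner X.1 Y.1 Z.1 s t t' w ht
  have hi : ∀ x, T.Admissible (N.inner x) := by
    intro x
    cases x
    · exact h2.admissible (hv _) D₁.joinable
    · exact admissible_single (nestLeft_single X.1 Y.1 Z.1 s t t' w ht)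
        (nestLeft_inv X.1 Y.1 Z.1 s t t' w ht) (hv _ _)
  have h2' := nestLeft_outer X.1 Y.1 Z.1 s t t' w ht T
  have h₀ : T.Admissible (N.outer T) := h2'.admissible (N.outer_vertex hi) D₃.joinable
  let ωi : ∀ x : N.Vert0, (N.inner x).EdgeOrder := fun x =>
    Bool.rec (motive := fun x : Bool => (N.inner x).EdgeOrder) h2.order
      (emptyOrder (nestLeft_inv X.1 Y.1 Z.1 s t t' w ht)) x
  obtain ⟨ψ₀, hψ₀, hA₀⟩ := G.innerComp_two h N h₀ hi ωi h2 (by decide : (0 : Fin 3) < 1) D₁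
    (chainX X.1 Y.1 Z.1 s t t' w ht) (chainY X.1 Y.1 Z.1 s t t' w ht) rfl rfl ha hb
    (chainDecor h a b c) rfl rfl
  obtain ⟨ψ₁, hψ₁, hA₁⟩ := G.innerComp_single h N h₀ hi ωi
    (nestLeft_single X.1 Y.1 Z.1 s t t' w ht) (nestLeft_inv X.1 Y.1 Z.1 s t t' w ht)
    (chainZ X.1 Y.1 Z.1 s t t' w ht) c (chainDecor h a b c) rfl
  have key := G.comp_nest_two h N h₀ hi ωi h2' (by decide : (false : Bool) < true)
    (chainOrder' X.1 Y.1 Z.1 s t t' w ht) (by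
      change _ = _ :: ((Finset.univ : Finset Bool).sort (· ≤ ·)).flatMap _
      rw [sort_univ_bool]
      rfl)
    (![i, j, l] : Fin 3 → ℤ) (chainDecor h a b c) (chainDecor_gr h ha hb hc) D₂ ψ₀ ψ₁
    (Subtype.ext ((hψ₀ f).trans (by rw [hD.left]; rfl))) (Subtype.ext (hψ₁ w))
    (chainResidue ht D₃ D₄ hD.right) (fun x => by
      rw [chainResidue_spec, hD.val_eq]
      rcases D₂.val x with y | y
      · refine Eq.trans ?_ (hψ₀ y).symm
        simp only [Sum.map_inl]
        rcases D₁.val y with z | z <;> rfl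
      · exact (hψ₁ y).symm) (G.gl_gr D₁ ha hb) hc hA₀ hA₁
  refine key.trans ?_
  refine (congrArg (· • G.comp _ h (chainOrder' X.1 Y.1 Z.1 s t t' w ht) (chainDecor h a b c))
    ((prod_bool_lt fun y y' => ((p : ℤ) * (ωi y').list.length *
      ∑ w : (N.inner y).Vert, (![i, j, l] : Fin 3 → ℤ) w.1).negOnePow).trans ?_)).trans (one_smul _ _)
  -- The graph inserted at the second vertex has no edges.
  change ((p : ℤ) * ((0 : ℕ) : ℤ) * _).negOnePow = 1
  simp

/-- Here the inserted edge `(t', w)` belongs to the second vertex, and its generator has to be moved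
past `a`. -/
theorem gl_gl_right (hD : JoinAssoc D₁ D₂ D₃ D₄) {ht : t ≠ t'}
    (h : T.Admissible (chain X.1 Y.1 Z.1 s t t' w ht)) {i j l : ℤ} {a : O.obj X} {b : O.obj Y}
    {c : O.obj Z} (ha : a ∈ O.gr X i) (hb : b ∈ O.gr Y j) (hc : c ∈ O.gr Z l) :
    O.map (Y := (chain X.1 Y.1 Z.1 s t t' w ht).total h) (chainResidue ht D₃ D₄ hD.right)
        (G.gl D₄ a (G.gl D₃ b c)) =
      ((p : ℤ) * i).negOnePow •
        G.comp _ h (chainOrder X.1 Y.1 Z.1 s t t' w ht) (chainDecor h a b c) := by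
  let N := nestRight X.1 Y.1 Z.1 s t t' w ht
  have hv := N.inner_vertex (chain_vertex X Y Z s t t' w ht)
  have h2 := nestRight_inner X.1 Y.1 Z.1 s t t' w ht
  have hi : ∀ x, T.Admissible (N.inner x) := by
    intro x
    cases x
    · exact admissible_single (nestRight_single X.1 Y.1 Z.1 s t t' w ht)
        (nestRight_inv X.1 Y.1 Z.1 s t t' w ht) (hv _ _)
    · exact h2.admissible (hv _) D₃.joinable
  have h2' := nestRight_outer X.1 Y.1 Z.1 s t t' w ht T
  have h₀ : T.Admissible (N.outer T) := h2'.admissible (N.outer_vertex hi) D₁.joinable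
  let ωi : ∀ x : N.Vert0, (N.inner x).EdgeOrder := fun x =>
    Bool.rec (motive := fun x : Bool => (N.inner x).EdgeOrder)
      (emptyOrder (nestRight_inv X.1 Y.1 Z.1 s t t' w ht)) h2.order x
  obtain ⟨ψ₁, hψ₁, hA₁⟩ := G.innerComp_two h N h₀ hi ωi h2 (by decide : (1 : Fin 3) < 2) D₃
    (chainY X.1 Y.1 Z.1 s t t' w ht) (chainZ X.1 Y.1 Z.1 s t t' w ht) rfl rfl hb hc
    (chainDecor h a b c) rfl rfl
  obtain ⟨ψ₀, hψ₀, hA₀⟩ := G.innerComp_single h N h₀ hi ωi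
    (nestRight_single X.1 Y.1 Z.1 s t t' w ht) (nestRight_inv X.1 Y.1 Z.1 s t t' w ht)
    (chainX X.1 Y.1 Z.1 s t t' w ht) a (chainDecor h a b c) rfl
  have key := G.comp_nest_two h N h₀ hi ωi h2' (by decide : (false : Bool) < true)
    (chainOrder X.1 Y.1 Z.1 s t t' w ht) (by
      change _ = _ :: ((Finset.univ : Finset Bool).sort (· ≤ ·)).flatMap _
      rw [sort_univ_bool]
      rfl)
    (![i, j, l] : Fin 3 → ℤ) (chainDecor h a b c) (chainDecor_gr h ha hb hc) D₄ ψ₀ ψ₁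
    (Subtype.ext (hψ₀ s)) (Subtype.ext ((hψ₁ g).trans (by rw [hD.right]; rfl)))
    (chainResidue ht D₃ D₄ hD.right) (fun x => by
      rw [chainResidue_spec]
      rcases D₄.val x with y | y
      · exact (hψ₀ y).symm
      · refine Eq.trans ?_ (hψ₁ y).symm
        simp only [Sum.map_inr]
        rcases D₃.val y with z | z <;> rfl) ha (G.gl_gr D₃ hb hc) hA₀ hA₁
  refine key.trans ?_
  refine congrArg (· • G.comp _ h (chainOrder X.1 Y.1 Z.1 s t t' w ht) (chainDecor h a b c))
    ((prod_bool_lt fun y y' => ((p : ℤ) * (ωi y').list.length *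
      ∑ w : (N.inner y).Vert, (![i, j, l] : Fin 3 → ℤ) w.1).negOnePow).trans ?_)
  have hu : (∑ w : (N.inner (false : Bool)).Vert, (![i, j, l] : Fin 3 → ℤ) w.1) = i :=
    sum_eq_of_forall_eq (ι := (N.inner (false : Bool)).Vert) ⟨(0 : Fin 3), rfl⟩
      (nestRight_single X.1 Y.1 Z.1 s t t' w ht) _
  refine (congrArg (fun x => ((p : ℤ) * (ωi (true : Bool)).list.length * x).negOnePow) hu).trans ?_
  change ((p : ℤ) * ((1 : ℕ) : ℤ) * i).negOnePow = _
  rw [Nat.cast_one, mul_one]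

/-- Compositions along single edges are associative up to a sign. -/
theorem gl_assoc (hD : JoinAssoc D₁ D₂ D₃ D₄) {i j l : ℤ} {a : O.obj X} {b : O.obj Y}
    {c : O.obj Z} (ha : a ∈ O.gr X i) (hb : b ∈ O.gr Y j) (hc : c ∈ O.gr Z l) :
    G.gl D₄ a (G.gl D₃ b c) = ((p : ℤ) * (i + 1)).negOnePow • G.gl D₂ (G.gl D₁ a b) c := by
  have ht : t ≠ t' := by
    rintro rfl
    exact D₁.val_ne_inr f hD.left
  have h := chain_admissible ht D₃ D₄ hD.right D₁.joinable
  have h1 := G.gl_gl_left hD h ha hb hc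
  have h2 := G.gl_gl_right hD h ha hb hc
  -- The two contractions produce opposite orders of the two edges; exchanging them contributes the
  -- factor `(-1)^p`.
  have h3 := G.comp_swap _ h (chainOrder' X.1 Y.1 Z.1 s t t' w ht)
    (chainOrder X.1 Y.1 Z.1 s t t' w ht) [] [] _ _ rfl rfl (chainDecor h a b c)
  rw [h3, smul_smul, ← Int.negOnePow_add, ← h1, ← map_units_zsmul] at h2
  have h4 := congrArg (O.map (X := (chain X.1 Y.1 Z.1 s t t' w ht).total h)
    (chainResidue ht D₃ D₄ hD.right).symm) h2
  have h5 := fun x : O.obj W => O.map_symm_map (Y := (chain X.1 Y.1 Z.1 s t t' w ht).total h)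
    (chainResidue ht D₃ D₄ hD.right) x
  rw [mul_add, mul_one]
  exact (h5 _).symm.trans (h4.trans (h5 _))

end Gluing

/-! ### The bracket on the universal invariant: uniqueness and naturality -/

namespace AntiGluing

variable {k : Type v} [Field k] {T : OpType} {O O' : SMod.{u} k T} {V V' : Type u}
  [AddCommGroup V] [Module k V] [AddCommGroup V'] [Module k V'] (C : Colim O V) (E : AntiGluing O)
  (C' : Colim O' V') (E' : AntiGluing O')

/-- The bracket that sums over all compositions along a single edge. -/
def bracket : V →ₗ[k] V →ₗ[k] V := (E.exists_bracket C).choose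

theorem bracket_cl {X Y : T.Vertex} (a : O.obj X) (b : O.obj Y) :
    E.bracket C (C.cl X a) (C.cl Y b) = ∑ p : Pairs X Y, C.cl _ (E.glue p.join a b) :=
  ((E.exists_bracket C).choose_spec X Y a b).trans (E.total_apply C a b)

theorem eq_bracket {br : V →ₗ[k] V →ₗ[k] V}
    (h : ∀ X Y i j a b, a ∈ O.gr X i → b ∈ O.gr Y j →
      br (C.cl X a) (C.cl Y b) = ∑ p : Pairs X Y, C.cl _ (E.glue p.join a b)) :
    br = E.bracket C :=
  C.hom_ext₂ fun X Y i j a b ha hb => (h X Y i j a b ha hb).trans (E.bracket_cl C a b).symm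

theorem isLieBracket_bracket : IsLieBracket C.gr (E.bracket C) :=
  E.isLieBracket C fun _ _ _ _ a b _ _ => (E.bracket_cl C a b).trans (E.total_apply C a b).symm

/-- Both sides are bilinear, hence agree once they agree on classes of homogeneous elements; there
`F` can be moved through each one-edge term. -/
theorem bracket_natural (f : ∀ X, O.obj X →ₗ[k] O'.obj X) (F : V →ₗ[k] V')
    (hF : ∀ X a, F (C.cl X a) = C'.cl X (f X a))
    (hf : ∀ {X Y W : T.Vertex} {s : X.1.Flag} {t : Y.1.Flag} (D : Join X Y W s t) (i j : ℤ)
      (a : O.obj X) (b : O.obj Y), a ∈ O.gr X i → b ∈ O.gr Y j →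
      f W (E.glue D a b) = E'.glue D (f X a) (f Y b)) (x y : V) :
    F (E.bracket C x y) = E'.bracket C' (F x) (F y) := by
  have h : (E.bracket C).compr₂ F = (E'.bracket C').compl₁₂ F F := by
    refine C.hom_ext₂ fun X Y i j a b ha hb => ?_
    simp only [LinearMap.compr₂_apply, LinearMap.compl₁₂_apply, hF, bracket_cl, map_sum]
    exact Finset.sum_congr rfl fun p _ => congrArg _ (hf p.join i j a b ha hb)
  exact LinearMap.congr_fun₂ h x y

end AntiGluing

/-! ### Antisymmetric gluings from twisted structures -/

/-- Signs by which the compositions along single edges of a `𝔎^{⊗p}`-twisted structure have to be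
multiplied to become antisymmetric and associative of degree `0`, after a twist by `S` and a
shift by `δ`. -/
structure Weight {T : OpType} (p : ℕ) (S : SignRule T) (δ : T.Index → ℤ) where
  coef : ∀ {X Y W : T.Vertex} {s : X.1.Flag} {t : Y.1.Flag}, Join X Y W s t → ℤ → ℤˣ
  index_eq : ∀ {X Y W : T.Vertex} {s : X.1.Flag} {t : Y.1.Flag}, Join X Y W s t →
    δ (T.index W) = δ (T.index X) + δ (T.index Y) + p
  equivariant : ∀ {X Y W X' Y' W' : T.Vertex} {s : X.1.Flag} {t : Y.1.Flag}
    (φ : Corolla.Iso X.1 X'.1) (ψ : Corolla.Iso Y.1 Y'.1) (χ : Corolla.Iso W.1 W'.1)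
    (D : Join X Y W s t) (D' : Join X' Y' W' (φ.flag s) (ψ.flag t)),
    (∀ f, D'.val (χ.flag f) = Sum.map φ.flag ψ.flag (D.val f)) →
    ∀ i, S.sgn φ * S.sgn ψ * coef D' i = S.sgn χ * coef D i
  antisymm : ∀ {X Y W : T.Vertex} {s : X.1.Flag} {t : Y.1.Flag} (D : Join X Y W s t) (i j : ℤ),
    coef D i = -((((i + δ (T.index X)) * (j + δ (T.index Y)) + i * j).negOnePow) * coef D.symm j)
  assoc : ∀ {X Y Z U V W : T.Vertex} {s : X.1.Flag} {t t' : Y.1.Flag}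
    {w : Z.1.Flag} {f : U.1.Flag} {g : V.1.Flag} {D₁ : Join X Y U s t} {D₂ : Join U Z W f w}
    {D₃ : Join Y Z V t' w} {D₄ : Join X V W s g}, JoinAssoc D₁ D₂ D₃ D₄ → ∀ i j : ℤ,
    coef D₁ i * coef D₂ (i + j - p) = coef D₃ j * coef D₄ i * (p * (i + 1)).negOnePow

namespace Gluing

variable {k : Type v} [Field k] {T : OpType} {p : ℕ} {O O' : SMod.{u} k T} (G : Gluing p O)
  (G' : Gluing p O') {S : SignRule T} {δ : T.Index → ℤ} (K : Weight p S δ)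

/-- Composition along a single edge, multiplied by a sign depending on the degree. -/
def weighted {X Y W : T.Vertex} {s : X.1.Flag} {t : Y.1.Flag} (D : Join X Y W s t) :
    O.obj X →ₗ[k] O.obj Y →ₗ[k] O.obj W :=
  G.gl D ∘ₗ O.scale (fun i => ((K.coef D i : ℤ) : k)) X

theorem weighted_apply {X Y W : T.Vertex} {s : X.1.Flag} {t : Y.1.Flag} (D : Join X Y W s t)
    {i : ℤ} {a : O.obj X} (ha : a ∈ O.gr X i) (b : O.obj Y) :
    G.weighted K D a b = K.coef D i • G.gl D a b := by
  rw [weighted, LinearMap.comp_apply, O.scale_apply _ ha, Int.cast_smul_eq_zsmul, map_zsmul,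
    LinearMap.smul_apply, Units.smul_def]

theorem weighted_gr {X Y W : T.Vertex} {s : X.1.Flag} {t : Y.1.Flag} (D : Join X Y W s t) {i j : ℤ}
    {a : O.obj X} {b : O.obj Y} (ha : a ∈ O.gr X i) (hb : b ∈ O.gr Y j) :
    G.weighted K D a b ∈ O.gr W (i + j - p) := by
  rw [weighted_apply G K D ha]
  exact units_zsmul_mem _ _ (G.gl_gr D ha hb)

/-- The antisymmetric gluing on a twist of a twisted structure. -/
def antiGluing : AntiGluing (O.twist S δ) where
  glue D := G.weighted K D
  glue_gr {X Y W s t} D {i j a b} ha hb := by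
    have ha' : a ∈ O.gr X (i - δ (T.index X)) := ha
    have hb' : b ∈ O.gr Y (j - δ (T.index Y)) := hb
    have h := G.weighted_gr K D ha' hb'
    change _ ∈ O.gr W (i + j - δ (T.index W))
    -- The shift at `W` exceeds the sum of the shifts at `X` and `Y` by `p`, which compensates the
    -- degree `-p` of the composition.
    rwa [K.index_eq D, show i + j - (δ (T.index X) + δ (T.index Y) + p) =
      i - δ (T.index X) + (j - δ (T.index Y)) - p by ring]
  equivariant {X Y W X' Y' W' s t} φ ψ χ D D' h {i j a b} ha hb := by
    have ha' : a ∈ O.gr X (i - δ (T.index X)) := ha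
    have hb' : b ∈ O.gr Y (j - δ (T.index Y)) := hb
    rw [SMod.twist_map, SMod.twist_map, SMod.twist_map, map_units_zsmul_left, map_units_zsmul,
      G.weighted_apply K D' (O.map_gr φ _ _ ha'), G.weighted_apply K D ha',
      G.gl_equivariant φ ψ χ D D' h ha' hb', map_units_zsmul, smul_smul, smul_smul, smul_smul,
      K.equivariant φ ψ χ D D' h]
  antisymm {X Y W s t} D {i j a b} ha hb := by
    have ha' : a ∈ O.gr X (i - δ (T.index X)) := ha
    have hb' : b ∈ O.gr Y (j - δ (T.index Y)) := hb
    -- Two Koszul signs meet: the one demanded by the shifted degrees and the one that `gl_symm`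
    -- supplies for the original degrees. The antisymmetry of a weight contains both.
    rw [G.weighted_apply K D ha', G.weighted_apply K D.symm hb', G.gl_symm D ha' hb',
      K.antisymm D _ (j - δ (T.index Y)), smul_smul, smul_smul, sub_add_cancel, sub_add_cancel,
      Int.negOnePow_add, Units.neg_smul, mul_assoc, mul_assoc, mul_comm (K.coef D.symm _)]
  assoc {X Y Z U V W s t t' w f g D₁ D₂ D₃ D₄} hD {i j l a b c} ha hb hc := by
    have ha' : a ∈ O.gr X (i - δ (T.index X)) := ha
    have hb' : b ∈ O.gr Y (j - δ (T.index Y)) := hb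
    have hc' : c ∈ O.gr Z (l - δ (T.index Z)) := hc
    rw [G.weighted_apply K D₂ (G.weighted_gr K D₁ ha' hb'), G.weighted_apply K D₁ ha',
      G.weighted_apply K D₃ hb', G.weighted_apply K D₄ ha', map_units_zsmul_left,
      map_units_zsmul, smul_smul, smul_smul, G.gl_assoc hD ha' hb' hc', smul_smul,
      mul_comm (K.coef D₂ _), mul_comm (K.coef D₄ _), K.assoc hD]

theorem antiGluing_apply {X Y W : T.Vertex} {s : X.1.Flag} {t : Y.1.Flag} (D : Join X Y W s t)
    {i : ℤ} {a : O.obj X} (ha : a ∈ O.gr X i) (b : O.obj Y) :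
    (G.antiGluing K).glue D a b = K.coef D i • G.gl D a b := G.weighted_apply K D ha b

theorem IsHom.glue₂ {G : Gluing p O} {G' : Gluing p O'} {f : SMod.Hom O O'} (hf : G.IsHom G' f)
    {X Y : T.Vertex} (s : X.1.Flag) (t : Y.1.Flag) (h : T.Admissible (Graph.glue X.1 Y.1 s t))
    (a : O.obj X) (b : O.obj Y) :
    f.app _ (G.glue₂ s t h a b) = G'.glue₂ s t h (f.app _ a) (f.app _ b) := by
  rw [glue₂_eq, glue₂_eq, hf]
  congr 1
  funext w
  cases w
  · exact f.natural _ a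
  · exact f.natural _ b

theorem IsHom.gl {G : Gluing p O} {G' : Gluing p O'} {f : SMod.Hom O O'} (hf : G.IsHom G' f)
    {X Y W : T.Vertex} {s : X.1.Flag} {t : Y.1.Flag} (D : Join X Y W s t) (a : O.obj X)
    (b : O.obj Y) : f.app _ (G.gl D a b) = G'.gl D (f.app _ a) (f.app _ b) := by
  rw [gl_apply, gl_apply, ← hf.glue₂]
  exact f.natural _ _

variable {χ : ∀ i : T.Index, Corolla.Iso (T.std i).1 (T.std i).1 → ℤˣ}
  (hχ : ∀ i σ, χ i σ = S.sgn σ)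

/-- The bracket on the coinvariants of a twist of a twisted structure. -/
def bracket : O.CoinvBy χ →ₗ[k] O.CoinvBy χ →ₗ[k] O.CoinvBy χ :=
  (G.antiGluing K).bracket (O.twistColim δ hχ)

theorem bracket_twistCls {X Y : T.Vertex} {i : ℤ} {a : O.obj X} (ha : a ∈ O.gr X i) (b : O.obj Y) :
    G.bracket K hχ (O.twistCls S δ χ X a) (O.twistCls S δ χ Y b) =
      ∑ q : Pairs X Y, K.coef q.join i • O.twistCls S δ χ _ (G.gl q.join a b) := by
  refine ((G.antiGluing K).bracket_cl (O.twistColim δ hχ) a b).trans ?_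
  refine Finset.sum_congr rfl fun q _ => ?_
  rw [G.antiGluing_apply K q.join ha]
  exact map_units_zsmul _ _ _

theorem eq_bracket {br : O.CoinvBy χ →ₗ[k] O.CoinvBy χ →ₗ[k] O.CoinvBy χ}
    (h : ∀ (X Y : T.Vertex) (i j : ℤ) (a : O.obj X) (b : O.obj Y), a ∈ O.gr X i → b ∈ O.gr Y j →
      br (O.twistCls S δ χ X a) (O.twistCls S δ χ Y b) =
      ∑ q : Pairs X Y, K.coef q.join i • O.twistCls S δ χ _ (G.gl q.join a b)) :
    br = G.bracket K hχ :=
  (O.twistColim δ hχ).hom_ext₂ fun X Y _ _ a b ha hb =>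
    (h X Y _ _ a b ha hb).trans (G.bracket_twistCls K hχ ha b).symm

theorem isLieBracket_bracket : IsLieBracket (O.coinvByGr χ δ) (G.bracket K hχ) := by
  have h := (G.antiGluing K).isLieBracket_bracket (O.twistColim δ hχ)
  rwa [show (O.twistColim δ hχ).gr = O.coinvByGr χ δ from funext (O.coinvByGr_eq δ hχ)] at h

include hχ in
theorem coinv_twistCls (f : SMod.Hom O O') {X : T.Vertex} (a : O.obj X) :
    f.coinv χ (O.twistCls S δ χ X a) = O'.twistCls S δ χ X (f.app X a) := by
  have h1 := O.twistCls_eq δ hχ (Classical.choice X.1.exists_iso_std :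
    Corolla.Iso X.1 (T.std (T.index X)).1) a
  have h2 := O'.twistCls_eq δ hχ (Classical.choice X.1.exists_iso_std :
    Corolla.Iso X.1 (T.std (T.index X)).1) (f.app X a)
  rw [h1, h2, f.coinv_stdCls, map_units_zsmul, f.natural]

theorem bracket_natural {f : SMod.Hom O O'} (hf : G.IsHom G' f) (x y : O.CoinvBy χ) :
    f.coinv χ (G.bracket K hχ x y) = G'.bracket K hχ (f.coinv χ x) (f.coinv χ y) := by
  refine (G.antiGluing K).bracket_natural (O.twistColim δ hχ) (O'.twistColim δ hχ)
    (G'.antiGluing K) f.app (f.coinv χ) (fun X a => coinv_twistCls hχ f a) ?_ x y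
  intro X Y W s t D i j a b ha hb
  have ha' : a ∈ O.gr X (i - δ (T.index X)) := ha
  rw [G.antiGluing_apply K D ha', G'.antiGluing_apply K D (f.app_gr _ _ _ ha'), map_units_zsmul,
    hf.gl]

end Gluing

/-! ### Brackets of twisted structures -/

/-- Replaces sums over all pairs of flags by sums over the pairs that form an edge, the others
contributing zero. -/
theorem finsum_pairs {T : OpType} {V : Type*} [AddCommMonoid V] {X Y : T.Vertex}
    (F : X.1.Flag → Y.1.Flag → V)
    (h : ∀ s t, ¬ T.Joinable (X.1.out s) (Y.1.out t) → F s t = 0) :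
    ∑ᶠ (s : X.1.Flag) (t : Y.1.Flag), F s t = ∑ q : Pairs X Y, F q.1.1 q.1.2 := by
  classical
  let _ : Fintype X.1.Flag := Fintype.ofFinite _
  let _ : Fintype Y.1.Flag := Fintype.ofFinite _
  simp only [finsum_eq_sum_of_fintype]
  rw [← Fintype.sum_prod_type']
  refine ((Finset.sum_filter_of_ne (p := fun q : X.1.Flag × Y.1.Flag =>
    T.Joinable (X.1.out q.1) (Y.1.out q.2)) fun q _ hq => ?_).symm).trans ?_
  · by_contra hn
    exact hq (h _ _ hn)
  · exact Finset.sum_subtype _ (fun q => by simp) _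

theorem SMod.twistCls_trivial {k : Type v} [Field k] {T : OpType} (O : SMod.{u} k T)
    (δ : T.Index → ℤ) {X : T.Vertex} (a : O.obj X) :
    O.twistCls (SignRule.trivial T) δ (fun _ _ => 1) X a = O.cls a := by
  change O.stdCls (fun _ _ => 1) _ ((O.twist _ _).map _ a) = _
  rw [twist_map]
  change O.stdCls (fun _ _ => 1) _ ((1 : ℤˣ) • O.map _ a) = _
  rw [one_smul]
  rfl

/-- The signs of the odd bracket. -/
def oddWeight (T : OpType) : Weight 1 (SignRule.trivial T) (fun _ => -1) where
  coef _ i := i.negOnePow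
  index_eq _ := by norm_num
  equivariant _ _ _ _ _ _ _ := rfl
  antisymm _ i j := by
    -- With degrees `i - 1` and `j - 1` after the shift, `(i-1)(j-1) + ij + j + 1` has the parity of
    -- `i`.
    rw [← Int.negOnePow_add, ← Int.negOnePow_succ]
    exact negOnePow_congr ⟨i - i * j - 1, by ring⟩
  -- The exponents are `i + (i + j - 1)` and `j + i + (i + 1)`, the last summand being the defect in
  -- `gl_assoc`.
  assoc _ i j := by
    rw [← Int.negOnePow_add, ← Int.negOnePow_add, ← Int.negOnePow_add]
    exact negOnePow_congr ⟨-1, by push_cast; ring⟩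

/-- The signs of the commutator. -/
def commWeight {T : OpType} (hT : T.Directed) : Weight 0 (SignRule.trivial T) (fun _ => 0) where
  coef {X _ _ s _} _ _ := if X.1.out s then -1 else 1
  index_eq _ := by norm_num
  equivariant φ _ _ _ _ _ _ := by rw [φ.out_eq]; rfl
  antisymm {X Y W s t} D i j := by
    have h := D.joinable hT
    -- Without a shift the two Koszul signs cancel. The minus sign comes from the edge: exactly one
    -- of `s`, `t` is an output, and exchanging the factors exchanges the two cases.
    rw [show ((i + 0) * (j + 0) + i * j).negOnePow = 1 from Int.negOnePow_even _ ⟨i * j, by ring⟩]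
    cases hs : X.1.out s <;> cases ht : Y.1.out t <;> simp_all
  assoc {X Y Z U V W s t t' w f g D₁ D₂ D₃ D₄} hD i j := by
    -- The flag `f` is `t'` seen in the join, so each of the two edges has the same sign in both
    -- bracketings.
    have h : U.1.out f = Y.1.out t' := by rw [← D₁.out_val, hD.left]; rfl
    simp only [h, Nat.cast_zero, zero_mul, Int.negOnePow_zero, mul_one]
    exact mul_comm _ _

/-! ### The odd bracket and the commutator in terms of weights -/

namespace Gluing

section

variable {k : Type v} [Field k] {T : OpType} {p : ℕ} {O : SMod.{u} k T} (G : Gluing p O)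

theorem cls_gl {X Y W : T.Vertex} {s : X.1.Flag} {t : Y.1.Flag} (D : Join X Y W s t) (a : O.obj X)
    (b : O.obj Y) : O.cls (G.gl D a b) = O.cls (G.glue₂ s t D.admissible a b) := by
  rw [gl_apply]; exact O.cls_map _ _

theorem edgeTerm_eq {X Y : T.Vertex} (a : O.obj X) (b : O.obj Y) (q : Pairs X Y) :
    G.edgeTerm a b q.1.1 q.1.2 = O.cls (G.gl q.join a b) :=
  (dif_pos q.join.admissible).trans (G.cls_gl q.join a b).symm

theorem edgeTerm_eq_zero {X Y : T.Vertex} (a : O.obj X) (b : O.obj Y) {s : X.1.Flag} {t : Y.1.Flag}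
    (h : ¬ T.Joinable (X.1.out s) (Y.1.out t)) : G.edgeTerm a b s t = 0 :=
  dif_neg fun h' => h ((Graph.glue_admissible_iff X Y s t).1 h')

theorem finsum_edgeTerm {X Y : T.Vertex} (a : O.obj X) (b : O.obj Y) :
    ∑ᶠ (s : X.1.Flag) (t : Y.1.Flag), G.edgeTerm a b s t =
      ∑ q : Pairs X Y, O.cls (G.gl q.join a b) :=
  (finsum_pairs _ fun _ _ h => G.edgeTerm_eq_zero a b h).trans
    (Finset.sum_congr rfl fun q _ => G.edgeTerm_eq a b q)

end

section Odd

variable {k : Type v} [Field k] {T : OpType} {O : SMod.{u} k T} (G : Gluing 1 O)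

/-- Turning the defining property into an equation yields existence and uniqueness together. -/
theorem isOddBracket_iff {br : O.Coinv →ₗ[k] O.Coinv →ₗ[k] O.Coinv} :
    G.IsOddBracket br ↔ br = G.bracket (oddWeight T) fun _ _ => rfl := by
  have key : ∀ {X Y : T.Vertex} {i : ℤ} (a : O.obj X) (b : O.obj Y),
      i.negOnePow • ∑ᶠ (s : X.1.Flag) (t : Y.1.Flag), G.edgeTerm a b s t =
      ∑ q : Pairs X Y, (oddWeight T).coef q.join i •
        O.twistCls (SignRule.trivial T) (fun _ => -1) (fun _ _ => 1) _ (G.gl q.join a b) := by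
    intro X Y i a b
    rw [finsum_edgeTerm, Finset.smul_sum]
    refine Finset.sum_congr rfl fun q _ => ?_
    rw [O.twistCls_trivial]
    rfl
  constructor
  · intro h
    refine G.eq_bracket _ _ fun X Y i j a b ha _ => ?_
    rw [O.twistCls_trivial, O.twistCls_trivial, ← key]
    exact h X Y i a b ha
  · rintro rfl X Y i a b ha
    have h := G.bracket_twistCls (χ := fun _ _ => 1) (oddWeight T) (fun _ _ => rfl) ha b
    rw [O.twistCls_trivial, O.twistCls_trivial] at h
    rw [key]
    exact h

end Odd

section Commutator

variable {k : Type v} [Field k] {T : OpType} (hT : T.Directed) {O : SMod.{u} k T} (G : Gluing 0 O)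

include hT in
-- Among joinable pairs in a directed type, `t` is an output as soon as `s` is an input, so the
-- condition on `s` suffices.
theorem circ_eq {X Y : T.Vertex} (a : O.obj X) (b : O.obj Y) :
    G.circ a b = ∑ q : Pairs X Y, if X.1.out q.1.1 then 0 else O.cls (G.gl q.join a b) := by
  have h1 : G.circ a b = ∑ᶠ (s : X.1.Flag) (t : Y.1.Flag),
      if X.1.out s = false ∧ Y.1.out t = true then G.edgeTerm a b s t else 0 := by
    refine (finsum_subtype_eq_finsum_cond (p := fun s => X.1.out s = false)
      (f := fun s => ∑ᶠ t : {t : Y.1.Flag // Y.1.out t = true}, G.edgeTerm a b s t.1)).trans ?_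
    refine finsum_congr fun s => ?_
    rw [finsum_eq_if, finsum_subtype_eq_finsum_cond (p := fun t => Y.1.out t = true)
      (f := fun t => G.edgeTerm a b s t)]
    simp only [finsum_eq_if]
    split_ifs with h <;> simp [h]
  rw [h1, finsum_pairs _ fun s t h => by rw [G.edgeTerm_eq_zero a b h, ite_self]]
  refine Finset.sum_congr rfl fun q _ => ?_
  rw [edgeTerm_eq]
  have := q.2 hT
  cases hs : X.1.out q.1.1 <;> cases ht : Y.1.out q.1.2 <;> simp_all

/-- The terms of `b ∘ a` are the edges from an output of `a` to an input of `b`. Rewritten as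
gluings of `a` with `b` they carry the Koszul sign twice, and only the minus sign of the commutator
survives. -/
theorem isCommutator_iff {br : O.Coinv →ₗ[k] O.Coinv →ₗ[k] O.Coinv} :
    G.IsCommutator br ↔ br = G.bracket (commWeight hT) fun _ _ => rfl := by
  have key : ∀ {X Y : T.Vertex} {i j : ℤ} {a : O.obj X} {b : O.obj Y}, a ∈ O.gr X i →
      b ∈ O.gr Y j → G.circ a b - (i * j).negOnePow • G.circ b a =
      ∑ q : Pairs X Y, (commWeight hT).coef q.join i •
        O.twistCls (SignRule.trivial T) (fun _ => 0) (fun _ _ => 1) _ (G.gl q.join a b) := by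
    intro X Y i j a b ha hb
    rw [G.circ_eq hT, G.circ_eq hT, ← Equiv.sum_comp
      ((Equiv.prodComm _ _).subtypeEquiv fun p => ⟨fun h => h.symm, fun h => h.symm⟩ :
        Pairs X Y ≃ Pairs Y X), Finset.smul_sum, ← Finset.sum_sub_distrib]
    refine Finset.sum_congr rfl fun q _ => ?_
    -- The standard join of `Y` with `X` and `q.join.symm` have different result corollas, but the
    -- same class.
    have h1 : O.cls (G.gl (Join.std Y X q.1.2 q.1.1 q.2.symm) b a) =
        (i * j).negOnePow • O.cls (G.gl q.join a b) := by
      rw [cls_gl, ← G.cls_gl q.join.symm, G.gl_symm q.join ha hb]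
      rw [← O.twistCls_trivial 0, ← O.twistCls_trivial 0, map_units_zsmul]
    rw [O.twistCls_trivial]
    change (if X.1.out q.1.1 then 0 else O.cls (G.gl q.join a b)) - (i * j).negOnePow •
      (if Y.1.out q.1.2 then 0 else O.cls (G.gl (Join.std Y X q.1.2 q.1.1 q.2.symm) b a)) =
      (if X.1.out q.1.1 then (-1 : ℤˣ) else 1) • O.cls (G.gl q.join a b)
    have h2 := q.2 hT
    rw [h1, smul_ite, smul_smul, ← Int.negOnePow_add, Int.negOnePow_even _ ⟨i * j, rfl⟩]
    cases hs : X.1.out q.1.1 <;> cases ht : Y.1.out q.1.2 <;> simp_all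
  constructor
  · intro h
    refine G.eq_bracket _ _ fun X Y i j a b ha hb => ?_
    rw [O.twistCls_trivial, O.twistCls_trivial, ← key ha hb]
    exact h X Y i j a b ha hb
  · rintro rfl X Y i j a b ha hb
    have h := G.bracket_twistCls (χ := fun _ _ => 1) (commWeight hT) (fun _ _ => rfl) ha b
    rw [O.twistCls_trivial, O.twistCls_trivial] at h
    rw [key ha hb]
    exact h

end Commutator

end Gluing

/-! ### Anti-cyclic operads -/

namespace AntiCyclic

variable {k : Type v} [Field k] {O O' : SMod.{u} k OpType.cyclic} (G : AntiCyclic O)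
  (G' : AntiCyclic O')

def stdJoin (X Y : OpType.cyclic.Vertex) (s : X.1.Flag) (t : Y.1.Flag) :
    Join X Y (joinVertex X Y s t) s t := Join.std X Y s t (fun h => h.elim)

variable {X Y Z W X' Y' W' : OpType.cyclic.Vertex} {s : X.1.Flag} {t : Y.1.Flag}

def joinIso (D : Join X Y W s t) : Corolla.Iso (joinVertex X Y s t).1 W.1 :=
  Join.mapIso (Corolla.Iso.refl X.1) (Corolla.Iso.refl Y.1) (stdJoin X Y s t) D

theorem joinIso_spec (D : Join X Y W s t) (f : (joinVertex X Y s t).1.Flag) :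
    D.val ((joinIso D).flag f) = (stdJoin X Y s t).val f := by
  refine (Join.mapIso_spec (Corolla.Iso.refl X.1) (Corolla.Iso.refl Y.1) (stdJoin X Y s t) D
    f).trans ?_
  rcases f with f | f <;> rfl

/-- The gluing, with values in any corolla obtained by joining. -/
def gl (D : Join X Y W s t) : O.obj X →ₗ[k] O.obj Y →ₗ[k] O.obj W :=
  (G.glue X Y s t).compr₂ (O.map (joinIso D))

theorem gl_apply (D : Join X Y W s t) (a : O.obj X) (b : O.obj Y) :
    G.gl D a b = O.map (joinIso D) (G.glue X Y s t a b) := rfl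

theorem gl_equivariant (φ : Corolla.Iso X.1 X'.1) (ψ : Corolla.Iso Y.1 Y'.1)
    (χ : Corolla.Iso W.1 W'.1) (D : Join X Y W s t) (D' : Join X' Y' W' (φ.flag s) (ψ.flag t))
    (hχ : ∀ f, D'.val (χ.flag f) = Sum.map φ.flag ψ.flag (D.val f)) (a : O.obj X) (b : O.obj Y) :
    G.gl D' (O.map φ a) (O.map ψ b) = O.map χ (G.gl D a b) := by
  let D₀ := stdJoin X Y s t
  let D₀' := stdJoin X' Y' (φ.flag s) (ψ.flag t)
  rw [gl_apply, gl_apply, G.equivariant X X' Y Y' φ ψ s t (Join.mapIso φ ψ D₀ D₀')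
    (Join.mapIso_spec φ ψ D₀ D₀'), ← O.map_trans]
  refine (O.map_map _ _ _ (fun f => D'.injective ?_) _).symm
  refine (hχ _).trans ((congrArg _ (joinIso_spec D f)).trans ?_)
  refine Eq.trans ?_ (joinIso_spec D' _).symm
  exact (Join.mapIso_spec φ ψ D₀ D₀' f).symm

theorem gl_antisymm (D : Join X Y W s t) {i j : ℤ} {a : O.obj X} {b : O.obj Y}
    (ha : a ∈ O.gr X i) (hb : b ∈ O.gr Y j) :
    G.gl D a b = -((i * j).negOnePow • G.gl D.symm b a) := by
  let θ : Corolla.Iso (joinVertex Y X t s).1 (joinVertex X Y s t).1 :=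
    joinIso (stdJoin X Y s t).symm
  have hθ : ∀ f, (stdJoin X Y s t).val (θ.flag f) = ((stdJoin Y X t s).val f).swap := fun f => by
    rw [← joinIso_spec (stdJoin X Y s t).symm f, Join.symm_val, Sum.swap_swap]
  rw [gl_apply, G.antisymm X Y s t θ hθ i j a b ha hb, gl_apply, map_neg, map_units_zsmul]
  congr 2
  refine O.map_map _ _ _ (fun f => D.injective ?_) _
  refine (joinIso_spec D _).trans ((hθ f).trans ?_)
  rw [← joinIso_spec D.symm f, Join.symm_val, Sum.swap_swap]

/-- The associativity axiom is stated for standard joins; equivariance transports both double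
gluings from there to the given `W`. -/
theorem gl_assoc {U V : OpType.cyclic.Vertex} {t' : Y.1.Flag} {w : Z.1.Flag} {f : U.1.Flag}
    {g : V.1.Flag} {D₁ : Join X Y U s t} {D₂ : Join U Z W f w} {D₃ : Join Y Z V t' w}
    {D₄ : Join X V W s g} (hD : JoinAssoc D₁ D₂ D₃ D₄) (a : O.obj X) (b : O.obj Y) (c : O.obj Z) :
    G.gl D₂ (G.gl D₁ a b) c = G.gl D₄ a (G.gl D₃ b c) := by
  have ht : t' ≠ t := by
    rintro rfl
    exact D₁.val_ne_inr f hD.left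
  -- The embedding of flags is injective, so `f` is forced to be the image of `t'`; likewise `g` is
  -- the image of `t`.
  obtain rfl : f = (joinIso D₁).flag (Sum.inr ⟨t', ht⟩) := D₁.injective (by
    rw [hD.left]; exact (joinIso_spec D₁ (Sum.inr ⟨t', ht⟩)).symm)
  obtain rfl : g = (joinIso D₃).flag (Sum.inl ⟨t, ht.symm⟩) := D₃.injective (by
    rw [hD.right]; exact (joinIso_spec D₃ (Sum.inl ⟨t, ht.symm⟩)).symm)
  let E₂ := stdJoin (joinVertex X Y s t) Z (Sum.inr ⟨t', ht⟩) w
  let E₄ := stdJoin X (joinVertex Y Z t' w) s (Sum.inl ⟨t, ht.symm⟩)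
  let χ₂ := Join.mapIso (joinIso D₁) (Corolla.Iso.refl Z.1) E₂ D₂
  let χ₄ := Join.mapIso (Corolla.Iso.refl X.1) (joinIso D₃) E₄ D₄
  have h₂ : ∀ x, D₂.val (χ₂.flag x) = Sum.map (joinIso D₁).flag id (E₂.val x) :=
    Join.mapIso_spec (joinIso D₁) (Corolla.Iso.refl Z.1) E₂ D₂
  have h₄ : ∀ x, D₄.val (χ₄.flag x) = Sum.map id (joinIso D₃).flag (E₄.val x) :=
    Join.mapIso_spec (Corolla.Iso.refl X.1) (joinIso D₃) E₄ D₄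
  have e₂ := G.gl_equivariant (joinIso D₁) (Corolla.Iso.refl Z.1) χ₂ E₂ D₂ h₂ (G.glue X Y s t a b) c
  have e₄ := G.gl_equivariant (Corolla.Iso.refl X.1) (joinIso D₃) χ₄ E₄ D₄ h₄ a (G.glue Y Z t' w b c)
  have hE : ∀ {X Y : OpType.cyclic.Vertex} (s : X.1.Flag) (t : Y.1.Flag) (a : O.obj X)
      (b : O.obj Y), G.gl (stdJoin X Y s t) a b = G.glue X Y s t a b := by
    intro X Y s t a b
    rw [gl_apply, show joinIso (stdJoin X Y s t) = Corolla.Iso.refl _ from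
      Corolla.Iso.ext fun f => (stdJoin X Y s t).injective (joinIso_spec _ f)]
    exact O.map_refl _ _
  rw [O.map_refl] at e₂ e₄
  replace e₂ := e₂.trans (congrArg (O.map χ₂) (hE _ _ _ _))
  replace e₄ := e₄.trans (congrArg (O.map χ₄) (hE _ _ _ _))
  -- The two standard double joins are compared through `W`. The axiom applies because `hD.val_eq`
  -- makes this comparison compatible with the embeddings in `X ⊕ (Y ⊕ Z)`.
  have key := G.assoc X Y Z s t t' w ht (χ₂.trans χ₄.symm) (fun x => by
    have h5 := hD.val_eq (χ₂.flag x)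
    rw [h₂] at h5
    obtain ⟨y, hy⟩ := χ₄.flag.surjective (χ₂.flag x)
    have h6 : (χ₂.trans χ₄.symm).flag x = y := by
      rw [Corolla.Iso.trans_flag, ← hy]; exact χ₄.flag.symm_apply_apply y
    rw [← hy, h₄] at h5
    rw [h6]
    refine Eq.trans ?_ (h5.trans ?_)
    · change Sum.map id joinVal (E₄.val y) = _
      rcases E₄.val y with z | z
      · rfl
      · exact congrArg Sum.inr (joinIso_spec D₃ z).symm
    · change _ = Equiv.sumAssoc _ _ _ (Sum.map joinVal id (E₂.val x))
      rcases E₂.val x with z | z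
      · exact congrArg (fun r => Equiv.sumAssoc _ _ _ (Sum.inl r)) (joinIso_spec D₁ z)
      · rfl) a b c
  refine e₂.trans (Eq.trans ?_ e₄.symm)
  rw [← key]
  exact (O.map_map (X := joinVertex (joinVertex X Y s t) Z (Sum.inr ⟨t', ht⟩) w)
    (Y := joinVertex X (joinVertex Y Z t' w) s (Sum.inl ⟨t, ht.symm⟩)) (χ₂.trans χ₄.symm) χ₄ χ₂
    (fun f => χ₄.flag.apply_symm_apply _) _).symm

/-- Anti-cyclic operads have antisymmetric gluings. -/
def antiGluing : AntiGluing (O.shift 0) where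
  glue D := G.gl D
  glue_gr {X Y W s t} D {i j a b} ha hb := by
    have h := O.map_gr (joinIso D) _ _ (G.glue_gr X Y s t _ _ a b ha hb)
    change _ ∈ O.gr W (i + j - 0)
    rwa [show i + j - 0 = i - 0 + (j - 0) by ring]
  equivariant {X Y W X' Y' W' s t} φ ψ χ D D' h {i j a b} _ _ := by
    rw [SMod.shift_map, SMod.shift_map, SMod.shift_map]
    exact G.gl_equivariant φ ψ χ D D' h a b
  antisymm {X Y W s t} D {i j a b} ha hb := by
    have h := G.gl_antisymm D ha hb
    rwa [sub_zero, sub_zero] at h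
  assoc {X Y Z U V W s t t' w f g D₁ D₂ D₃ D₄} hD {i j l a b c} _ _ _ := G.gl_assoc hD a b c

def bracket : O.Coinv →ₗ[k] O.Coinv →ₗ[k] O.Coinv := G.antiGluing.bracket (O.shiftColim 0)

theorem finsum_cls_glue (a : O.obj X) (b : O.obj Y) :
    ∑ᶠ (s : X.1.Flag) (t : Y.1.Flag), O.cls (G.glue X Y s t a b) =
      ∑ q : Pairs X Y, O.cls (G.gl q.join a b) := by
  refine (finsum_pairs (T := .cyclic) _ fun _ _ h => (h fun h : False => h.elim).elim).trans ?_
  exact Finset.sum_congr rfl fun q _ => (O.cls_map _ _).symm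

theorem bracket_cls (a : O.obj X) (b : O.obj Y) :
    G.bracket (O.cls a) (O.cls b) = ∑ q : Pairs X Y, O.cls (G.gl q.join a b) := by
  have h := G.antiGluing.bracket_cl (O.shiftColim 0) a b
  rw [SMod.shiftColim_cl, SMod.shiftColim_cl] at h
  exact h.trans (Finset.sum_congr rfl fun q _ => O.shiftColim_cl 0 _)

theorem isBracket_iff {br : O.Coinv →ₗ[k] O.Coinv →ₗ[k] O.Coinv} :
    G.IsBracket br ↔ br = G.bracket := by
  constructor
  · intro h
    refine G.antiGluing.eq_bracket _ fun X Y i j a b _ _ => ?_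
    rw [SMod.shiftColim_cl, SMod.shiftColim_cl]
    refine (h X Y a b).trans ((G.finsum_cls_glue a b).trans ?_)
    exact Finset.sum_congr rfl fun q _ => (O.shiftColim_cl 0 _).symm
  · rintro rfl X Y a b
    rw [bracket_cls, finsum_cls_glue]

theorem isLieBracket_bracket : IsLieBracket (O.coinvGr 0) G.bracket := by
  rw [← O.shiftColim_gr]
  exact G.antiGluing.isLieBracket_bracket _

theorem bracket_natural {f : SMod.Hom O O'} (hf : G.IsHom G' f) (x y : O.Coinv) :
    f.coinv _ (G.bracket x y) = G'.bracket (f.coinv _ x) (f.coinv _ y) := by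
  refine G.antiGluing.bracket_natural (O.shiftColim 0) (O'.shiftColim 0) G'.antiGluing f.app
    (f.coinv _) (fun X a => ?_) (fun {X Y W s t} D i j a b _ _ => ?_) x y
  · rw [SMod.shiftColim_cl, f.coinv_cls, SMod.shiftColim_cl]
  · exact (f.natural _ _).trans (congrArg _ (hf X Y s t a b))

end AntiCyclic

/-! ### Alternating functions of lists -/

section Lists

variable {A B β : Type*}

/-- Adjacent transpositions generate all permutations. Invariance is required only on rearrangements
of `L`, because the signs below alternate only on lists without repetition or with a single glued
entry. -/
theorem eq_of_perm_of_swap {Q : List A → β} {L M : List A} (h : L.Perm M)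
    (hQ : ∀ l₁ x y l₂, (l₁ ++ x :: y :: l₂).Perm L →
      Q (l₁ ++ x :: y :: l₂) = Q (l₁ ++ y :: x :: l₂)) : Q L = Q M := by
  -- A fixed prefix is carried through the induction to cover permutations that keep the head.
  have key : ∀ {L M : List A}, L.Perm M → ∀ p : List A,
      (∀ l₁ x y l₂, (l₁ ++ x :: y :: l₂).Perm (p ++ L) →
        Q (l₁ ++ x :: y :: l₂) = Q (l₁ ++ y :: x :: l₂)) → Q (p ++ L) = Q (p ++ M) := by
    intro L M h
    induction h with
    | nil => intro p _; rfl
    | cons x _ ih =>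
      intro p hp
      have := ih (p ++ [x]) (by simpa using hp)
      simpa using this
    | swap x y l => intro p hp; exact hp p y x l (List.Perm.refl _)
    | trans h1 _ ih1 ih2 =>
      intro p hp
      exact (ih1 p hp).trans (ih2 p fun l₁ x y l₂ hl => hp l₁ x y l₂
        (hl.trans (h1.symm.append_left p)))
  exact key h [] hQ

/-- `F` changes sign when two consecutive entries of a list that is a permutation of `L` are
exchanged. -/
def Alternating (L : List A) (F : List A → ℤˣ) : Prop :=
  ∀ l₁ x y l₂, (l₁ ++ x :: y :: l₂).Perm L → F (l₁ ++ y :: x :: l₂) = -F (l₁ ++ x :: y :: l₂)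

theorem Alternating.perm {L M : List A} {F : List A → ℤˣ} (hF : Alternating L F)
    (h : L.Perm M) : Alternating M F :=
  fun l₁ x y l₂ hl => hF l₁ x y l₂ (hl.trans h.symm)

theorem Alternating.comp_map {L : List A} (f : A → B) {F : List B → ℤˣ}
    (hF : Alternating (L.map f) F) : Alternating L fun M => F (M.map f) := by
  intro l₁ x y l₂ h
  simpa using hF (l₁.map f) (f x) (f y) (l₂.map f) (by simpa using h.map f)

/-- The product of two alternating functions is symmetric. This is what makes the relative signs
below independent of the enumeration used to define them. -/
theorem Alternating.mul_eq {L M : List A} {F G : List A → ℤˣ} (hF : Alternating L F)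
    (hG : Alternating L G) (h : L.Perm M) : F L * G L = F M * G M :=
  eq_of_perm_of_swap (Q := fun N => F N * G N) h fun l₁ x y l₂ hl => by
    rw [hF l₁ x y l₂ hl, hG l₁ x y l₂ hl, neg_mul_neg]

theorem Alternating.move {F : List A → ℤˣ} (x : A) (l q : List A) : ∀ p : List A,
    Alternating (p ++ x :: (l ++ q)) F →
    F (p ++ l ++ x :: q) = (l.length : ℤ).negOnePow * F (p ++ x :: (l ++ q)) := by
  induction l with
  | nil => intro p _; simp
  | cons y l ih =>
    intro p hF
    have hp : (p ++ x :: (y :: l ++ q)).Perm ((p ++ [y]) ++ x :: (l ++ q)) := by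
      simpa using (List.Perm.swap y x (l ++ q)).append_left p
    have h1 := ih (p ++ [y]) (hF.perm hp)
    have h2 := hF p x y (l ++ q) (List.Perm.refl _)
    rw [show p ++ y :: l ++ x :: q = p ++ [y] ++ l ++ x :: q by simp, h1,
      show p ++ [y] ++ x :: (l ++ q) = p ++ y :: x :: (l ++ q) by simp, h2, List.length_cons,
      Nat.cast_succ, Int.negOnePow_succ, neg_mul_comm]
    rfl

/-- Exchanging two blocks moves each entry of `l` past all of `m`; this is the rule `L ∧ M =
(-1)^(|L||M|) M ∧ L`. -/
theorem Alternating.append_comm {F : List A → ℤˣ} (l m q : List A) : ∀ p : List A,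
    Alternating (p ++ (l ++ (m ++ q))) F →
    F (p ++ (m ++ (l ++ q))) = ((l.length : ℤ) * m.length).negOnePow * F (p ++ (l ++ (m ++ q))) := by
  induction l with
  | nil => intro p _; simp
  | cons x l ih =>
    intro p hF
    have h1 := ih (p ++ [x]) (by simpa using hF)
    have hp : (p ++ (x :: l ++ (m ++ q))).Perm (p ++ x :: (m ++ (l ++ q))) := by
      refine (List.Perm.cons x ?_).append_left p
      change (l ++ (m ++ q)).Perm _
      rw [← List.append_assoc, ← List.append_assoc]
      exact List.perm_append_comm.append_right q
    have h2 := Alternating.move x m (l ++ q) p (hF.perm hp)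
    rw [show p ++ (m ++ (x :: l ++ q)) = p ++ m ++ x :: (l ++ q) by simp, h2,
      show p ++ x :: (m ++ (l ++ q)) = p ++ [x] ++ (m ++ (l ++ q)) by simp, h1, ← mul_assoc,
      ← Int.negOnePow_add, List.length_cons, Nat.cast_succ, add_mul, one_mul, add_comm]
    simp

/-- The sign of the permutation that sorts a list of distinct numbers. -/
def listSign : List ℕ → ℤˣ
  | [] => 1
  | a :: l => ((l.countP (· < a) : ℕ) : ℤ).negOnePow * listSign l

/-- Exchanging two distinct neighbours changes the number of inversions by exactly one; inversions
with earlier entries depend only on the set of later ones. -/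
theorem listSign_alternating {L : List ℕ} (hL : L.Nodup) : Alternating L listSign := by
  intro l₁ x y l₂ h
  have hn : (l₁ ++ x :: y :: l₂).Nodup := h.nodup_iff.2 hL
  clear h
  induction l₁ with
  | nil =>
    have hxy : x ≠ y := by
      rintro rfl
      simp at hn
    simp only [List.nil_append, listSign, List.countP_cons]
    rcases lt_or_gt_of_ne hxy with h | h
    · simp only [h, decide_true, if_true, h.le.not_gt, decide_false, Bool.false_eq_true, if_false,
        add_zero, Nat.cast_succ, Int.negOnePow_succ, neg_mul]
      rw [mul_left_comm]
    · simp only [gt_iff_lt.1 h, decide_true, if_true, (le_of_lt h).not_gt, decide_false,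
        Bool.false_eq_true, if_false, add_zero, Nat.cast_succ, Int.negOnePow_succ, neg_mul, neg_neg]
      rw [mul_left_comm]
  | cons a l₁ ih =>
    have := ih (List.nodup_cons.1 hn).2
    simp only [List.cons_append, listSign, this, mul_neg]
    rw [List.Perm.countP_eq _ ((List.Perm.swap x y l₂).append_left l₁)]

theorem map_perm_self {L : List A} (hL : L.Nodup) (hm : ∀ a, a ∈ L) (σ : Equiv.Perm A) :
    (L.map σ).Perm L := by
  rw [List.perm_ext_iff_of_nodup (hL.map σ.injective) hL]
  exact fun a => ⟨fun _ => hm a, fun _ => List.mem_map.2 ⟨σ.symm a, hm _, σ.apply_symm_apply a⟩⟩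

/-- The product of `F` before and after relabelling does not depend on the order of the list, so `x`
and `y` may be brought to the front, where the swap is one of neighbours. -/
theorem Alternating.map_swap [DecidableEq A] {L : List A} (hL : L.Nodup) (hm : ∀ a, a ∈ L)
    {F : List A → ℤˣ} (hF : Alternating L F) {x y : A} (hxy : x ≠ y) :
    F (L.map (Equiv.swap x y)) = -F L := by
  have hp : L.Perm (x :: y :: (L.erase x).erase y) :=
    (List.perm_cons_erase (hm x)).trans ((List.perm_cons_erase
      ((List.mem_erase_of_ne hxy.symm).2 (hm y))).cons x)
  have h := hF.mul_eq ((hF.perm (map_perm_self hL hm (Equiv.swap x y)).symm).comp_map _) hp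
  have hn : (x :: y :: (L.erase x).erase y).Nodup := hp.nodup_iff.1 hL
  have h1 : (x :: y :: (L.erase x).erase y).map (Equiv.swap x y) =
      y :: x :: (L.erase x).erase y := by
    rw [List.map_cons, List.map_cons, Equiv.swap_apply_left, Equiv.swap_apply_right]
    congr 2
    refine (List.map_congr_left fun a ha => ?_).trans (List.map_id _)
    refine Equiv.swap_apply_of_ne_of_ne ?_ ?_
    · rintro rfl
      exact (List.nodup_cons.1 hn).1 (List.mem_cons_of_mem _ ha)
    · rintro rfl
      exact (List.nodup_cons.1 (List.nodup_cons.1 hn).2).1 ha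
  have h2 : F (y :: x :: (L.erase x).erase y) = -F (x :: y :: (L.erase x).erase y) :=
    hF [] x y _ hp.symm
  rw [h1, h2, mul_neg, Int.units_mul_self] at h
  rw [← one_mul (F (L.map _)), ← Int.units_mul_self (F L), mul_assoc, h, mul_neg, mul_one]

/-- The sign is generated by transpositions, each of which reverses `F`. This links the permutation
sign in the definition of the coinvariants with signs of enumerations. -/
theorem Alternating.sign_eq [Fintype A] [DecidableEq A] {L : List A} (hL : L.Nodup)
    (hm : ∀ a, a ∈ L) {F : List A → ℤˣ} (hF : Alternating L F) (σ : Equiv.Perm A) :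
    Equiv.Perm.sign σ = F L * F (L.map σ) := by
  induction σ using Equiv.Perm.swap_induction_on with
  | one => simp
  | swap_mul f x y hxy ih =>
    have h1 : L.map (Equiv.swap x y * f) = (L.map f).map (Equiv.swap x y) := by simp
    have hp := map_perm_self hL hm f
    rw [Equiv.Perm.sign_mul, Equiv.Perm.sign_swap hxy, ih, h1,
      Alternating.map_swap (hL.map f.injective) (fun a => hp.mem_iff.2 (hm a)) (hF.perm hp.symm)
        hxy, mul_neg, neg_one_mul]

/-! ### Contraction of an entry -/

/-- The contraction of an alternating function with an entry is alternating. -/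
theorem contract_swap (p : A → Bool) {F : List A → ℤˣ} {L : List A}
    (hF : Alternating (L.filter fun a => !p a) F) (hc : L.countP p = 1) :
    Alternating L fun M => (M.findIdx p : ℤ).negOnePow * F (M.filter fun a => !p a) := by
  intro l₁ x y l₂ hl
  have hc' : (l₁ ++ x :: y :: l₂).countP p = 1 := by rw [hl.countP_eq, hc]
  have hf := hl.filter fun a => !p a
  simp only [List.filter_append, List.filter_cons] at hf ⊢
  cases hx : p x <;> cases hy : p y
  · have h1 : (l₁ ++ y :: x :: l₂).findIdx p = (l₁ ++ x :: y :: l₂).findIdx p := by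
      simp [List.findIdx_append, List.findIdx_cons, hx, hy]
    simp only [hx, hy, Bool.not_false, if_true] at hf ⊢
    rw [h1, hF _ x y _ hf, mul_neg]
  -- If one of the two exchanged entries is the marked one, the filtered list does not change and
  -- the marked position moves by one; two marked entries are excluded by the count.
  all_goals
    simp only [List.countP_append, List.countP_cons, hx, hy, if_true, if_false,
      Bool.false_eq_true] at hc'
  · have h0 : ∀ a ∈ l₁, p a = false := by
      simpa using List.countP_eq_zero.1 (show l₁.countP p = 0 by omega)
    have h1 : l₁.findIdx p = l₁.length := List.findIdx_eq_length.2 h0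
    simp [List.findIdx_append, List.findIdx_cons, hx, hy, h1, add_comm (1 : ℤ), Int.negOnePow_succ]
  · have h0 : ∀ a ∈ l₁, p a = false := by
      simpa using List.countP_eq_zero.1 (show l₁.countP p = 0 by omega)
    have h1 : l₁.findIdx p = l₁.length := List.findIdx_eq_length.2 h0
    simp [List.findIdx_append, List.findIdx_cons, hx, hy, h1, add_comm (1 : ℤ), Int.negOnePow_succ]
  · omega

/-- The two contractions of entries anticommute. -/
theorem contract_comm (p q : A → Bool) (hpq : ∀ a, p a = true → q a = false) {L : List A}
    (hp : L.countP p = 1) (hq : L.countP q = 1) :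
    Even ((L.findIdx p : ℤ) + (L.filter fun a => !p a).findIdx q -
      (L.findIdx q + (L.filter fun a => !q a).findIdx p + 1)) := by
  induction L with
  | nil => simp at hp
  | cons a L ih =>
    rw [List.countP_cons] at hp hq
    -- If the head is marked by one predicate, removing it lowers the position of the other marked
    -- entry by one. This is where the contractions in the two orders differ in parity.
    cases hpa : p a <;> cases hqa : q a
    · simp only [hpa, hqa, Bool.false_eq_true, if_false, add_zero] at hp hq
      obtain ⟨c, hc⟩ := ih hp hq
      simp only [List.findIdx_cons, List.filter_cons, hpa, hqa, Bool.not_false, if_true, cond_false]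
      exact ⟨c, by push_cast; linarith⟩
    · simp only [hpa, hqa, Bool.false_eq_true, if_false, if_true, add_zero] at hp hq
      have h0 : ∀ b ∈ L, q b = false := by
        simpa using List.countP_eq_zero.1 (show L.countP q = 0 by omega)
      have h1 : L.filter (fun a => !q a) = L := List.filter_eq_self.2 (by simpa using h0)
      simp only [List.findIdx_cons, List.filter_cons, hpa, hqa, Bool.not_false, Bool.not_true,
        Bool.false_eq_true, if_true, if_false, cond_false, cond_true, h1]
      exact ⟨0, by push_cast; ring⟩
    · simp only [hpa, hqa, Bool.false_eq_true, if_false, if_true, add_zero] at hp hq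
      have h0 : ∀ b ∈ L, p b = false := by
        simpa using List.countP_eq_zero.1 (show L.countP p = 0 by omega)
      have h1 : L.filter (fun a => !p a) = L := List.filter_eq_self.2 (by simpa using h0)
      simp only [List.findIdx_cons, List.filter_cons, hpa, hqa, Bool.not_false, Bool.not_true,
        Bool.false_eq_true, if_true, if_false, cond_false, cond_true, h1]
      exact ⟨-1, by push_cast; ring⟩
    · exact absurd (hpq a hpa) (by simp [hqa])

end Lists

/-! ### The sign of an enumeration of the outputs -/

namespace Corolla

/-- The sign of a list of flags, relative to a chosen enumeration of all flags. -/
def rawSign (X : Corolla) (L : List X.Flag) : ℤˣ :=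
  listSign (L.map fun f => (Finite.equivFin X.Flag f : ℕ))

theorem rawSign_alternating (X : Corolla) {L : List X.Flag} (hL : L.Nodup) :
    Alternating L X.rawSign :=
  (listSign_alternating (hL.map (Fin.val_injective.comp (Equiv.injective _)))).comp_map _

end Corolla

namespace SMod.IsOutOrder

variable {X Y : Corolla} {L M : List X.Flag}

theorem perm (hL : IsOutOrder X L) (hM : IsOutOrder X M) : L.Perm M :=
  (List.perm_ext_iff_of_nodup hL.1 hM.1).2 fun f => (hL.2 f).trans (hM.2 f).symm

theorem map (hL : IsOutOrder X L) (φ : Corolla.Iso X Y) : IsOutOrder Y (L.map φ.flag) := by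
  refine ⟨hL.1.map φ.flag.injective, fun f => ?_⟩
  obtain ⟨f, rfl⟩ := φ.flag.surjective f
  rw [List.mem_map_of_injective φ.flag.injective, hL.2, φ.out_eq]

theorem length_eq (hL : IsOutOrder X L) : L.length = X.numOut := by
  classical
  rw [Corolla.numOut, Nat.subtype_card L.toFinset (fun f => by rw [List.mem_toFinset, hL.2]),
    List.toFinset_card_of_nodup hL.1]

theorem of_subtype {L : List {f : X.Flag // X.out f = true}} (hL : L.Nodup) (hm : ∀ f, f ∈ L) :
    IsOutOrder X (L.map Subtype.val) := by
  refine ⟨hL.map Subtype.val_injective, fun f => ?_⟩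
  rw [List.mem_map]
  exact ⟨fun ⟨g, _, hg⟩ => hg ▸ g.2, fun hf => ⟨⟨f, hf⟩, hm _, rfl⟩⟩

end SMod.IsOutOrder

theorem Corolla.exists_isOutOrder (X : Corolla) : ∃ L, SMod.IsOutOrder X L := by
  let _ : Fintype {f : X.Flag // X.out f = true} := Fintype.ofFinite _
  exact ⟨_, SMod.IsOutOrder.of_subtype (Finset.nodup_toList Finset.univ) (by simp)⟩

/-- The sign of an isomorphism on the outputs. -/
def Corolla.Iso.outSgn {X Y : Corolla} (φ : Corolla.Iso X Y) : ℤˣ :=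
  X.rawSign X.exists_isOutOrder.choose * Y.rawSign (X.exists_isOutOrder.choose.map φ.flag)

/-- Both factors alternate in the enumeration, so any enumeration computes the sign; functoriality
in `φ` follows by choosing matching ones. -/
theorem Corolla.Iso.outSgn_eq {X Y : Corolla} (φ : Corolla.Iso X Y) {L : List X.Flag}
    (hL : SMod.IsOutOrder X L) : φ.outSgn = X.rawSign L * Y.rawSign (L.map φ.flag) :=
  have h := X.exists_isOutOrder.choose_spec
  (X.rawSign_alternating h.1).mul_eq ((Y.rawSign_alternating (h.map φ).1).comp_map φ.flag)
    (h.perm hL)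

def outSignRule (T : OpType) : SignRule T where
  sgn φ := φ.outSgn
  sgn_refl X := by
    obtain ⟨L, hL⟩ := X.1.exists_isOutOrder
    rw [Corolla.Iso.outSgn_eq _ hL]
    change _ * X.1.rawSign (L.map id) = 1
    rw [List.map_id, Int.units_mul_self]
  sgn_trans {X Y Z} φ ψ := by
    obtain ⟨L, hL⟩ := X.1.exists_isOutOrder
    rw [φ.outSgn_eq hL, ψ.outSgn_eq (hL.map φ), (φ.trans ψ).outSgn_eq hL, List.map_map, mul_assoc,
      ← mul_assoc (Y.1.rawSign _), Int.units_mul_self, one_mul]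
    rfl

theorem outSign_eq_sgn {T : OpType} (i : T.Index) (σ : Corolla.Iso (T.std i).1 (T.std i).1) :
    outSign i σ = (outSignRule T).sgn σ := by
  unfold outSign
  let _ : Fintype {f : (T.std i).1.Flag // (T.std i).1.out f = true} := Fintype.ofFinite _
  let _ : DecidableEq {f : (T.std i).1.Flag // (T.std i).1.out f = true} := Classical.decEq _
  set L : List {f : (T.std i).1.Flag // (T.std i).1.out f = true} := Finset.univ.toList with hL
  have hn : L.Nodup := Finset.nodup_toList _
  have hm : ∀ f, f ∈ L := by simp [hL]
  have ho := SMod.IsOutOrder.of_subtype hn hm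
  refine (Alternating.sign_eq hn hm (((T.std i).1.rawSign_alternating ho.1).comp_map
    Subtype.val) _).trans ?_
  refine Eq.trans ?_ (σ.outSgn_eq ho).symm
  rw [List.map_map, List.map_map]
  rfl

/-- Every enumeration of the outputs becomes the standard one under an isomorphism to the standard
corolla. -/
theorem SMod.IsOutOrder.exists_iso_std {X : Corolla} {L : List X.Flag} (hL : SMod.IsOutOrder X L) :
    ∃ φ : Corolla.Iso X (Corolla.std X.genus X.numIn X.numOut),
      L.map φ.flag = (List.finRange X.numOut).map Sum.inr := by
  classical
  obtain ⟨c⟩ := X.exists_iso_std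
  -- An output goes to its position in `L`; the inputs are numbered by an arbitrary isomorphism.
  let F : X.Flag → Fin X.numIn ⊕ Fin X.numOut := fun f =>
    if h : X.out f = true then
      Sum.inr ⟨L.idxOf f, by rw [← hL.length_eq]; exact List.idxOf_lt_length_iff.2 ((hL.2 f).2 h)⟩
    else c.flag f
  have hF₁ : ∀ f (h : X.out f = true), F f = Sum.inr ⟨L.idxOf f, by
      rw [← hL.length_eq]; exact List.idxOf_lt_length_iff.2 ((hL.2 f).2 h)⟩ := fun f h => dif_pos h
  have hF₀ : ∀ f, ¬ X.out f = true → F f = c.flag f := fun f h => dif_neg h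
  have hF : ∀ f, (F f).isRight = X.out f := by
    intro f
    by_cases h : X.out f = true
    · exact (congrArg Sum.isRight (hF₁ f h)).trans h.symm
    · rw [hF₀ f h]; exact c.out_eq f
  have hinj : Function.Injective F := by
    intro f g hfg
    have ho : X.out f = X.out g := by rw [← hF, ← hF, hfg]
    by_cases h : X.out f = true
    · rw [hF₁ f h, hF₁ g (ho ▸ h)] at hfg
      exact (List.idxOf_inj ((hL.2 f).2 h)).1 (congrArg Fin.val (Sum.inr_injective hfg))
    · rw [hF₀ f h, hF₀ g (ho ▸ h)] at hfg
      exact c.flag.injective hfg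
  have hbij : Function.Bijective F := by
    have h1 : Function.Bijective (c.flag.symm ∘ F) :=
      Finite.injective_iff_bijective.1 (c.flag.symm.injective.comp hinj)
    refine ⟨hinj, fun y => ?_⟩
    obtain ⟨x, hx⟩ := h1.2 (c.flag.symm y)
    exact ⟨x, c.flag.symm.injective hx⟩
  refine ⟨⟨Equiv.ofBijective F hbij, hF, rfl⟩, ?_⟩
  have h0 : L.map F = (List.finRange X.numOut).map Sum.inr := by
    refine List.ext_getElem (by simp [hL.length_eq]) fun n h1 h2 => ?_
    have hn : n < L.length := by simpa using h1
    rw [List.getElem_map, List.getElem_map, hF₁ _ ((hL.2 _).1 (List.getElem_mem hn))]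
    exact congrArg Sum.inr (Fin.ext (by simpa using hL.1.idxOf_getElem n hn))
  exact h0

section OrderSign

variable {T : OpType}

/-- The sign of an enumeration of the outputs of the standard corolla. -/
def stdOrderSign (i : T.Index) : ℤˣ :=
  (T.std i).1.rawSign ((List.finRange i.1.2.2).map Sum.inr)

/-- The sign of a list of flags, normalized to be `1` for the standard enumeration of the outputs
of a standard corolla. -/
def orderSign (X : T.Vertex) (L : List X.1.Flag) : ℤˣ :=
  X.1.rawSign L * stdOrderSign (T.index X)

theorem orderSign_alternating {X : T.Vertex} {L : List X.1.Flag} (hL : L.Nodup) :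
    Alternating L (orderSign X) := fun l₁ x y l₂ h => by
  simp only [orderSign, X.1.rawSign_alternating hL l₁ x y l₂ h, neg_mul]

/-- Isomorphic corollas have the same index, so the normalizing factor occurs twice and cancels. -/
theorem sgn_eq_orderSign {X Y : T.Vertex} (φ : Corolla.Iso X.1 Y.1) {L : List X.1.Flag}
    (hL : SMod.IsOutOrder X.1 L) :
    (outSignRule T).sgn φ = orderSign X L * orderSign Y (L.map φ.flag) := by
  rw [orderSign, orderSign, index_eq_of_iso φ, mul_mul_mul_comm, Int.units_mul_self, mul_one]
  exact φ.outSgn_eq hL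

/-- Removes the choices from `outCls`: the isomorphism taking `L` to the standard enumeration has
sign `orderSign X L`, so the class is a signed universal class, alternating in `L`. -/
theorem outCls_eq {k : Type v} [Field k] (O : SMod.{u} k T) (δ : T.Index → ℤ) {X : T.Vertex}
    {L : List X.1.Flag} (hL : SMod.IsOutOrder X.1 L) (a : O.obj X) :
    O.outCls L a = orderSign X L • O.twistCls (outSignRule T) δ outSign X a := by
  have h : ∃ φ : Corolla.Iso X.1 (T.std (T.index X)).1,
      L.map φ.flag = (List.finRange X.1.numOut).map Sum.inr := hL.exists_iso_std
  have h1 : O.outCls L a = O.stdCls outSign (T.index X) (O.map h.choose a) := dif_pos h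
  rw [h1, O.twistCls_eq δ outSign_eq_sgn h.choose, map_units_zsmul, smul_smul]
  have h2 : (outSignRule T).sgn h.choose = orderSign X L := by
    refine (h.choose.outSgn_eq hL).trans ?_
    rw [h.choose_spec]
    rfl
  rw [h2, Int.units_mul_self, one_smul]

end OrderSign

/-! ### The signs of the bracket of the output suspension -/

section Lists

variable {A B : Type*}

theorem Alternating.comp_filterMap {L : List A} (g : A → Option B) (hg : ∀ a ∈ L, (g a).isSome)
    {F : List B → ℤˣ} (hF : Alternating (L.filterMap g) F) :
    Alternating L fun M => F (M.filterMap g) := by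
  intro l₁ x y l₂ h
  obtain ⟨x', hx⟩ := Option.isSome_iff_exists.1 (hg x (h.mem_iff.1 (by simp)))
  obtain ⟨y', hy⟩ := Option.isSome_iff_exists.1 (hg y (h.mem_iff.1 (by simp)))
  simpa [hx, hy] using hF (l₁.filterMap g) x' y' (l₂.filterMap g) (by
    simpa [hx, hy] using h.filterMap g)

theorem map_filterMap_partialInv {v : B → A} (hv : Function.Injective v) {L : List A}
    (hL : ∀ a ∈ L, a ∈ Set.range v) : (L.filterMap (Function.partialInv v)).map v = L := by
  induction L with
  | nil => rfl
  | cons a L ih =>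
    obtain ⟨b, rfl⟩ := hL a (by simp)
    rw [List.filterMap_cons_some (Function.partialInv_left hv b), List.map_cons,
      ih fun a ha => hL a (List.mem_cons_of_mem _ ha)]

/-- The flags of `L`, followed by those of `M`. -/
def joinList (L : List A) (M : List B) : List (A ⊕ B) := L.map Sum.inl ++ M.map Sum.inr

theorem Alternating.joinList_left {L : List A} {M : List B} {F : List (A ⊕ B) → ℤˣ}
    (hF : Alternating (joinList L M) F) : Alternating L fun L' => F (joinList L' M) := by
  intro l₁ x y l₂ h
  simpa [joinList] using hF (l₁.map Sum.inl) (Sum.inl x) (Sum.inl y)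
    (l₂.map Sum.inl ++ M.map Sum.inr) (by
      simpa [joinList] using (h.map Sum.inl).append_right (M.map Sum.inr))

theorem Alternating.joinList_right {L : List A} {M : List B} {F : List (A ⊕ B) → ℤˣ}
    (hF : Alternating (joinList L M) F) : Alternating M fun M' => F (joinList L M') := by
  intro l₁ x y l₂ h
  have := hF (L.map Sum.inl ++ l₁.map Sum.inr) (Sum.inr x) (Sum.inr y) (l₂.map Sum.inr) (by
    simpa [joinList] using (h.map Sum.inr).append_left (L.map Sum.inl))
  rw [List.append_assoc, List.append_assoc] at this
  simpa [joinList] using this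

end Lists

namespace Join

variable {T : OpType} {X Y Z U V W X' Y' W' : T.Vertex} {s : X.1.Flag} {t : Y.1.Flag}

open Classical in
/-- The two flags that form the edge. -/
def glued (_ : Join X Y W s t) (f : X.1.Flag ⊕ Y.1.Flag) : Bool :=
  decide (f = Sum.inl s ∨ f = Sum.inr t)

theorem glued_iff (D : Join X Y W s t) (f : X.1.Flag ⊕ Y.1.Flag) :
    D.glued f = true ↔ f = Sum.inl s ∨ f = Sum.inr t := by
  simp [glued]

theorem glued_eq_false_iff (D : Join X Y W s t) (f : X.1.Flag ⊕ Y.1.Flag) :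
    D.glued f = false ↔ f ∈ Set.range D.val := by
  rw [D.mem_range, ← not_or, ← D.glued_iff, Bool.not_eq_true]

/-- The flags of the result, in the order of the list. -/
def rest (D : Join X Y W s t) (R : List (X.1.Flag ⊕ Y.1.Flag)) : List W.1.Flag :=
  (R.filter fun f => !D.glued f).filterMap (Function.partialInv D.val)

theorem mem_range_of_mem_filter (D : Join X Y W s t) {R : List (X.1.Flag ⊕ Y.1.Flag)}
    {f : X.1.Flag ⊕ Y.1.Flag} (hf : f ∈ R.filter fun f => !D.glued f) : f ∈ Set.range D.val := by
  rw [← D.glued_eq_false_iff]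
  simpa using (List.mem_filter.1 hf).2

theorem map_rest (D : Join X Y W s t) (R : List (X.1.Flag ⊕ Y.1.Flag)) :
    (D.rest R).map D.val = R.filter fun f => !D.glued f :=
  map_filterMap_partialInv D.injective fun _ hf => D.mem_range_of_mem_filter hf

theorem eq_rest (D : Join X Y W s t) {R : List (X.1.Flag ⊕ Y.1.Flag)} {P : List W.1.Flag}
    (h : P.map D.val = R.filter fun f => !D.glued f) : P = D.rest R :=
  List.map_injective_iff.2 D.injective (h.trans (D.map_rest R).symm)

/-- The sign of the contraction of the glued output out of a list of outputs. -/
def contractSign (D : Join X Y W s t) (R : List (X.1.Flag ⊕ Y.1.Flag)) : ℤˣ :=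
  (R.findIdx D.glued : ℤ).negOnePow * orderSign W (D.rest R)

section

variable (hT : T.Directed) (D : Join X Y W s t) {L : List X.1.Flag} {M : List Y.1.Flag}
  (hL : SMod.IsOutOrder X.1 L) (hM : SMod.IsOutOrder Y.1 M)

include hL hM

theorem mem_joinList (f : X.1.Flag ⊕ Y.1.Flag) :
    f ∈ joinList L M ↔ Sum.elim X.1.out Y.1.out f = true := by
  rcases f with f | f <;> simp [joinList, hL.2, hM.2]

theorem nodup_joinList : (joinList L M).Nodup := by
  refine List.Nodup.append (hL.1.map Sum.inl_injective) (hM.1.map Sum.inr_injective) ?_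
  intro f h1 h2
  obtain ⟨x, _, rfl⟩ := List.mem_map.1 h1
  obtain ⟨y, _, h⟩ := List.mem_map.1 h2
  cases h

include hT in
-- In a directed type exactly one of `s` and `t` is an output, and only that one is listed.
theorem countP_glued : (joinList L M).countP D.glued = 1 := by
  have hn := nodup_joinList hL hM
  have hmem := mem_joinList hL hM
  have key : ∀ o, (∀ f, D.glued f = true ∧ Sum.elim X.1.out Y.1.out f = true ↔ f = o) →
      (joinList L M).countP D.glued = 1 := by
    intro o ho
    rw [List.countP_eq_length_filter]
    refine List.Perm.length_eq (l₂ := [o]) ?_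
    rw [List.perm_ext_iff_of_nodup (hn.filter _) (List.nodup_singleton o)]
    intro f
    rw [List.mem_filter, hmem, List.mem_singleton, ← ho f, and_comm]
  have h := D.joinable hT
  cases hs : X.1.out s
  · have ht : Y.1.out t = true := by
      rw [hs] at h
      simpa using h.symm
    refine key (Sum.inr t) fun f => ⟨?_, ?_⟩
    · rintro ⟨h1, h2⟩
      rcases (D.glued_iff f).1 h1 with rfl | rfl
      · exact absurd (hs.symm.trans h2) (by simp)
      · rfl
    · rintro rfl
      exact ⟨(D.glued_iff _).2 (Or.inr rfl), ht⟩
  · refine key (Sum.inl s) fun f => ⟨?_, ?_⟩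
    · rintro ⟨h1, h2⟩
      rcases (D.glued_iff f).1 h1 with rfl | rfl
      · rfl
      · exact absurd (hs.trans h2.symm) h
    · rintro rfl
      exact ⟨(D.glued_iff _).2 (Or.inl rfl), hs⟩

theorem isOutOrder_rest : SMod.IsOutOrder W.1 (D.rest (joinList L M)) := by
  constructor
  · refine List.Nodup.of_map D.val ?_
    rw [D.map_rest]
    exact (nodup_joinList hL hM).filter _
  · intro f
    rw [← List.mem_map_of_injective D.injective, D.map_rest, List.mem_filter, mem_joinList hL hM,
      D.out_val, (D.glued_eq_false_iff _).2 ⟨f, rfl⟩]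
    simp

include hT in
theorem contractSign_alternating : Alternating (joinList L M) D.contractSign :=
  contract_swap D.glued (F := fun N => orderSign W (N.filterMap (Function.partialInv D.val)))
    (Alternating.comp_filterMap _ (fun f hf => by
      obtain ⟨g, rfl⟩ := D.mem_range_of_mem_filter hf
      rw [Function.partialInv_left D.injective]; rfl)
      (orderSign_alternating (D.isOutOrder_rest hL hM).1)) (D.countP_glued hT hL hM)

end

/-- The sign by which the composition along an edge changes the chosen orientations of the
outputs. -/
def sign (D : Join X Y W s t) : ℤˣ :=
  orderSign X X.1.exists_isOutOrder.choose * orderSign Y Y.1.exists_isOutOrder.choose *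
    D.contractSign (joinList X.1.exists_isOutOrder.choose Y.1.exists_isOutOrder.choose)

/-- The contraction sign alternates in `L` and in `M`, as the normalizing factors do, so the two
chosen enumerations can be replaced one after the other. -/
theorem sign_eq (hT : T.Directed) (D : Join X Y W s t) {L : List X.1.Flag} {M : List Y.1.Flag}
    (hL : SMod.IsOutOrder X.1 L) (hM : SMod.IsOutOrder Y.1 M) :
    D.sign = orderSign X L * orderSign Y M * D.contractSign (joinList L M) := by
  have hL' := X.1.exists_isOutOrder.choose_spec
  have hM' := Y.1.exists_isOutOrder.choose_spec
  have h1 := (orderSign_alternating (X := X) hL'.1).mul_eq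
    (D.contractSign_alternating hT hL' hM').joinList_left (hL'.perm hL)
  have h2 := (orderSign_alternating (X := Y) hM'.1).mul_eq
    (D.contractSign_alternating hT hL hM').joinList_right (hM'.perm hM)
  rw [sign, mul_right_comm, h1, mul_right_comm, mul_assoc, h2, ← mul_assoc]

theorem numOut_add_one (hT : T.Directed) (D : Join X Y W s t) :
    W.1.numOut + 1 = X.1.numOut + Y.1.numOut := by
  obtain ⟨L, hL⟩ := X.1.exists_isOutOrder
  obtain ⟨M, hM⟩ := Y.1.exists_isOutOrder
  have h1 := congrArg List.length (D.map_rest (joinList L M))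
  rw [List.length_map, (D.isOutOrder_rest hL hM).length_eq] at h1
  have h2 := List.length_eq_countP_add_countP D.glued (l := joinList L M)
  rw [D.countP_glued hT hL hM] at h2
  have h3 : (joinList L M).length = X.1.numOut + Y.1.numOut := by
    simp [joinList, hL.length_eq, hM.length_eq]
  rw [← h3, h2, h1, List.countP_eq_length_filter, add_comm]
  simp

theorem sign_equivariant (hT : T.Directed) (φ : Corolla.Iso X.1 X'.1) (ψ : Corolla.Iso Y.1 Y'.1)
    (χ : Corolla.Iso W.1 W'.1) (D : Join X Y W s t) (D' : Join X' Y' W' (φ.flag s) (ψ.flag t))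
    (h : ∀ f, D'.val (χ.flag f) = Sum.map φ.flag ψ.flag (D.val f)) :
    (outSignRule T).sgn φ * (outSignRule T).sgn ψ * D'.sign = (outSignRule T).sgn χ * D.sign := by
  obtain ⟨L, hL⟩ := X.1.exists_isOutOrder
  obtain ⟨M, hM⟩ := Y.1.exists_isOutOrder
  have hg : D'.glued ∘ Sum.map φ.flag ψ.flag = D.glued := by
    funext f
    rw [Bool.eq_iff_iff, Function.comp_apply, D'.glued_iff, D.glued_iff]
    rcases f with f | f <;> simp
  have hj : joinList (L.map φ.flag) (M.map ψ.flag) =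
      (joinList L M).map (Sum.map φ.flag ψ.flag) := by
    simp only [joinList, List.map_append, List.map_map]
    rfl
  have hr : (D.rest (joinList L M)).map χ.flag =
      D'.rest (joinList (L.map φ.flag) (M.map ψ.flag)) := by
    refine D'.eq_rest ?_
    rw [hj, List.filter_map, ← show (fun f => !D.glued f) =
      (fun f => !D'.glued f) ∘ Sum.map φ.flag ψ.flag by rw [← hg]; rfl, ← D.map_rest, List.map_map,
      List.map_map]
    exact List.map_congr_left fun f _ => h f
  have hi : (joinList (L.map φ.flag) (M.map ψ.flag)).findIdx D'.glued =
      (joinList L M).findIdx D.glued := by rw [hj, List.findIdx_map, hg]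
  rw [D.sign_eq hT hL hM, D'.sign_eq hT (hL.map φ) (hM.map ψ), sgn_eq_orderSign φ hL,
    sgn_eq_orderSign ψ hM, sgn_eq_orderSign χ (D.isOutOrder_rest hL hM), contractSign, contractSign,
    hi, hr]
  have aux : ∀ a b c d e f g : ℤˣ, a * b * (c * d) * (b * d * (e * f)) = g * f * (a * c * (e * g)) := by
    intro a b c d e f g
    calc a * b * (c * d) * (b * d * (e * f)) = a * c * e * f * (b * b) * (d * d) := by ac_rfl
      _ = a * c * e * f * (g * g) := by simp only [Int.units_mul_self, mul_one]
      _ = _ := by ac_rfl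
  exact aux _ _ _ _ _ _ _

/-- The contraction itself does not distinguish the two factors; the sign is that of interchanging
the blocks `L` and `M`. -/
theorem sign_symm (hT : T.Directed) (D : Join X Y W s t) :
    D.symm.sign = ((X.1.numOut : ℤ) * Y.1.numOut).negOnePow * D.sign := by
  obtain ⟨L, hL⟩ := X.1.exists_isOutOrder
  obtain ⟨M, hM⟩ := Y.1.exists_isOutOrder
  have hg : D.symm.glued ∘ Sum.swap = D.glued := by
    funext f
    rw [Bool.eq_iff_iff, Function.comp_apply, D.symm.glued_iff, D.glued_iff]
    rcases f with f | f <;> simp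
  have h1 : ∀ R, D.symm.contractSign (R.map Sum.swap) = D.contractSign R := by
    intro R
    have hr : D.rest R = D.symm.rest (R.map Sum.swap) := by
      refine D.symm.eq_rest ?_
      rw [List.filter_map, ← show (fun f => !D.glued f) = (fun f => !D.symm.glued f) ∘ Sum.swap by
        rw [← hg]; rfl, ← D.map_rest, List.map_map]
      rfl
    rw [contractSign, contractSign, ← hr, List.findIdx_map, hg]
  have h2 : joinList M L = (M.map Sum.inr ++ L.map Sum.inl : List (X.1.Flag ⊕ Y.1.Flag)).map
      Sum.swap := by
    simp [joinList, Function.comp_def]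
  have h3 := Alternating.append_comm (L.map Sum.inl) (M.map Sum.inr) [] [] (by
    simpa [joinList] using D.contractSign_alternating hT hL hM)
  simp only [List.nil_append, List.append_nil, List.length_map, hL.length_eq, hM.length_eq] at h3
  rw [D.symm.sign_eq hT hM hL, h2, h1, h3, D.sign_eq hT hL hM, mul_comm (orderSign Y M),
    mul_left_comm]
  rfl

/-- Both sides contract the two glued outputs out of `L ∧ M ∧ N`, in opposite orders.
Anticommutation of the contractions gives one minus sign; contracting inside `M ∧ N`, instead of
inside the whole product, gives `(-1)^|L|`. -/
theorem sign_assoc (hT : T.Directed) {t' : Y.1.Flag} {w : Z.1.Flag} {f : U.1.Flag} {g : V.1.Flag}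
    {D₁ : Join X Y U s t} {D₂ : Join U Z W f w} {D₃ : Join Y Z V t' w} {D₄ : Join X V W s g}
    (hD : JoinAssoc D₁ D₂ D₃ D₄) :
    D₁.sign * D₂.sign = ((X.1.numOut : ℤ) + 1).negOnePow * (D₃.sign * D₄.sign) := by
  classical
  obtain ⟨L, hL⟩ := X.1.exists_isOutOrder
  obtain ⟨M, hM⟩ := Y.1.exists_isOutOrder
  obtain ⟨N, hN⟩ := Z.1.exists_isOutOrder
  have hP := D₁.isOutOrder_rest hL hM
  have hQ := D₃.isOutOrder_rest hM hN
  have ht : t ≠ t' := by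
    rintro rfl
    exact D₁.val_ne_inr f hD.left
  let R : List (X.1.Flag ⊕ (Y.1.Flag ⊕ Z.1.Flag)) := joinList L (joinList M N)
  let p₁ : X.1.Flag ⊕ (Y.1.Flag ⊕ Z.1.Flag) → Bool := fun a =>
    decide (a = Sum.inl s ∨ a = Sum.inr (Sum.inl t))
  let p₂ : X.1.Flag ⊕ (Y.1.Flag ⊕ Z.1.Flag) → Bool := fun a =>
    decide (a = Sum.inr (Sum.inl t') ∨ a = Sum.inr (Sum.inr w))
  let i₁ : X.1.Flag ⊕ Y.1.Flag → X.1.Flag ⊕ (Y.1.Flag ⊕ Z.1.Flag) := Sum.map id Sum.inl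
  let i₂ : U.1.Flag ⊕ Z.1.Flag → X.1.Flag ⊕ (Y.1.Flag ⊕ Z.1.Flag) := fun a =>
    Equiv.sumAssoc _ _ _ (Sum.map D₁.val id a)
  let i₄ : X.1.Flag ⊕ V.1.Flag → X.1.Flag ⊕ (Y.1.Flag ⊕ Z.1.Flag) := Sum.map id D₃.val
  have hR : R = (joinList L M).map i₁ ++ N.map (Sum.inr ∘ Sum.inr) := by
    simp [R, joinList, i₁, Function.comp_def]
  have hg₁ : p₁ ∘ i₁ = D₁.glued := by
    funext a
    rw [Bool.eq_iff_iff, Function.comp_apply, D₁.glued_iff]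
    rcases a with a | a <;> simp [p₁, i₁]
  have hg₃ : p₂ ∘ Sum.inr = D₃.glued := by
    funext a
    rw [Bool.eq_iff_iff, Function.comp_apply, D₃.glued_iff]
    simp [p₂]
  have hi₁ : ∀ a, i₂ (Sum.inl a) = i₁ (D₁.val a) := by
    intro a
    change Equiv.sumAssoc _ _ _ (Sum.inl (D₁.val a)) = _
    rcases D₁.val a with x | x <;> rfl
  have hi₂ : Function.Injective i₂ := (Equiv.injective _).comp
    (Sum.map_injective.2 ⟨D₁.injective, Function.injective_id⟩)
  have hi₄ : Function.Injective i₄ := Sum.map_injective.2 ⟨Function.injective_id, D₃.injective⟩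
  have hg₂ : p₂ ∘ i₂ = D₂.glued := by
    funext a
    rw [Bool.eq_iff_iff, Function.comp_apply, D₂.glued_iff, ← hi₂.eq_iff (b := Sum.inl f), hi₁,
      hD.left, ← hi₂.eq_iff (b := Sum.inr w)]
    exact decide_eq_true_iff
  have hg₄ : p₁ ∘ i₄ = D₄.glued := by
    funext a
    rw [Bool.eq_iff_iff, Function.comp_apply, D₄.glued_iff, ← hi₄.eq_iff (b := Sum.inr g),
      ← hi₄.eq_iff (b := Sum.inl s), show i₄ (Sum.inr g) = Sum.inr (D₃.val g) from rfl, hD.right]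
    exact decide_eq_true_iff
  have hN₁ : ∀ a ∈ N.map (Sum.inr ∘ Sum.inr : Z.1.Flag → X.1.Flag ⊕ (Y.1.Flag ⊕ Z.1.Flag)),
      p₁ a = false := by simp [p₁]
  have hL₂ : ∀ a ∈ L.map (Sum.inl : X.1.Flag → X.1.Flag ⊕ (Y.1.Flag ⊕ Z.1.Flag)),
      p₂ a = false := by simp [p₂]
  have hc₁ : R.countP p₁ = 1 := by
    rw [hR, List.countP_append, List.countP_map, hg₁, D₁.countP_glued hT hL hM,
      List.countP_eq_zero.2 (by simpa using hN₁)]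
  have hc₂ : R.countP p₂ = 1 := by
    rw [show R = L.map Sum.inl ++ (joinList M N).map Sum.inr from rfl, List.countP_append,
      List.countP_map (f := Sum.inr), hg₃, D₃.countP_glued hT hM hN,
      List.countP_eq_zero.2 (by simpa using hL₂)]
  have hf₁ : R.findIdx p₁ = (joinList L M).findIdx D₁.glued := by
    have h1 : (joinList L M).findIdx D₁.glued < (joinList L M).length := by
      rw [List.findIdx_lt_length]
      exact List.countP_pos_iff.1 (by rw [D₁.countP_glued hT hL hM]; exact one_pos)
    rw [hR, List.findIdx_append, List.findIdx_map, hg₁, List.length_map, if_pos h1]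
  -- `M ∧ N` stands behind `L`, whereas `L ∧ M` above is an initial segment containing its glued
  -- output; hence a shift occurs only here.
  have hf₃ : R.findIdx p₂ = L.length + (joinList M N).findIdx D₃.glued := by
    rw [show R = L.map Sum.inl ++ (joinList M N).map Sum.inr from rfl, List.findIdx_append,
      List.findIdx_eq_length.2 hL₂, if_neg (lt_irrefl _), List.findIdx_map (f := Sum.inr), hg₃,
      List.length_map, add_comm]
  have hr₁ : (joinList (D₁.rest (joinList L M)) N).map i₂ = R.filter fun a => !p₁ a := by
    rw [hR, List.filter_append, List.filter_map, show (fun a => !p₁ a) ∘ i₁ =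
      (fun a => !D₁.glued a) by rw [← hg₁]; rfl, ← D₁.map_rest, List.filter_eq_self.2 (by
      simpa using hN₁), joinList, List.map_append, List.map_map, List.map_map, List.map_map]
    exact congrArg₂ (· ++ ·) (List.map_congr_left fun a _ => hi₁ a) rfl
  have hr₃ : (joinList L (D₃.rest (joinList M N))).map i₄ = R.filter fun a => !p₂ a := by
    rw [show R = L.map Sum.inl ++ (joinList M N).map Sum.inr from rfl, List.filter_append,
      List.filter_map (f := Sum.inr), show (fun a => !p₂ a) ∘ Sum.inr =
      (fun a => !D₃.glued a) by rw [← hg₃]; rfl, ← D₃.map_rest, List.filter_eq_self.2 (by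
      simpa using hL₂), joinList, List.map_append, List.map_map, List.map_map, List.map_map]
    rfl
  have hf₂ : (joinList (D₁.rest (joinList L M)) N).findIdx D₂.glued =
      (R.filter fun a => !p₁ a).findIdx p₂ := by rw [← hr₁, List.findIdx_map, hg₂]
  have hf₄ : (joinList L (D₃.rest (joinList M N))).findIdx D₄.glued =
      (R.filter fun a => !p₂ a).findIdx p₁ := by rw [← hr₃, List.findIdx_map, hg₄]
  -- Both lists of remaining outputs become `R` with all glued flags removed once they are embedded
  -- in the union of all flags.
  have hrest : D₂.rest (joinList (D₁.rest (joinList L M)) N) =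
      D₄.rest (joinList L (D₃.rest (joinList M N))) := by
    refine List.map_injective_iff.2 (hi₄.comp D₄.injective) ?_
    have h₄ : ((D₄.rest (joinList L (D₃.rest (joinList M N)))).map (i₄ ∘ D₄.val)) =
        (R.filter fun a => !p₂ a).filter fun a => !p₁ a := by
      rw [← List.map_map, D₄.map_rest, show (fun a => !D₄.glued a) = (fun a => !p₁ a) ∘ i₄ by
        rw [← hg₄]; rfl, ← List.filter_map, hr₃]
    have h₂ : ((D₂.rest (joinList (D₁.rest (joinList L M)) N)).map (i₂ ∘ D₂.val)) =
        (R.filter fun a => !p₁ a).filter fun a => !p₂ a := by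
      rw [← List.map_map, D₂.map_rest, show (fun a => !D₂.glued a) = (fun a => !p₂ a) ∘ i₂ by
        rw [← hg₂]; rfl, ← List.filter_map, hr₁]
    rw [h₄, show i₄ ∘ D₄.val = i₂ ∘ D₂.val from funext hD.val_eq, h₂, List.filter_filter,
      List.filter_filter]
    exact List.filter_congr fun a _ => Bool.and_comm _ _
  have hpar := contract_comm p₁ p₂ (fun a h => by
    have h' : a = Sum.inl s ∨ a = Sum.inr (Sum.inl t) := by simpa [p₁] using h
    rcases h' with rfl | rfl <;> simp [p₂, ht]) hc₁ hc₂
  rw [← hf₂, ← hf₄, hf₁, hf₃] at hpar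
  rw [D₁.sign_eq hT hL hM, D₂.sign_eq hT hP hN, D₃.sign_eq hT hM hN, D₄.sign_eq hT hL hQ,
    contractSign, contractSign, contractSign, contractSign, hrest, ← hL.length_eq]
  set x₁ : ℕ := (joinList L M).findIdx D₁.glued
  set x₂ : ℕ := (joinList (D₁.rest (joinList L M)) N).findIdx D₂.glued
  set x₃ : ℕ := (joinList M N).findIdx D₃.glued
  set x₄ : ℕ := (joinList L (D₃.rest (joinList M N))).findIdx D₄.glued
  have hx : (x₁ : ℤ).negOnePow * (x₂ : ℤ).negOnePow =
      ((L.length : ℤ) + 1).negOnePow * ((x₃ : ℤ).negOnePow * (x₄ : ℤ).negOnePow) := by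
    rw [← Int.negOnePow_add, ← Int.negOnePow_add, ← Int.negOnePow_add]
    refine negOnePow_congr ?_
    obtain ⟨c, hc⟩ := hpar
    refine ⟨c, ?_⟩
    rw [← hc]
    push_cast
    ring
  -- The orientations `c` and `f` of the intermediate corollas `U` and `V` occur twice and drop out.
  have aux : ∀ a b c d e f y₁ y₂ y₃ y₄ z : ℤˣ, y₁ * y₂ = z * (y₃ * y₄) →
      a * b * (y₁ * c) * (c * d * (y₂ * e)) = z * (b * d * (y₃ * f) * (a * f * (y₄ * e))) := by
    intro a b c d e f y₁ y₂ y₃ y₄ z h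
    calc a * b * (y₁ * c) * (c * d * (y₂ * e)) = a * b * d * e * (y₁ * y₂) * (c * c) := by ac_rfl
      _ = a * b * d * e * (z * (y₃ * y₄)) * (f * f) := by rw [h, Int.units_mul_self, Int.units_mul_self]
      _ = _ := by ac_rfl
  exact aux _ _ _ _ _ _ _ _ _ _ _ hx

end Join

/-! ### The bracket of the output suspension -/

/-- The signs of the bracket of the output suspension. -/
def outWeight {T : OpType} (hT : T.Directed) :
    Weight 0 (outSignRule T) (fun i => (i.1.2.2 : ℤ) - 1) where
  coef {X Y _ _ _} D i := (i + X.1.numOut + i * Y.1.numOut).negOnePow * D.sign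
  index_eq {X Y W s t} D := by
    -- The shift is `m - 1` for `m` outputs, one less than in `s_out`, so that the bracket is even.
    -- It is additive because a gluing consumes exactly one output.
    have h := D.numOut_add_one hT
    change (W.1.numOut : ℤ) - 1 = X.1.numOut - 1 + (Y.1.numOut - 1) + (0 : ℕ)
    push_cast
    omega
  equivariant φ ψ χ D D' h i := by
    rw [← φ.numOut_eq, ← ψ.numOut_eq, mul_left_comm, D.sign_equivariant hT φ ψ χ D' h,
      mul_left_comm]
  antisymm {X Y W s t} D i j := by
    change _ = -(((i + ((X.1.numOut : ℤ) - 1)) * (j + ((Y.1.numOut : ℤ) - 1)) + i * j).negOnePow * _)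
    rw [D.sign_symm hT, ← mul_assoc, ← mul_assoc, ← Int.negOnePow_add, ← Int.negOnePow_add,
      ← neg_mul, ← Int.negOnePow_succ]
    congr 1
    refine negOnePow_congr ⟨i + X.1.numOut - i * j - X.1.numOut * Y.1.numOut
      - X.1.numOut * j - 1, by ring⟩
  assoc {X Y Z U V W s t t' w f g D₁ D₂ D₃ D₄} hD i j := by
    have h1 := D₁.numOut_add_one hT
    have h3 := D₃.numOut_add_one hT
    have h1' : (U.1.numOut : ℤ) = X.1.numOut + Y.1.numOut - 1 := by omega
    have h3' : (V.1.numOut : ℤ) = Y.1.numOut + Z.1.numOut - 1 := by omega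
    rw [mul_mul_mul_comm, Join.sign_assoc hT hD, ← Int.negOnePow_add, ← mul_assoc,
      ← Int.negOnePow_add, mul_mul_mul_comm (_ : ℤˣ) D₃.sign, ← Int.negOnePow_add, mul_right_comm,
      ← Int.negOnePow_add]
    congr 1
    rw [h1', h3']
    refine negOnePow_congr ⟨i + X.1.numOut, ?_⟩
    push_cast
    ring

theorem outCls_map {k : Type v} [Field k] {T : OpType} (O : SMod.{u} k T) {X Y : T.Vertex}
    (φ : Corolla.Iso X.1 Y.1) {L : List X.1.Flag} (hL : SMod.IsOutOrder X.1 L) (a : O.obj X) :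
    O.outCls (L.map φ.flag) (O.map φ a) = O.outCls L a := by
  have h : O.twistCls (outSignRule T) 0 outSign Y ((outSignRule T).sgn φ • O.map φ a) =
      O.twistCls (outSignRule T) 0 outSign X a := by
    rw [← SMod.twist_map (O := O) (outSignRule T) 0]
    exact (O.twistColim 0 outSign_eq_sgn).cl_map φ a
  rw [outCls_eq O 0 hL, outCls_eq O 0 (hL.map φ), ← h, map_units_zsmul, smul_smul,
    sgn_eq_orderSign φ hL, ← mul_assoc, Int.units_mul_self, one_mul]

namespace Join

variable {T : OpType} {X Y W : T.Vertex} {s : X.1.Flag} {t : Y.1.Flag}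

theorem glue_inv_eq_iff (D : Join X Y W s t) (f : X.1.Flag ⊕ Y.1.Flag) :
    (Graph.glue X.1 Y.1 s t).inv f = f ↔ D.glued f = false := by
  rw [D.glued_eq_false_iff, D.mem_range]
  exact (Graph.isTwo_glue X.1 Y.1 s t).inv_eq_iff f

open Classical in
/-- The tails of the graph with a single edge, in the order of the list. -/
theorem map_glueIso_filterMap (D : Join X Y W s t) (R : List (X.1.Flag ⊕ Y.1.Flag)) :
    (R.filterMap fun f => if hf : (Graph.glue X.1 Y.1 s t).inv f = f then
      some (⟨f, hf⟩ : ((Graph.glue X.1 Y.1 s t).residue T).Flag) else none).map D.glueIso.flag =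
    D.rest R := by
  have h : ∀ K : List ((Graph.glue X.1 Y.1 s t).residue T).Flag,
      (K.map D.glueIso.flag).map D.val = K.map fun f => (f.1 : X.1.Flag ⊕ Y.1.Flag) :=
    fun K => List.map_map.trans (List.map_congr_left fun f _ => D.glueIso_spec f)
  refine D.eq_rest ((h _).trans ?_)
  induction R with
  | nil => rfl
  | cons f R ih =>
    by_cases hf : (Graph.glue X.1 Y.1 s t).inv f = f
    · refine (congrArg (List.map _) (List.filterMap_cons_some (dif_pos hf))).trans ?_
      rw [List.filter_cons_of_pos (by simpa using (D.glue_inv_eq_iff f).1 hf)]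
      exact congrArg (f :: ·) ih
    · refine (congrArg (List.map _) (List.filterMap_cons_none (dif_neg hf))).trans ?_
      rw [List.filter_cons_of_neg (by simpa using mt (D.glue_inv_eq_iff f).2 hf)]
      exact ih

end Join

namespace Gluing

variable {k : Type v} [Field k] {T : OpType} (hT : T.Directed) {O : SMod.{u} k T} (G : Gluing 0 O)
  {X Y : T.Vertex}

/-- The glued output and the remaining tails, defined by the involution of the graph, are matched
with `glued` and `rest` of the standard join. -/
theorem outTerm_eq {L : List X.1.Flag} {M : List Y.1.Flag} (hL : SMod.IsOutOrder X.1 L)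
    (hM : SMod.IsOutOrder Y.1 M) (δ : T.Index → ℤ) (a : O.obj X) (b : O.obj Y) (q : Pairs X Y) :
    G.outTerm L M a b q.1.1 q.1.2 = q.join.contractSign (joinList L M) •
      O.twistCls (outSignRule T) δ outSign _ (G.gl q.join a b) := by
  classical
  have hr := q.join.isOutOrder_rest hL hM
  have hK := q.join.map_glueIso_filterMap (joinList L M)
  set K := (joinList L M).filterMap fun f =>
    if hf : (Graph.glue X.1 Y.1 q.1.1 q.1.2).inv f = f then
      some (⟨f, hf⟩ : ((Graph.glue X.1 Y.1 q.1.1 q.1.2).residue T).Flag) else none with hKdef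
  have hKo : SMod.IsOutOrder ((Graph.glue X.1 Y.1 q.1.1 q.1.2).residue T) K := by
    have h := hr.map q.join.glueIso.symm
    have h' : (K.map q.join.glueIso.flag).map q.join.glueIso.symm.flag = K :=
      List.map_map.trans ((List.map_congr_left fun f _ =>
        q.join.glueIso.flag.symm_apply_apply f).trans (List.map_id K))
    rw [hK] at h'
    exact h' ▸ h
  have h1 : O.outCls (X := (Graph.glue X.1 Y.1 q.1.1 q.1.2).total q.join.admissible) K
      (G.glue₂ q.1.1 q.1.2 q.join.admissible a b) =
      orderSign _ (q.join.rest (joinList L M)) •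
        O.twistCls (outSignRule T) δ outSign _ (G.gl q.join a b) := by
    rw [← outCls_eq O δ hr, ← hK]
    exact (outCls_map O (X := (Graph.glue X.1 Y.1 q.1.1 q.1.2).total q.join.admissible)
      q.join.glueIso hKo _).symm
  have h2 : (joinList L M).findIdx (fun f => decide ((Graph.glue X.1 Y.1 q.1.1 q.1.2).inv f ≠ f)) =
      (joinList L M).findIdx q.join.glued := by
    congr 1
    funext f
    rw [Bool.eq_iff_iff, decide_eq_true_iff]
    exact (not_congr (q.join.glue_inv_eq_iff f)).trans (by rw [Bool.not_eq_false])
  rw [Join.contractSign, mul_smul, ← h1, ← h2]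
  refine (dif_pos q.join.admissible).trans ?_
  congr!

theorem finsum_outTerm {L : List X.1.Flag} {M : List Y.1.Flag} (hL : SMod.IsOutOrder X.1 L)
    (hM : SMod.IsOutOrder Y.1 M) (i : ℤ) (a : O.obj X) (b : O.obj Y) :
    (i + L.length + i * M.length).negOnePow •
        ∑ᶠ (s : X.1.Flag) (t : Y.1.Flag), G.outTerm L M a b s t =
      (orderSign X L * orderSign Y M) • ∑ q : Pairs X Y, (outWeight hT).coef q.join i •
        O.twistCls (outSignRule T) (fun i => (i.1.2.2 : ℤ) - 1) outSign _ (G.gl q.join a b) := by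
  rw [finsum_pairs _ fun s t h => dif_neg fun h' => h ((Graph.glue_admissible_iff X Y s t).1 h'),
    Finset.smul_sum, Finset.smul_sum]
  refine Finset.sum_congr rfl fun q _ => ?_
  change _ = (orderSign X L * orderSign Y M) •
    ((i + X.1.numOut + i * Y.1.numOut).negOnePow * q.join.sign) • _
  rw [G.outTerm_eq hL hM (fun i => (i.1.2.2 : ℤ) - 1), hL.length_eq, hM.length_eq, smul_smul,
    smul_smul, q.join.sign_eq hT hL hM, mul_left_comm, ← mul_assoc (orderSign X L * orderSign Y M),
    Int.units_mul_self, one_mul]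

theorem isOutBracket_iff {br : O.OutCoinv →ₗ[k] O.OutCoinv →ₗ[k] O.OutCoinv} :
    G.IsOutBracket br ↔ br = G.bracket (outWeight hT) outSign_eq_sgn := by
  constructor
  · intro h
    refine G.eq_bracket _ _ fun X Y i j a b ha _ => ?_
    obtain ⟨L, hL⟩ := X.1.exists_isOutOrder
    obtain ⟨M, hM⟩ := Y.1.exists_isOutOrder
    have h1 := h X Y L M i a b hL hM ha
    rw [G.finsum_outTerm hT hL hM, outCls_eq O (fun i => (i.1.2.2 : ℤ) - 1) hL,
      outCls_eq O (fun i => (i.1.2.2 : ℤ) - 1) hM, map_units_zsmul_left, map_units_zsmul,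
      smul_smul] at h1
    -- Both sides carry the same invertible sign, that of the enumerations `L` and `M`.
    exact smul_left_cancel _ h1
  · rintro rfl X Y L M i a b hL hM ha
    rw [G.finsum_outTerm hT hL hM, outCls_eq O (fun i => (i.1.2.2 : ℤ) - 1) hL,
      outCls_eq O (fun i => (i.1.2.2 : ℤ) - 1) hM, map_units_zsmul_left, map_units_zsmul,
      smul_smul, G.bracket_twistCls _ _ ha]

theorem isOddLieBracket_outBracket :
    IsOddLieBracket O.outCoinvGr (G.bracket (outWeight hT) outSign_eq_sgn) := by
  apply IsLieBracket.odd
  have h := G.isLieBracket_bracket (outWeight hT) outSign_eq_sgn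
  convert h using 2 with d
  simp only [SMod.outCoinvGr, SMod.coinvByGr]
  congr! 5
  ring

end Gluing

end OddBracket

end

/-! ### The theorem -/

theorem mainTheorem1 (k : Type v) [Field k] [CharZero k] :
    -- `𝔎`-twisted structures `O` of every type: natural odd Lie bracket;
    -- for their shifts `Σ⁻¹ O`, which are twisted by `𝔎 𝔇_Σ⁻¹` (anti-modular, anti-cyclic): Lie bracket
    (∀ (T : OpType) (O : SMod.{u} k T) (G : Gluing 1 O),
      (∃! br, G.IsOddBracket br) ∧
      ∀ br, G.IsOddBracket br →
        IsOddLieBracket (O.coinvGr 0) br ∧ IsLieBracket (O.coinvGr (-1)) br) ∧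
    (∀ (T : OpType) (O O' : SMod.{u} k T) (G : Gluing 1 O) (G' : Gluing 1 O') (f : SMod.Hom O O'),
      G.IsHom G' f → ∀ br br', G.IsOddBracket br → G'.IsOddBracket br' →
      ∀ x y, f.coinv _ (br x y) = br' (f.coinv _ x) (f.coinv _ y)) ∧
    -- operads, (wheeled) PROP(erad)s: natural Lie bracket
    (∀ (T : OpType), T.Directed → ∀ (P : SMod.{u} k T) (G : Gluing 0 P),
      (∃! br, G.IsCommutator br) ∧
      ∀ br, G.IsCommutator br → IsLieBracket (P.coinvGr 0) br) ∧
    (∀ (T : OpType), T.Directed → ∀ (P P' : SMod.{u} k T) (G : Gluing 0 P) (G' : Gluing 0 P')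
      (f : SMod.Hom P P'),
      G.IsHom G' f → ∀ br br', G.IsCommutator br → G'.IsCommutator br' →
      ∀ x y, f.coinv _ (br x y) = br' (f.coinv _ x) (f.coinv _ y)) ∧
    -- odd operads `Σ P`, `P` an operad: odd Lie bracket
    (∀ (P : SMod.{u} k OpType.operad) (G : Gluing 0 P),
      ∀ br, G.IsCommutator br → IsOddLieBracket (P.coinvGr 1) br) ∧
    -- odd (wheeled) PROP(erad)s `s_out P`, `P` a (wheeled) PROP(erad): natural odd Lie bracket
    (∀ (T : OpType), T.Directed → ∀ (P : SMod.{u} k T) (G : Gluing 0 P),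
      (∃! br, G.IsOutBracket br) ∧
      ∀ br, G.IsOutBracket br → IsOddLieBracket P.outCoinvGr br) ∧
    (∀ (T : OpType), T.Directed → ∀ (P P' : SMod.{u} k T) (G : Gluing 0 P) (G' : Gluing 0 P')
      (f : SMod.Hom P P'),
      G.IsHom G' f → ∀ br br', G.IsOutBracket br → G'.IsOutBracket br' →
      ∀ x y, f.coinv _ (br x y) = br' (f.coinv _ x) (f.coinv _ y)) ∧
    -- anti-cyclic operads `P`: natural Lie bracket; odd cyclic operads `Σ P`: odd Lie bracket
    (∀ (P : SMod.{u} k OpType.cyclic) (G : AntiCyclic P),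
      (∃! br, G.IsBracket br) ∧
      ∀ br, G.IsBracket br →
        IsLieBracket (P.coinvGr 0) br ∧ IsOddLieBracket (P.coinvGr 1) br) ∧
    (∀ (P P' : SMod.{u} k OpType.cyclic) (G : AntiCyclic P) (G' : AntiCyclic P')
      (f : SMod.Hom P P'),
      G.IsHom G' f → ∀ br br', G.IsBracket br → G'.IsBracket br' →
      ∀ x y, f.coinv _ (br x y) = br' (f.coinv _ x) (f.coinv _ y)) := by
  refine ⟨fun T O G => ⟨⟨_, G.isOddBracket_iff.2 rfl, fun br h => G.isOddBracket_iff.1 h⟩, ?_⟩, ?_,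
    fun T hT P G => ⟨⟨_, (G.isCommutator_iff hT).2 rfl, fun br h => (G.isCommutator_iff hT).1 h⟩, ?_⟩,
    ?_, ?_,
    fun T hT P G => ⟨⟨_, (G.isOutBracket_iff hT).2 rfl, fun br h => (G.isOutBracket_iff hT).1 h⟩, ?_⟩,
    ?_, fun P G => ⟨⟨_, G.isBracket_iff.2 rfl, fun br h => G.isBracket_iff.1 h⟩, ?_⟩, ?_⟩
  · intro br h
    rw [G.isOddBracket_iff.1 h]
    have hl : IsLieBracket (O.coinvGr (-1)) (G.bracket (oddWeight T) fun _ _ => rfl) :=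
      G.isLieBracket_bracket (oddWeight T) _
    exact ⟨isOddLieBracket_coinvGr hl, hl⟩
  · intro T O O' G G' f hf br br' h h'
    rw [G.isOddBracket_iff.1 h, G'.isOddBracket_iff.1 h']
    exact G.bracket_natural G' _ _ hf
  · intro br h
    rw [(G.isCommutator_iff hT).1 h]
    exact G.isLieBracket_bracket (commWeight hT) _
  · intro T hT P P' G G' f hf br br' h h'
    rw [(G.isCommutator_iff hT).1 h, (G'.isCommutator_iff hT).1 h']
    exact G.bracket_natural G' _ _ hf
  · intro P G br h
    have hT : OpType.operad.Directed := trivial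
    rw [(G.isCommutator_iff hT).1 h]
    -- The bracket is unchanged: it is even for the shift `0`, hence odd for the shift `1`.
    exact isOddLieBracket_coinvGr (c := 1) (G.isLieBracket_bracket (commWeight hT) _)
  · intro br h
    rw [(G.isOutBracket_iff hT).1 h]
    exact G.isOddLieBracket_outBracket hT
  · intro T hT P P' G G' f hf br br' h h'
    rw [(G.isOutBracket_iff hT).1 h, (G'.isOutBracket_iff hT).1 h']
    exact G.bracket_natural G' _ _ hf
  · intro br h
    rw [G.isBracket_iff.1 h]
    exact ⟨G.isLieBracket_bracket, isOddLieBracket_coinvGr (c := 1) G.isLieBracket_bracket⟩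
  · intro P P' G G' f hf br br' h h'
    rw [G.isBracket_iff.1 h, G'.isBracket_iff.1 h']
    exact G.bracket_natural G' hf
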